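/- **Setting.** Let $T>0$ and let $W$ be a standard $n$-dimensional Brownian motion on a complete probability space, with its natural (null-set completed) filtration $(\mathcal F_s)$. Let $b$ and $\sigma$ be deterministic continuous functions on $[0,T]$ with values in $\mathbb R^n$ and in the nonsingular $n\times n$ matrices, and let $K\subset\mathbb R^n$ be a nonempty closed convex cone. For $0\le t\le T$ and $x>0$ let $$V(t,x)=\sup E[U(X_T)],$$ where the supremum is over all progressively measurable $\pi$ with $\pi_s\in K$ a.s. for each $s\in[t,T]$ and all nonnegative continuous adapted solutions $X$ of $$dX_s=X_s\big(\pi_s' b(s)\,ds+\pi_s'\sigma(s)\,dW_s\big),\qquad t\le s\le T,\qquad X_t=x.$$ Put $\theta(t)=\sigma(t)^{-1}b(t)$ and $\tilde K=\{p: p'v\ge 0\ \text{for all } v\in K\}$, let $\hat\pi(t)$ be the unique minimizer of $|\theta(t)+\sigma(t)^{-1}p|^2$ over $p\in\tilde K$, and put $\hat\theta(t)=\theta(t)+\sigma(t)^{-1}\hat\pi(t)$. Assume: * $\hat\theta$ is continuous on $[0,T]$ and there is a constant $\theta_0>0$ with $|\hat\theta(t)|\ge\theta_0$ for all $t\in[0,T]$;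 * $U:[0,\infty)\to\mathbb R$ is continuous, increasing and concave, $U(0)=0$, $\lim_{x\to\infty}U(x)=\infty$, and there are constants $L>0$, $0<p<1$ with $0\le U(x)\le L(1+x^p)$ for all $x\ge0$. **Theorem.** Suppose in addition that $U$ is $C^1$ on $(0,\infty)$, strictly increasing and strictly concave. Then for every $t\in[0,T)$ the function $V(t,\cdot)$ is finite and differentiable on $(0,\infty)$ with $V_x(t,\cdot)>0$, and moreover: * if $\ln U'$ is convex on $(0,\infty)$, then $\ln V_x(t,\cdot)$ is strictly convex on $(0,\infty)$ for every $t\in[0,T)$; * if $\ln U'$ is concave on $(0,\infty)$, then $\ln V_x(t,\cdot)$ is strictly concave on $(0,\infty)$ for every $t\in[0,T)$. -/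

import Mathlib

open MeasureTheory ProbabilityTheory Filter Topology
open scoped NNReal ENNReal RealInnerProductSpace

namespace UtilityMax

section BrownianMotion

variable {Ω : Type*} {mΩ : MeasurableSpace Ω} {n : ℕ}

/-- `W` is a standard `n`-dimensional Brownian motion under `P`: its coordinates are independent
one-dimensional standard Brownian motions. -/
structure IsStandardBrownian (W : ℝ≥0 → Ω → EuclideanSpace ℝ (Fin n)) (P : Measure Ω) : Prop where
  measurable : ∀ s, Measurable (W s)
  isBrownianReal : ∀ i, IsBrownianReal (fun s ω => W s ω i) P
  indep : iIndepFun (fun (i : Fin n) (ω : Ω) (s : ℝ≥0) => W s ω i) P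

/-- The natural filtration generated by `W`, completed by the `P`-null sets. -/
def brownianFiltration (P : Measure Ω) (W : ℝ≥0 → Ω → EuclideanSpace ℝ (Fin n))
    (hW : ∀ s, Measurable (W s)) : Filtration ℝ≥0 mΩ where
  seq s := (⨆ r : Set.Iic s, MeasurableSpace.comap (W r) inferInstance) ⊔
    MeasurableSpace.generateFrom {A : Set Ω | MeasurableSet A ∧ P A = 0}
  mono' := by
    intro s s' hs
    refine sup_le_sup_right (iSup_le fun r => ?_) _
    exact le_iSup (fun q : Set.Iic s' => MeasurableSpace.comap (W q) inferInstance)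
      ⟨r.1, le_trans r.2 hs⟩
  le' := by
    intro s
    refine sup_le (iSup_le fun r => (hW r).comap_le) ?_
    exact MeasurableSpace.generateFrom_le fun A hA => hA.1

/-- A simple (bounded, piecewise constant, adapted) process
`H_s = ∑ i < N, ξ i · 1_{(τ i, τ (i+1)]}(s)` with deterministic times `τ i` and bounded
`𝓕 (τ i)`-measurable coefficients `ξ i`. -/
structure SimpleProcess (𝓕 : Filtration ℝ≥0 mΩ) (n : ℕ) where
  N : ℕ
  τ : ℕ → ℝ≥0
  mono : Monotone τ
  ξ : ℕ → Ω → EuclideanSpace ℝ (Fin n)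
  measurable : ∀ i, Measurable[𝓕 (τ i)] (ξ i)
  bounded : ∃ C : ℝ, ∀ i ω, ‖ξ i ω‖ ≤ C

/-- The value of a simple process at time `s`. -/
noncomputable def SimpleProcess.val {𝓕 : Filtration ℝ≥0 mΩ} (H : SimpleProcess 𝓕 n)
    (s : ℝ≥0) (ω : Ω) : EuclideanSpace ℝ (Fin n) :=
  ∑ i ∈ Finset.range H.N, (Set.Ioc (H.τ i) (H.τ (i + 1))).indicator (fun _ => H.ξ i ω) s

/-- The elementary stochastic integral `∫_t^s H' dW` of a simple process, for `t ≤ s`. -/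
noncomputable def SimpleProcess.integral {𝓕 : Filtration ℝ≥0 mΩ} (H : SimpleProcess 𝓕 n)
    (W : ℝ≥0 → Ω → EuclideanSpace ℝ (Fin n)) (t s : ℝ≥0) (ω : Ω) : ℝ :=
  ∑ i ∈ Finset.range H.N,
    (⟪H.ξ i ω, W (min s (H.τ (i + 1))) ω - W (min s (H.τ i)) ω⟫ -
      ⟪H.ξ i ω, W (min t (H.τ (i + 1))) ω - W (min t (H.τ i)) ω⟫)

/-- `I_s = ∫_t^s H_r' dW_r` for `s ∈ [t,T]` as an Itô integral: there are simple processes `Hₖ` with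
`∫_t^T |Hₖ - H|² ds → 0` in probability and `sup_{t ≤ s ≤ T} |∫_t^s Hₖ' dW - I_s| → 0` in
probability. The first condition forces `∫_t^T |H|² ds < ∞` almost surely; the process `I` is then
unique up to indistinguishability. -/
def IsItoIntegral (P : Measure Ω) (𝓕 : Filtration ℝ≥0 mΩ)
    (W : ℝ≥0 → Ω → EuclideanSpace ℝ (Fin n)) (t T : ℝ≥0)
    (H : ℝ≥0 → Ω → EuclideanSpace ℝ (Fin n)) (I : ℝ≥0 → Ω → ℝ) : Prop :=
  ∃ Hs : ℕ → SimpleProcess 𝓕 n,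
    (∀ ε : ℝ≥0∞, 0 < ε → Tendsto (fun k =>
      P {ω | ε ≤ ∫⁻ r in Set.Icc (t : ℝ) T,
        ‖(Hs k).val r.toNNReal ω - H r.toNNReal ω‖ₑ ^ 2}) atTop (𝓝 0)) ∧
    (∀ ε : ℝ≥0∞, 0 < ε → Tendsto (fun k =>
      P {ω | ε ≤ ⨆ s ∈ Set.Icc t T, ‖(Hs k).integral W t s ω - I s ω‖ₑ}) atTop (𝓝 0))

end BrownianMotion

section Control

variable {Ω : Type*} {mΩ : MeasurableSpace Ω} {n : ℕ}

/-- `X` is a nonnegative wealth process on `[t,T]` with initial wealth `X_t = x`, driven by the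
portfolio `π` (proportions of wealth): `π` is progressively measurable with values in `K`, and `X`
is adapted, continuous, nonnegative and satisfies
`dX_s = X_s (π_s' b(s) ds + π_s' σ(s) dW_s)`. -/
structure IsWealthProcess (P : Measure Ω) (𝓕 : Filtration ℝ≥0 mΩ)
    (W : ℝ≥0 → Ω → EuclideanSpace ℝ (Fin n))
    (b : ℝ≥0 → EuclideanSpace ℝ (Fin n)) (σ : ℝ≥0 → Matrix (Fin n) (Fin n) ℝ)
    (K : ProperCone ℝ (EuclideanSpace ℝ (Fin n))) (T t : ℝ≥0) (x : ℝ)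
    (π : ℝ≥0 → Ω → EuclideanSpace ℝ (Fin n)) (X : ℝ≥0 → Ω → ℝ) : Prop where
  progressive : IsProgressive 𝓕 π
  mem_cone : ∀ s ∈ Set.Icc t T, ∀ᵐ ω ∂P, π s ω ∈ K
  adapted : ∀ s ∈ Set.Icc t T, Measurable[𝓕 s] (X s)
  continuous : ∀ᵐ ω ∂P, ContinuousOn (fun s => X s ω) (Set.Icc t T)
  nonneg : ∀ᵐ ω ∂P, ∀ s ∈ Set.Icc t T, 0 ≤ X s ω
  integrable_drift : ∀ᵐ ω ∂P,
    IntervalIntegrable (fun r : ℝ => X r.toNNReal ω * ⟪π r.toNNReal ω, b r.toNNReal⟫) volume t T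
  sde : IsItoIntegral P 𝓕 W t T
    (fun s ω => X s ω • (σ s).transpose.toEuclideanLin (π s ω))
    (fun s ω => X s ω - x -
      ∫ r : ℝ in (t : ℝ)..s, X r.toNNReal ω * ⟪π r.toNNReal ω, b r.toNNReal⟫)

/-- The value function `V(t,x) = sup E[U(X_T)]`, the supremum over all admissible portfolios and
the corresponding nonnegative wealth processes with `X_t = x`. It is used only for utilities that
are nonnegative on `[0,∞)`, so the expectation is that of a nonnegative random variable. -/
noncomputable def valueFunction (P : Measure Ω) (𝓕 : Filtration ℝ≥0 mΩ)
    (W : ℝ≥0 → Ω → EuclideanSpace ℝ (Fin n))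
    (b : ℝ≥0 → EuclideanSpace ℝ (Fin n)) (σ : ℝ≥0 → Matrix (Fin n) (Fin n) ℝ)
    (K : ProperCone ℝ (EuclideanSpace ℝ (Fin n))) (U : ℝ → ℝ) (T t : ℝ≥0) (x : ℝ) : ℝ≥0∞ :=
  ⨆ (π : ℝ≥0 → Ω → EuclideanSpace ℝ (Fin n)) (X : ℝ≥0 → Ω → ℝ)
    (_ : IsWealthProcess P 𝓕 W b σ K T t x π X), ∫⁻ ω, ENNReal.ofReal (U (X T ω)) ∂P

end Control

section Coefficients

variable {n : ℕ}

/-- The shifted price of risk `θ + σ⁻¹ p`, where `θ = σ⁻¹ b`. -/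
noncomputable def shiftedPrice (b : EuclideanSpace ℝ (Fin n)) (σ : Matrix (Fin n) (Fin n) ℝ)
    (p : EuclideanSpace ℝ (Fin n)) : EuclideanSpace ℝ (Fin n) :=
  σ⁻¹.toEuclideanLin b + σ⁻¹.toEuclideanLin p

/-- `p` minimizes `|θ + σ⁻¹ p|²` over the positive polar cone `{p | p' v ≥ 0 for all v ∈ K}`. -/
def IsDualMinimizer (b : EuclideanSpace ℝ (Fin n)) (σ : Matrix (Fin n) (Fin n) ℝ)
    (K : ProperCone ℝ (EuclideanSpace ℝ (Fin n))) (p : EuclideanSpace ℝ (Fin n)) : Prop :=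
  p ∈ ProperCone.innerDual (K : Set (EuclideanSpace ℝ (Fin n))) ∧
    ∀ q ∈ ProperCone.innerDual (K : Set (EuclideanSpace ℝ (Fin n))),
      ‖shiftedPrice b σ p‖ ^ 2 ≤ ‖shiftedPrice b σ q‖ ^ 2

/-- The minimizer `π̂`; for nonsingular `σ` it exists and is unique, see
`existsUnique_isDualMinimizer`. -/
noncomputable def dualMinimizer (b : EuclideanSpace ℝ (Fin n)) (σ : Matrix (Fin n) (Fin n) ℝ)
    (K : ProperCone ℝ (EuclideanSpace ℝ (Fin n))) : EuclideanSpace ℝ (Fin n) :=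
  Classical.epsilon (IsDualMinimizer b σ K)

/-- `θ̂ = θ + σ⁻¹ π̂`. -/
noncomputable def thetaHat (b : EuclideanSpace ℝ (Fin n)) (σ : Matrix (Fin n) (Fin n) ℝ)
    (K : ProperCone ℝ (EuclideanSpace ℝ (Fin n))) : EuclideanSpace ℝ (Fin n) :=
  shiftedPrice b σ (dualMinimizer b σ K)

theorem existsUnique_isDualMinimizer (b : EuclideanSpace ℝ (Fin n))
    (σ : Matrix (Fin n) (Fin n) ℝ) (hσ : IsUnit σ.det)
    (K : ProperCone ℝ (EuclideanSpace ℝ (Fin n))) : ∃! p, IsDualMinimizer b σ K p := by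
  set D := ProperCone.innerDual (K : Set (EuclideanSpace ℝ (Fin n))) with hD
  set A : EuclideanSpace ℝ (Fin n) →ₗ[ℝ] EuclideanSpace ℝ (Fin n) := σ⁻¹.toEuclideanLin with hA
  set B : EuclideanSpace ℝ (Fin n) →ₗ[ℝ] EuclideanSpace ℝ (Fin n) := σ.toEuclideanLin with hB
  have hBA : ∀ v, B (A v) = v := by
    intro v
    ext i
    simp [hA, hB, Matrix.toLpLin_apply, Matrix.mulVec_mulVec, Matrix.mul_nonsing_inv σ hσ]
  have hAB : ∀ v, A (B v) = v := by
    intro v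
    ext i
    simp [hA, hB, Matrix.toLpLin_apply, Matrix.mulVec_mulVec, Matrix.nonsing_inv_mul σ hσ]
  set S : Set (EuclideanSpace ℝ (Fin n)) := {v | B (v - A b) ∈ D} with hS
  have hmem : ∀ p ∈ D, A b + A p ∈ S := by
    intro p hp
    simpa [hS, hBA] using hp
  have hSne : S.Nonempty := ⟨_, hmem 0 D.zero_mem⟩
  have hBc : Continuous B := LinearMap.continuous_of_finiteDimensional B
  have hSc : IsClosed S := D.isClosed.preimage (hBc.comp (continuous_id.sub continuous_const))
  have hconv : Convex ℝ S := by
    intro v hv w hw a c ha hc hac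
    have h1 : B (a • v + c • w - A b) = a • B (v - A b) + c • B (w - A b) := by
      rw [← map_smul, ← map_smul, ← map_add]
      congr 1
      have : A b = (a + c) • A b := by rw [hac, one_smul]
      nth_rewrite 1 [this]
      module
    change B (a • v + c • w - A b) ∈ D
    rw [h1]
    exact D.toPointedCone.add_mem (D.toPointedCone.smul_mem ha hv)
      (D.toPointedCone.smul_mem hc hw)
  obtain ⟨v, hvS, hv⟩ := exists_norm_eq_iInf_of_complete_convex hSne hSc.isComplete hconv 0
  have hvmin : ∀ w ∈ S, ‖v‖ ≤ ‖w‖ := by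
    intro w hw
    have h1 : ‖(0 : EuclideanSpace ℝ (Fin n)) - v‖ ≤ ‖(0 : EuclideanSpace ℝ (Fin n)) - w‖ := by
      rw [hv]
      exact ciInf_le (f := fun w : S => ‖(0 : EuclideanSpace ℝ (Fin n)) - w‖)
        ⟨0, by rintro _ ⟨w, rfl⟩; positivity⟩ ⟨w, hw⟩
    simpa using h1
  have hpv : A b + A (B (v - A b)) = v := by rw [hAB]; abel
  refine ⟨B (v - A b), ⟨hvS, fun q hq => ?_⟩, fun q hq => ?_⟩
  · change ‖A b + A (B (v - A b))‖ ^ 2 ≤ ‖A b + A q‖ ^ 2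
    rw [hpv]
    exact pow_le_pow_left₀ (norm_nonneg _) (hvmin _ (hmem q hq)) 2
  · have hqS := hmem q hq.1
    have h1 : ‖A b + A q‖ ^ 2 ≤ ‖v‖ ^ 2 := by
      have := hq.2 _ hvS
      change ‖A b + A q‖ ^ 2 ≤ ‖A b + A (B (v - A b))‖ ^ 2 at this
      rwa [hpv] at this
    have hmid := hvmin _ (hconv hvS hqS (by norm_num : (0 : ℝ) ≤ 1 / 2)
      (by norm_num : (0 : ℝ) ≤ 1 / 2) (by norm_num))
    rw [← smul_add, norm_smul] at hmid
    have hpar := parallelogram_law_with_norm ℝ v (A b + A q)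
    have hmid2 : 2 * ‖v‖ ≤ ‖v + (A b + A q)‖ := by
      rw [Real.norm_of_nonneg (by norm_num : (0 : ℝ) ≤ 1 / 2)] at hmid
      linarith
    have hz : ‖v - (A b + A q)‖ = 0 := by
      have h3 := norm_nonneg v
      have h4 := norm_nonneg (v - (A b + A q))
      have : ‖v - (A b + A q)‖ * ‖v - (A b + A q)‖ ≤ 0 := by nlinarith
      nlinarith
    have hveq : v = A b + A q := sub_eq_zero.mp (norm_eq_zero.mp hz)
    rw [hveq]
    simp [hBA]

end Coefficients

/-- The standing assumption on the utility function: `U` is continuous, increasing and concave on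
`[0,∞)`, with `U(0) = 0`, `U(∞) = ∞` and `0 ≤ U(x) ≤ L (1 + x^p)` for some `L > 0`, `0 < p < 1`. -/
structure UtilityAssumption (U : ℝ → ℝ) : Prop where
  continuousOn : ContinuousOn U (Set.Ici 0)
  monotoneOn : MonotoneOn U (Set.Ici 0)
  concaveOn : ConcaveOn ℝ (Set.Ici 0) U
  zero : U 0 = 0
  tendsto_atTop : Tendsto U atTop atTop
  growth : ∃ L p : ℝ, 0 < L ∧ 0 < p ∧ p < 1 ∧
    ∀ x : ℝ, 0 ≤ x → 0 ≤ U x ∧ U x ≤ L * (1 + x ^ p)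

/-- The standing assumption on `θ̂`: it is continuous on `[0,T]` and `|θ̂|` is bounded below by a
positive constant there. -/
def ParabolicityAssumption {n : ℕ} (b : ℝ≥0 → EuclideanSpace ℝ (Fin n))
    (σ : ℝ≥0 → Matrix (Fin n) (Fin n) ℝ) (K : ProperCone ℝ (EuclideanSpace ℝ (Fin n)))
    (T : ℝ≥0) : Prop :=
  ContinuousOn (fun s => thetaHat (b s) (σ s) K) (Set.Icc 0 T) ∧
    ∃ θ₀ : ℝ, 0 < θ₀ ∧ ∀ s ∈ Set.Icc 0 T, θ₀ ≤ ‖thetaHat (b s) (σ s) K‖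

end UtilityMax

/-!
# Log-convexity of the marginal value of terminal wealth

The value function is computed by convex duality. Put `v = ∫_t^T |θ̂|²`, which is positive since
`θ̂` does not vanish, let `Φ` be the inverse of `ln U'` (`inverseMarginal`), extended by `0` above
the range of `ln U'`, and let `Ψ(z) = U(Φ(z)) - e^z Φ(z)` be the conjugate utility (`conjugate`).
The function `h(z) = ∫ Φ(z + g) N(v/2, v)(dg)` (`dualWealth`) is a continuous strictly decreasing
map of `ℝ` onto `(0, ∞)`. With its inverse `Z` the claim is that `V_x(t, ·) = e^Z`.

*Upper bound* (`valueFunction_le`). The polar cone inequality `⟨π, b⟩ ≤ ⟨σ'π, θ̂⟩` for `π ∈ K`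
(`inner_le_of_mem_cone`) says that wealth grows no faster than a stochastic integral against the
Brownian motion with drift `θ̂`. Outside an event of small probability that integral is uniformly
close to the one of a simple process, sampled on a partition. There the Girsanov density for a step
function near `θ̂` is an explicit log-normal product (`partitionWeight`), under which the drifted
increments are centred Gaussian. Since wealth is nonnegative, stopping the discrete sum when it
becomes negative changes nothing off the exceptional event, and by the fourth moments of the
increments the overshoot is negligible; so the weighted mean of the terminal wealth is at most `x`
up to small errors. Fenchel's inequality `U(a) ≤ Ψ(ζ) + e^ζ a`, at `ζ = z` plus the log-density,
then gives `V(t, x) ≤ e(z) + e^z x` for every `z`, with `e(z) = ∫ Ψ(z + g) N(-v/2, v)(dg)`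
(`dualValue`). No stochastic integration theory beyond simple processes is needed.

*Lower bound* (`lintegral_le_valueFunction_of_monotone`). A nondecreasing payoff of the drifted
Wiener integral `∫_t^T θ̂' dW + v` is replicated from its Gaussian expectation by delta hedging
along the heat flow. The portfolio is a nonnegative multiple of `(σ')⁻¹ θ̂`, which lies in the
bipolar of `K`, hence in `K` (`transpose_inv_thetaHat_mem`), and complementary slackness at the dual
minimizer identifies its drift. For smooth payoffs, Itô's formula (`isItoIntegral_hedgeValue`) is
proved by showing that discretely rebalanced hedging errors are martingale differences whose second
moments sum to zero in the limit; Kolmogorov's inequality makes the convergence uniform in time.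
Applied to `Φ` of `z` plus the log-density, this attains the upper bound at `x = h(z)`
(`le_valueFunction_dualWealth`).

*Conclusion.* By the two bounds `V(t, ·)` is finite and `e^{Z(x)}` is a supergradient at each `x`.
As `Z` is continuous, `V(t, ·)` is differentiable with derivative `e^Z`
(`SmoothUtility.hasDerivAt_valueFunction`), so `ln V_x(t, ·) = Z`. If `ln U'` is convex then so is
`Φ` (`convexOn_inverseMarginal`); its average `h` against a law of full support is strictly convex
(`strictConvexOn_dualWealth`), because `Φ`, being bounded below and not constant, cannot be affine
along all arithmetic progressions of a given step; and the inverse of a strictly decreasing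
strictly convex function is strictly convex. In the opposite case there is nothing to prove: for a
strictly concave utility, concavity of `ln U'` forces `U'` to decay exponentially, so `U` would be
bounded, in contradiction to `U(∞) = ∞` (`not_concaveOn_log_deriv`).
-/

namespace UtilityMax

/-! ### Past and future of a Brownian motion -/

section Brownian

variable {Ω : Type*} {mΩ : MeasurableSpace Ω} {n : ℕ} {P : Measure Ω}
  {W : ℝ≥0 → Ω → EuclideanSpace ℝ (Fin n)}

lemma IsStandardBrownian.measurable_coord (hW : IsStandardBrownian W P) (s : ℝ≥0) (i : Fin n) :
    Measurable (fun ω => W s ω i) := by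
  have := hW.measurable s
  fun_prop

/-- The coordinates of a Brownian motion at all times form one Gaussian process. -/
lemma IsStandardBrownian.isGaussianProcess (hW : IsStandardBrownian W P) :
    IsGaussianProcess (fun (p : Fin n × ℝ≥0) ω => W p.2 ω p.1) P where
  hasGaussianLaw I := by
    classical
    set J : Finset ℝ≥0 := I.image Prod.snd with hJ
    have h1 : HasGaussianLaw (fun ω (i : Fin n) => J.restrict (fun s => W s ω i)) P := by
      refine iIndepFun.hasGaussianLaw (fun i => ?_) ?_
      · have hWi := (hW.isBrownianReal i).toIsPreBrownianReal
        exact hWi.isGaussianProcess.hasGaussianLaw J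
      · exact hW.indep.comp (fun _ f => J.restrict f) (fun i => by fun_prop)
    have hmem : ∀ p : I, p.1.2 ∈ J := fun p => Finset.mem_image_of_mem _ p.2
    let L : ((i : Fin n) → (J → ℝ)) →L[ℝ] (I → ℝ) :=
      ContinuousLinearMap.pi fun p => (ContinuousLinearMap.proj (R := ℝ) (φ := fun _ : J => ℝ)
        (⟨p.1.2, hmem p⟩ : J)).comp (ContinuousLinearMap.proj (R := ℝ)
          (φ := fun _ : Fin n => (J → ℝ)) p.1.1)
    exact h1.map_fun L

lemma IsStandardBrownian.memLp_coord (hW : IsStandardBrownian W P) (s : ℝ≥0) (i : Fin n) :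
    MemLp (fun ω => W s ω i) 2 P :=
  (hW.isGaussianProcess.hasGaussianLaw_eval (i, s)).memLp_two

lemma IsStandardBrownian.covariance_coord (hW : IsStandardBrownian W P) (s t : ℝ≥0)
    (i j : Fin n) :
    cov[fun ω => W s ω i, fun ω => W t ω j; P] = if i = j then ((min s t : ℝ≥0) : ℝ) else 0 := by
  split_ifs with h
  · subst h
    exact (hW.isBrownianReal i).toIsPreBrownianReal.covariance_fun_eval s t
  · have h1 : IndepFun (fun ω => W s ω i) (fun ω => W t ω j) P :=
      (hW.indep.indepFun h).comp (φ := fun f : ℝ≥0 → ℝ => f s) (ψ := fun f : ℝ≥0 → ℝ => f t)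
        (measurable_pi_apply s) (measurable_pi_apply t)
    exact h1.covariance_eq_zero (hW.memLp_coord s i) (hW.memLp_coord t j)

/-- Weak Markov property of the `n`-dimensional Brownian motion. -/
lemma IsStandardBrownian.indepFun_shift (hW : IsStandardBrownian W P) (a : ℝ≥0) :
    IndepFun (fun ω (p : Fin n × ℝ≥0) => W (a + p.2) ω p.1 - W a ω p.1)
      (fun ω (p : Fin n × Set.Iic a) => W p.2 ω p.1) P := by
  have hP := hW.isGaussianProcess.isProbabilityMeasure
  have hm := hW.measurable_coord
  refine IsGaussianProcess.indepFun_of_covariance_eq_zero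
    (X := fun (p : Fin n × ℝ≥0) ω => W (a + p.2) ω p.1 - W a ω p.1)
    (Y := fun (p : Fin n × Set.Iic a) ω => W p.2 ω p.1) ?_
    (fun p => ((hm (a + p.2) p.1).sub (hm a p.1)).aemeasurable)
    (fun p => (hm p.2 p.1).aemeasurable) ?_
  · refine hW.isGaussianProcess.of_isGaussianProcess ?_
    classical
    rintro (⟨i, s⟩ | ⟨i, ⟨s, hs⟩⟩)
    · refine ⟨{(i, a + s), (i, a)}, ContinuousLinearMap.proj (R := ℝ) (φ := fun _ => ℝ)
        ⟨(i, a + s), by simp⟩ - ContinuousLinearMap.proj (R := ℝ) (φ := fun _ => ℝ)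
        ⟨(i, a), by simp⟩, fun ω => by simp⟩
    · exact ⟨{(i, s)}, ContinuousLinearMap.proj (R := ℝ) (φ := fun _ => ℝ)
        ⟨(i, s), by simp⟩, fun ω => by simp⟩
  · rintro ⟨i, s⟩ ⟨j, ⟨r, hr⟩⟩
    have hr' : r ≤ a := hr
    -- for `r ≤ a` both `min (a + s) r` and `min a r` equal `r`
    rw [covariance_fun_sub_left (hW.memLp_coord _ _) (hW.memLp_coord _ _) (hW.memLp_coord _ _),
      hW.covariance_coord, hW.covariance_coord, min_eq_right (hr'.trans le_self_add),
      min_eq_right hr', sub_self]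

/-- The completed `σ`-algebra generated by the increments of `W` after time `a`. -/
@[reducible] def futureSigma (P : Measure Ω) (W : ℝ≥0 → Ω → EuclideanSpace ℝ (Fin n)) (a : ℝ≥0) :
    MeasurableSpace Ω :=
  eventuallyMeasurableSpace
    (MeasurableSpace.comap (fun ω (p : Fin n × ℝ≥0) => W (a + p.2) ω p.1 - W a ω p.1) inferInstance)
    (ae P)

lemma futureSigma_le [P.IsComplete] (hW : IsStandardBrownian W P) (a : ℝ≥0) :
    futureSigma P W a ≤ mΩ := by
  rintro A ⟨B, hB, hAB⟩
  have hm := hW.measurable_coord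
  have hB' : MeasurableSet B := by
    have h1 : Measurable (fun ω (p : Fin n × ℝ≥0) => W (a + p.2) ω p.1 - W a ω p.1) :=
      measurable_pi_lambda _ fun p => (hm _ _).sub (hm _ _)
    exact h1.comap_le _ hB
  exact (hB'.nullMeasurableSet.congr hAB.symm).measurable_of_complete

/-- Up to null sets, the filtration at time `a` is generated by the coordinates up to time `a`. -/
lemma brownianFiltration_le_eventually (hW : ∀ s, Measurable (W s)) (a : ℝ≥0) :
    (brownianFiltration P W hW a : MeasurableSpace Ω) ≤ eventuallyMeasurableSpace
      (MeasurableSpace.comap (fun ω (p : Fin n × Set.Iic a) => W p.2 ω p.1) inferInstance)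
      (ae P) := by
  refine sup_le (iSup_le fun r => ?_) (MeasurableSpace.generateFrom_le ?_)
  · refine le_trans ?_ le_eventuallyMeasurableSpace
    have h1 : @Measurable _ _ (MeasurableSpace.comap
        (fun ω (p : Fin n × Set.Iic a) => W p.2 ω p.1) inferInstance) _
        (fun ω (i : Fin n) => W r ω i) := by
      refine @measurable_pi_lambda _ _ _ (_) _ _ fun i => ?_
      exact (measurable_pi_apply ((i, r) : Fin n × Set.Iic a)).comp
        (comap_measurable (fun ω (p : Fin n × Set.Iic a) => W p.2 ω p.1))
    have h2 := (WithLp.measurable_toLp 2 (Fin n → ℝ)).comp h1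
    exact h2.comap_le
  · rintro A ⟨-, hA⟩
    exact ⟨∅, @MeasurableSet.empty _ (_), ae_eq_empty.2 hA⟩

/-- The completed past and the completed future of a Brownian motion are independent. -/
lemma IsStandardBrownian.indep_future (hW : IsStandardBrownian W P) (a : ℝ≥0) :
    Indep (futureSigma P W a) (brownianFiltration P W hW.measurable a) P := by
  have h := (IndepFun_iff_Indep _ _ _).1 (hW.indepFun_shift a)
  rw [Indep_iff] at h ⊢
  rintro A B ⟨A', hA', hA⟩ hB
  obtain ⟨B', hB', hB⟩ := brownianFiltration_le_eventually hW.measurable a B hB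
  rw [measure_congr (hA.inter hB), h A' B' hA' hB', measure_congr hA, measure_congr hB]

lemma measurable_past (hW : ∀ s, Measurable (W s)) {s a : ℝ≥0} (h : s ≤ a) :
    Measurable[brownianFiltration P W hW a] (W s) := by
  have : MeasurableSpace.comap (W s) inferInstance ≤
      (brownianFiltration P W hW a : MeasurableSpace Ω) :=
    le_trans (le_iSup (fun q : Set.Iic a => MeasurableSpace.comap (W q) inferInstance) ⟨s, h⟩)
      le_sup_left
  exact (comap_measurable (W s)).mono this le_rfl

lemma measurableSet_past_of_null [P.IsComplete] (hW : ∀ s, Measurable (W s)) (a : ℝ≥0) {A : Set Ω}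
    (h : P A = 0) : MeasurableSet[brownianFiltration P W hW a] A := by
  have : MeasurableSet[MeasurableSpace.generateFrom {A : Set Ω | MeasurableSet A ∧ P A = 0}] A :=
    MeasurableSpace.measurableSet_generateFrom ⟨Measure.IsComplete.out ‹_› A h, h⟩
  exact (le_sup_right : _ ≤ (brownianFiltration P W hW a : MeasurableSpace Ω)) _ this

lemma measurableSet_future_of_null (a : ℝ≥0) {A : Set Ω}
    (h : P A = 0) : MeasurableSet[futureSigma P W a] A :=
  ⟨∅, @MeasurableSet.empty _ (_), ae_eq_empty.2 h⟩

lemma measurable_future_coord {a s u : ℝ≥0} (hs : a ≤ s) (hu : a ≤ u) (i : Fin n) :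
    Measurable[futureSigma P W a] (fun ω => W u ω i - W s ω i) := by
  have key : ∀ q, Measurable[futureSigma P W a] (fun ω => W (a + q) ω i - W a ω i) := fun q =>
    (((measurable_pi_apply ((i, q) : Fin n × ℝ≥0)).comp (comap_measurable
      (fun ω (p : Fin n × ℝ≥0) => W (a + p.2) ω p.1 - W a ω p.1)))).mono
      le_eventuallyMeasurableSpace le_rfl
  obtain ⟨q, rfl⟩ := exists_add_of_le hs
  obtain ⟨q', rfl⟩ := exists_add_of_le hu
  have h := (key q').sub (key q)
  have e : (fun ω => W (a + q') ω i - W (a + q) ω i) =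
      (fun ω => W (a + q') ω i - W a ω i) - fun ω => W (a + q) ω i - W a ω i := by
    ext ω
    simp
  rw [e]
  exact h

lemma measurable_future {a s u : ℝ≥0} (hs : a ≤ s) (hu : a ≤ u) :
    Measurable[futureSigma P W a] (fun ω => W u ω - W s ω) := by
  have h1 : Measurable[futureSigma P W a] (fun ω (i : Fin n) => W u ω i - W s ω i) :=
    @measurable_pi_lambda _ _ _ (_) _ _ fun i => measurable_future_coord hs hu i
  exact (WithLp.measurable_toLp 2 (Fin n → ℝ)).comp h1

/-- Functions of the past and of the future are independent. -/
lemma IsStandardBrownian.indepFun_past_future (hW : IsStandardBrownian W P) {a : ℝ≥0}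
    {E F : Type*} [MeasurableSpace E] [MeasurableSpace F] {f : Ω → E} {g : Ω → F}
    (hf : Measurable[brownianFiltration P W hW.measurable a] f)
    (hg : Measurable[futureSigma P W a] g) : IndepFun f g P := by
  rw [IndepFun_iff_Indep]
  exact indep_of_indep_of_le_right (indep_of_indep_of_le_left (hW.indep_future a).symm
    hf.comap_le) hg.comap_le

/-- Expectations of products of past and future variables factorize. No integrability is needed:
by independence, both sides are `0` as soon as one factor is not integrable. -/
lemma IsStandardBrownian.integral_past_mul_future [P.IsComplete] (hW : IsStandardBrownian W P)
    {a : ℝ≥0} {f g : Ω → ℝ} (hf : Measurable[brownianFiltration P W hW.measurable a] f)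
    (hg : Measurable[futureSigma P W a] g) :
    ∫ ω, f ω * g ω ∂P = (∫ ω, f ω ∂P) * ∫ ω, g ω ∂P :=
  (hW.indepFun_past_future hf hg).integral_fun_mul_eq_mul_integral
    (hf.mono ((brownianFiltration P W hW.measurable).le a) le_rfl).aestronglyMeasurable
    (hg.mono (futureSigma_le hW a) le_rfl).aestronglyMeasurable

lemma IsStandardBrownian.integrable_past_mul_future (hW : IsStandardBrownian W P)
    {a : ℝ≥0} {f g : Ω → ℝ} (hf : Measurable[brownianFiltration P W hW.measurable a] f)
    (hg : Measurable[futureSigma P W a] g) (hfi : Integrable f P) (hgi : Integrable g P) :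
    Integrable (fun ω => f ω * g ω) P :=
  (hW.indepFun_past_future hf hg).integrable_mul hfi hgi

/-! ### Gaussian increments -/

lemma IsStandardBrownian.map_increment_coord (hW : IsStandardBrownian W P) {a b : ℝ≥0}
    (hab : a ≤ b) (i : Fin n) :
    P.map (fun ω => W b ω i - W a ω i) = gaussianReal 0 (b - a) := by
  have h := ((hW.isBrownianReal i).toIsPreBrownianReal.hasLaw_sub b a).map_eq
  have h2 : nndist b.1 a.1 = b - a := by
    change nndist (b : ℝ) (a : ℝ) = b - a
    ext
    rw [coe_nndist, Real.dist_eq, abs_of_nonneg (sub_nonneg.2 (NNReal.coe_le_coe.2 hab)),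
      NNReal.coe_sub hab]
  rw [h2] at h
  exact h

lemma IsStandardBrownian.iIndepFun_increment (hW : IsStandardBrownian W P) (a b : ℝ≥0) :
    iIndepFun (fun (i : Fin n) ω => W b ω i - W a ω i) P :=
  hW.indep.comp (fun _ (f : ℝ≥0 → ℝ) => f b - f a) (fun i => by fun_prop)

lemma IsStandardBrownian.hasGaussianLaw_inner_increment (hW : IsStandardBrownian W P)
    (a b : ℝ≥0) (c : EuclideanSpace ℝ (Fin n)) :
    HasGaussianLaw (fun ω => ⟪c, W b ω - W a ω⟫) P := by
  have h1 : HasGaussianLaw (fun ω (i : Fin n) => W b ω i - W a ω i) P := by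
    refine iIndepFun.hasGaussianLaw (fun i => ?_) (hW.iIndepFun_increment a b)
    have hWi := (hW.isBrownianReal i).toIsPreBrownianReal
    exact hWi.isGaussianProcess.hasGaussianLaw_fun_sub
  have h2 := h1.map_fun (∑ i, c i • ContinuousLinearMap.proj (R := ℝ) (φ := fun _ : Fin n => ℝ) i)
  have e : (fun ω => ⟪c, W b ω - W a ω⟫) = fun ω => (∑ i, c i • ContinuousLinearMap.proj (R := ℝ)
      (φ := fun _ : Fin n => ℝ) i) fun i => W b ω i - W a ω i := by
    ext ω
    simp [PiLp.inner_apply, mul_comm]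
  rw [e]
  exact h2

/-- Scalar projections of increments are centred Gaussian. -/
lemma IsStandardBrownian.map_inner_increment (hW : IsStandardBrownian W P) {a b : ℝ≥0}
    (hab : a ≤ b) (c : EuclideanSpace ℝ (Fin n)) :
    P.map (fun ω => ⟪c, W b ω - W a ω⟫) = gaussianReal 0 (‖c‖₊ ^ 2 * (b - a)) := by
  have hP := hW.isGaussianProcess.isProbabilityMeasure
  have hLp : ∀ i, MemLp (fun ω => W b ω i - W a ω i) 2 P := fun i =>
    (hW.memLp_coord b i).sub (hW.memLp_coord a i)
  have hm : ∀ i, Measurable (fun ω => W b ω i - W a ω i) := fun i =>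
    (hW.measurable_coord b i).sub (hW.measurable_coord a i)
  have e : (fun ω => ⟪c, W b ω - W a ω⟫) = ∑ i, fun ω => c i * (W b ω i - W a ω i) := by
    ext ω
    rw [Finset.sum_apply]
    simp [PiLp.inner_apply, mul_comm]
  rw [(hW.hasGaussianLaw_inner_increment a b c).map_eq_gaussianReal]
  have hmean : ∀ i, ∫ ω, W b ω i - W a ω i ∂P = 0 := by
    intro i
    have := integral_id_gaussianReal (μ := 0) (v := b - a)
    rwa [← hW.map_increment_coord hab i, integral_map (hm i).aemeasurable (by fun_prop)] at this
  have hvar : ∀ i, Var[fun ω => W b ω i - W a ω i; P] = b - a := by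
    intro i
    have := variance_id_gaussianReal (μ := 0) (v := b - a)
    rw [← hW.map_increment_coord hab i, variance_map measurable_id.aemeasurable
      (hm i).aemeasurable, NNReal.coe_sub hab] at this
    exact this
  congr 1
  · rw [e]
    have h3 : (∑ i, fun ω => c i * (W b ω i - W a ω i)) =
        fun ω => ∑ i, c i * (W b ω i - W a ω i) := by ext ω; simp
    rw [h3, integral_finsetSum _ fun i _ => ((hLp i).integrable (by norm_num)).const_mul _]
    simp_rw [integral_const_mul, hmean]
    simp
  · rw [e, IndepFun.variance_sum (fun i _ => (hLp i).const_mul _)]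
    · simp_rw [variance_const_mul, hvar]
      ext
      rw [← Finset.sum_mul, ← EuclideanSpace.real_norm_sq_eq, Real.coe_toNNReal _ (by
        have := NNReal.coe_le_coe.2 hab
        nlinarith [sq_nonneg ‖c‖])]
      push_cast [NNReal.coe_sub hab]
      rfl
    · intro i _ j _ hij
      exact ((hW.iIndepFun_increment a b).indepFun hij).comp (measurable_const_mul (c i))
        (measurable_const_mul (c j))

lemma IsStandardBrownian.integral_coord_increment (hW : IsStandardBrownian W P) {a b : ℝ≥0}
    (hab : a ≤ b) (i : Fin n) : ∫ ω, (W b ω i - W a ω i) ∂P = 0 := by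
  have := integral_id_gaussianReal (μ := 0) (v := b - a)
  have hm : Measurable (fun ω => W b ω i - W a ω i) :=
    (hW.measurable_coord b i).sub (hW.measurable_coord a i)
  rwa [← hW.map_increment_coord hab i, integral_map hm.aemeasurable (by fun_prop)] at this

end Brownian


/-! ### Partitions and simple integrals -/

section Partition

/-- A finite set of times refines to a partition of `[t, T]`, extended by the constant `T`, none of
whose open intervals meets the set. -/
lemma exists_partition (S : Finset ℝ≥0) {t T : ℝ≥0} (htT : t ≤ T) :
    ∃ (s : ℕ → ℝ≥0) (N : ℕ), Monotone s ∧ s 0 = t ∧ (∀ i, N ≤ i → s i = T) ∧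
      ∀ i, ∀ q ∈ S, q ≤ s i ∨ s (i + 1) ≤ q := by
  classical
  -- the partition enumerates in increasing order the points of `S` in `[t, T]`, with `t` and `T`
  set S' : Finset ℝ≥0 := insert t (insert T (S.filter fun q => q ∈ Set.Icc t T)) with hS'
  have hmem : ∀ q ∈ S', t ≤ q ∧ q ≤ T := by
    intro q hq
    simp only [hS', Finset.mem_insert, Finset.mem_filter, Set.mem_Icc] at hq
    rcases hq with rfl | rfl | hq
    · exact ⟨le_rfl, htT⟩
    · exact ⟨htT, le_rfl⟩
    · exact hq.2
  have hne : S'.card ≠ 0 := by simp [hS']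
  obtain ⟨N, hN⟩ := Nat.exists_eq_succ_of_ne_zero hne
  let e := S'.orderEmbOfFin hN
  have he : ∀ i, e i ∈ S' := fun i => S'.orderEmbOfFin_mem hN i
  have hsurj : ∀ q ∈ S', ∃ j, e j = q := by
    intro q hq
    have : q ∈ Set.range e := by
      rw [Finset.range_orderEmbOfFin]
      exact hq
    exact this
  -- the enumeration has indices `0, …, N`; later indices repeat the last point
  let s : ℕ → ℝ≥0 := fun i => e ⟨min i N, by omega⟩
  have hs : ∀ i, s i ∈ S' := fun i => he _
  refine ⟨s, N, ?_, ?_, ?_, ?_⟩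
  · intro i j hij
    exact e.monotone (by simp only [Fin.mk_le_mk]; omega)
  · obtain ⟨j, hj⟩ := hsurj t (by simp [hS'])
    refine le_antisymm ?_ (hmem _ (hs 0)).1
    rw [← hj]
    exact e.monotone (by simp)
  · intro i hi
    obtain ⟨j, hj⟩ := hsurj T (by simp [hS'])
    refine le_antisymm (hmem _ (hs i)).2 ?_
    rw [← hj]
    exact e.monotone (by simp only [Fin.le_def]; omega)
  · intro i q hq
    by_cases hqt : q ∈ Set.Icc t T
    · obtain ⟨j, hj⟩ := hsurj q (by simp only [hS', Finset.mem_insert, Finset.mem_filter]; tauto)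
      rw [← hj]
      rcases le_or_gt j.1 i with h | h
      · exact Or.inl (e.monotone (by simp only [Fin.le_def]; omega))
      · exact Or.inr (e.monotone (by simp only [Fin.le_def]; omega))
    · rw [Set.mem_Icc, not_and_or, not_le, not_le] at hqt
      rcases hqt with h | h
      · exact Or.inl (h.le.trans (hmem _ (hs i)).1)
      · exact Or.inr ((hmem _ (hs (i + 1))).2.trans h.le)

/-- A point of `[t, T]` that avoids all open intervals of a partition is a partition point. -/
lemma exists_eq_of_partition {s : ℕ → ℝ≥0} {N : ℕ} {t T q : ℝ≥0} (h0 : s 0 = t)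
    (hN : ∀ i, N ≤ i → s i = T) (hq : q ∈ Set.Icc t T) (h : ∀ i, q ≤ s i ∨ s (i + 1) ≤ q) :
    ∃ i ≤ N, s i = q := by
  by_contra! hc
  have key : ∀ i ≤ N, s i < q := by
    intro i
    induction i with
    | zero => intro hi; exact lt_of_le_of_ne (h0 ▸ hq.1) (hc 0 hi)
    | succ i ih =>
      intro hi
      rcases h i with h1 | h1
      · exact absurd h1 (not_le.2 (ih (by omega)))
      · exact lt_of_le_of_ne h1 (hc _ hi)
  have := key N le_rfl
  rw [hN N le_rfl] at this
  exact absurd hq.2 (not_le.2 this)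

/-- The partition can moreover be taken of mesh at most `δ`. -/
lemma exists_fine_partition (S : Finset ℝ≥0) {t T δ : ℝ≥0} (htT : t ≤ T) (hδ : 0 < δ) :
    ∃ (s : ℕ → ℝ≥0) (N : ℕ), Monotone s ∧ s 0 = t ∧ (∀ i, N ≤ i → s i = T) ∧
      (∀ i, ∀ q ∈ S, q ≤ s i ∨ s (i + 1) ≤ q) ∧ ∀ i, s (i + 1) ≤ s i + δ := by
  classical
  obtain ⟨M, hM⟩ : ∃ M : ℕ, T ≤ M * δ := by
    obtain ⟨M, hM⟩ := exists_nat_ge (T / δ)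
    exact ⟨M, by rwa [div_le_iff₀ hδ] at hM⟩
  -- adding the multiples of `δ` up to `T` to the set bounds the mesh
  obtain ⟨s, N, hs, h0, hN, hS⟩ := exists_partition
    (S ∪ (Finset.range (M + 1)).image fun j : ℕ => (j : ℝ≥0) * δ) htT
  refine ⟨s, N, hs, h0, hN, fun i q hq => hS i q (Finset.mem_union_left _ hq), fun i => ?_⟩
  have hle : ∀ i, s i ≤ T := fun i => by
    rw [← hN (max i N) (le_max_right _ _)]
    exact hs (le_max_left _ _)
  have hu : ∀ j ≤ M, (j : ℝ≥0) * δ ≤ s i ∨ s (i + 1) ≤ (j : ℝ≥0) * δ := fun j hj =>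
    hS i _ (Finset.mem_union_right _ (Finset.mem_image_of_mem _ (by simp; omega)))
  by_contra! hc
  have key : ∀ j ≤ M, (j : ℝ≥0) * δ ≤ s i := by
    intro j
    induction j with
    | zero => intro _; simp
    | succ j ih =>
      intro hj
      rcases hu (j + 1) hj with h | h
      · exact h
      · exfalso
        refine absurd (h.trans ?_) (not_le.2 hc)
        push_cast
        rw [add_mul, one_mul]
        exact add_le_add_left (ih (by omega)) δ
  have h1 := (hM.trans (key M le_rfl))
  exact absurd ((hle (i + 1)).trans (h1.trans le_self_add)) (not_le.2 hc)

end Partition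

/-! ### Elementary integrals along a partition -/

section Simple

variable {Ω : Type*} {mΩ : MeasurableSpace Ω} {n : ℕ} {P : Measure Ω}
  {W : ℝ≥0 → Ω → EuclideanSpace ℝ (Fin n)} {𝓕 : Filtration ℝ≥0 mΩ}

/-- No jump time of `H` lies in the open interval `(a, b)`. -/
def SimpleProcess.JumpFree (H : SimpleProcess 𝓕 n) (a b : ℝ≥0) : Prop :=
  ∀ l ≤ H.N, H.τ l ≤ a ∨ b ≤ H.τ l

lemma SimpleProcess.exists_bound (H : SimpleProcess 𝓕 n) :
    ∃ C : ℝ, 0 ≤ C ∧ ∀ s ω, ‖H.val s ω‖ ≤ C := by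
  obtain ⟨C, hC⟩ := H.bounded
  refine ⟨∑ i ∈ Finset.range H.N, |C|, by positivity, fun s ω => ?_⟩
  refine (norm_sum_le _ _).trans (Finset.sum_le_sum fun i _ => ?_)
  by_cases h : s ∈ Set.Ioc (H.τ i) (H.τ (i + 1))
  · rw [Set.indicator_of_mem h]
    exact (hC i ω).trans (le_abs_self C)
  · rw [Set.indicator_of_notMem h]
    simp

/-- The increment of an elementary integral over an interval without interior jump times. -/
lemma SimpleProcess.integral_sub (H : SimpleProcess 𝓕 n) (t : ℝ≥0) {a b : ℝ≥0} (hab : a ≤ b)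
    (h : H.JumpFree a b) (ω : Ω) :
    H.integral W t b ω - H.integral W t a ω = ⟪H.val b ω, W b ω - W a ω⟫ := by
  rcases hab.eq_or_lt with rfl | hab
  · simp
  unfold SimpleProcess.integral SimpleProcess.val
  rw [← Finset.sum_sub_distrib, sum_inner]
  refine Finset.sum_congr rfl fun l hl => ?_
  have hl := Finset.mem_range.1 hl
  rw [sub_sub_sub_cancel_right, ← inner_sub_right]
  have hm := H.mono (Nat.le_succ l)
  rcases h l hl.le with h1 | h1
  · rcases h (l + 1) hl with h2 | h2
    · rw [Set.indicator_of_notMem (fun hb => absurd (hab.trans_le hb.2) (not_lt.2 h2)),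
        min_eq_right (h2.trans hab.le), min_eq_right (h1.trans hab.le), min_eq_right h2,
        min_eq_right h1]
      simp
    · rw [Set.indicator_of_mem (show b ∈ Set.Ioc (H.τ l) (H.τ (l + 1)) from
          ⟨h1.trans_lt hab, h2⟩),
        min_eq_left h2, min_eq_right (h1.trans hab.le), min_eq_left (hab.le.trans h2),
        min_eq_right h1]
      congr 1
      abel
  · rw [Set.indicator_of_notMem (fun hb => absurd hb.1 (not_lt.2 h1)),
      min_eq_left (h1.trans hm), min_eq_left h1, min_eq_left (hab.le.trans (h1.trans hm)),
      min_eq_left (hab.le.trans h1)]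
    simp

lemma SimpleProcess.integral_self (H : SimpleProcess 𝓕 n) (t : ℝ≥0) (ω : Ω) :
    H.integral W t t ω = 0 := by
  simp [SimpleProcess.integral]

/-- Along a partition without interior jump times the elementary integral is a sum of increments. -/
lemma SimpleProcess.integral_partition (H : SimpleProcess 𝓕 n) {s : ℕ → ℝ≥0} (hs : Monotone s)
    (h : ∀ i, H.JumpFree (s i) (s (i + 1))) (j : ℕ) (ω : Ω) :
    H.integral W (s 0) (s j) ω =
      ∑ i ∈ Finset.range j, ⟪H.val (s (i + 1)) ω, W (s (i + 1)) ω - W (s i) ω⟫ := by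
  induction j with
  | zero => simp [SimpleProcess.integral_self]
  | succ j ih =>
    rw [Finset.sum_range_succ, ← ih, ← H.integral_sub (s 0) (hs j.le_succ) (h j)]
    ring

/-- A simple process is constant on left-open intervals without interior jump times. -/
lemma SimpleProcess.val_eq (H : SimpleProcess 𝓕 n) {a b r : ℝ≥0} (hr : r ∈ Set.Ioc a b)
    (h : H.JumpFree a b) (ω : Ω) : H.val r ω = H.val b ω := by
  refine Finset.sum_congr rfl fun l hl => ?_
  have hl := Finset.mem_range.1 hl
  have : r ∈ Set.Ioc (H.τ l) (H.τ (l + 1)) ↔ b ∈ Set.Ioc (H.τ l) (H.τ (l + 1)) := by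
    constructor
    · rintro ⟨h1, h2⟩
      refine ⟨h1.trans_le hr.2, ?_⟩
      rcases h (l + 1) hl with h3 | h3
      · exact absurd (hr.1.trans_le h2) (not_lt.2 h3)
      · exact h3
    · rintro ⟨h1, h2⟩
      refine ⟨?_, hr.2.trans h2⟩
      rcases h l hl.le with h3 | h3
      · exact h3.trans_lt hr.1
      · exact absurd h1 (not_lt.2 h3)
  by_cases hb : b ∈ Set.Ioc (H.τ l) (H.τ (l + 1))
  · rw [Set.indicator_of_mem hb, Set.indicator_of_mem (this.2 hb)]
  · rw [Set.indicator_of_notMem hb, Set.indicator_of_notMem (fun h => hb (this.1 h))]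

/-- Predictability: on an interval without interior jump times, the value is known at its left
end. -/
lemma SimpleProcess.measurable_val (H : SimpleProcess 𝓕 n) {a b : ℝ≥0}
    (h : H.JumpFree a b) : Measurable[𝓕 a] (H.val b) := by
  unfold SimpleProcess.val
  refine @Finset.measurable_fun_sum _ _ _ _ _ _ (𝓕 a) _ _ fun l hl => ?_
  have hl := Finset.mem_range.1 hl
  by_cases hb : b ∈ Set.Ioc (H.τ l) (H.τ (l + 1))
  · simp only [Set.indicator_of_mem hb]
    rcases h l hl.le with h3 | h3
    · exact (H.measurable l).mono (𝓕.mono h3) le_rfl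
    · exact absurd hb.1 (not_lt.2 h3)
  · simp only [Set.indicator_of_notMem hb]
    exact @measurable_const _ _ _ (𝓕 a) _

/-- The jump times of a simple process, as a finite set. -/
noncomputable def SimpleProcess.jumps (H : SimpleProcess 𝓕 n) : Finset ℝ≥0 :=
  (Finset.range (H.N + 1)).image H.τ

lemma SimpleProcess.jumpFree_of_jumps (H : SimpleProcess 𝓕 n) {a b : ℝ≥0}
    (h : ∀ q ∈ H.jumps, q ≤ a ∨ b ≤ q) : H.JumpFree a b := fun l hl =>
  h _ (Finset.mem_image_of_mem _ (by simp; omega))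

end Simple

/-! ### Kolmogorov's maximal inequality -/

section Maximal

variable {Ω : Type*} {mΩ : MeasurableSpace Ω} {P : Measure Ω}

/-- The filtration of a process sampled along a monotone sequence of times. -/
def sampleFiltration (𝓕 : Filtration ℝ≥0 mΩ) (s : ℕ → ℝ≥0) (hs : Monotone s) :
    Filtration ℕ mΩ where
  seq i := 𝓕 (s i)
  mono' _ _ hij := 𝓕.mono (hs hij)
  le' i := 𝓕.le (s i)

/-- Kolmogorov's maximal inequality for martingale differences. -/
theorem measure_exists_abs_sum_ge_le [IsFiniteMeasure P] (𝒢 : Filtration ℕ mΩ) {D : ℕ → Ω → ℝ}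
    (hD : ∀ i, Measurable[𝒢 (i + 1)] (D i)) (hL : ∀ i, MemLp (D i) 2 P)
    (horth : ∀ i φ, Measurable[𝒢 i] φ → MemLp φ 2 P → ∫ ω, φ ω * D i ω ∂P = 0)
    (N : ℕ) {ε : ℝ} (hε : 0 < ε) :
    P {ω | ∃ j ≤ N, ε ≤ |∑ i ∈ Finset.range j, D i ω|} ≤
      ENNReal.ofReal ((∑ i ∈ Finset.range N, ∫ ω, D i ω ^ 2 ∂P) / ε ^ 2) := by
  set S : ℕ → Ω → ℝ := fun j ω => ∑ i ∈ Finset.range j, D i ω with hS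
  have hSm : ∀ j, Measurable[𝒢 j] (S j) := fun j =>
    @Finset.measurable_fun_sum _ _ _ _ _ _ (𝒢 j) _ _ fun i hi =>
      (hD i).mono (𝒢.mono (by simp at hi; omega)) le_rfl
  have hSL : ∀ j, MemLp (S j) 2 P := fun j => memLp_finsetSum _ fun i _ => hL i
  have hSi : ∀ j, Integrable (fun ω => S j ω ^ 2) P := fun j => (hSL j).integrable_sq
  -- the cross term vanishes by orthogonality, on every event of the past
  have hstep : ∀ j (A : Set Ω), MeasurableSet[𝒢 j] A →
      ∫ ω in A, S (j + 1) ω ^ 2 ∂P = ∫ ω in A, S j ω ^ 2 ∂P + ∫ ω in A, D j ω ^ 2 ∂P := by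
    intro j A hA
    have hA' := 𝒢.le j A hA
    have hcross : ∫ ω in A, S j ω * D j ω ∂P = 0 := by
      have := horth j (A.indicator (S j)) ((hSm j).indicator hA) ((hSL j).indicator hA')
      rw [← this, ← integral_indicator hA']
      congr 1
      ext ω
      by_cases h : ω ∈ A <;> simp [h]
    have hci : Integrable (fun ω => S j ω * D j ω) P := (hSL j).integrable_mul (hL j)
    have e : ∀ ω, S (j + 1) ω ^ 2 = S j ω ^ 2 + D j ω ^ 2 + 2 * (S j ω * D j ω) := by
      intro ω
      simp only [hS, Finset.sum_range_succ]
      ring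
    simp_rw [e]
    have hi : Integrable (fun ω => S j ω ^ 2 + D j ω ^ 2) P := (hSi j).add (hL j).integrable_sq
    rw [integral_add hi.integrableOn (hci.const_mul 2).integrableOn,
      integral_add (hSi j).integrableOn (hL j).integrable_sq.integrableOn, integral_const_mul,
      hcross]
    ring
  -- hence `S²` is a submartingale, and Doob's maximal inequality applies to it
  have hsub : Submartingale (fun j ω => S j ω ^ 2) 𝒢 P := by
    refine submartingale_of_setIntegral_le_succ (fun j => ((hSm j).pow_const 2).stronglyMeasurable)
      hSi fun j A hA => ?_
    rw [hstep j A hA]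
    have : 0 ≤ ∫ ω in A, D j ω ^ 2 ∂P := integral_nonneg fun ω => sq_nonneg _
    linarith
  have htot : ∀ j, ∫ ω, S j ω ^ 2 ∂P = ∑ i ∈ Finset.range j, ∫ ω, D i ω ^ 2 ∂P := by
    intro j
    induction j with
    | zero => simp [hS]
    | succ j ih =>
      have := hstep j Set.univ (@MeasurableSet.univ _ (𝒢 j))
      simp only [Measure.restrict_univ] at this
      rw [this, ih, Finset.sum_range_succ]
  have hmax := maximal_ineq hsub (fun j ω => sq_nonneg _) (ε := ⟨ε ^ 2, by positivity⟩) N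
  set A : Set Ω := {ω | (ε ^ 2 : ℝ) ≤ (Finset.range (N + 1)).sup' Finset.nonempty_range_add_one
    fun k => S k ω ^ 2} with hA
  have hAsub : {ω | ∃ j ≤ N, ε ≤ |∑ i ∈ Finset.range j, D i ω|} ⊆ A := by
    rintro ω ⟨j, hj, h⟩
    refine le_trans ?_ (Finset.le_sup' (fun k => S k ω ^ 2) (by simp; omega : j ∈ _))
    rw [← sq_abs (S j ω)]
    exact pow_le_pow_left₀ hε.le h 2
  refine (measure_mono hAsub).trans ?_
  have h1 : ENNReal.ofReal (ε ^ 2) * P A ≤ ENNReal.ofReal (∑ i ∈ Finset.range N,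
      ∫ ω, D i ω ^ 2 ∂P) := by
    rw [← htot]
    refine le_trans (le_of_eq ?_) (hmax.trans (ENNReal.ofReal_le_ofReal ?_))
    · congr 1
      rw [ENNReal.ofReal, Real.toNNReal_of_nonneg (by positivity)]
      rfl
    · exact setIntegral_le_integral (hSi N) (ae_of_all _ fun ω => sq_nonneg _)
  rw [ENNReal.ofReal_div_of_pos (by positivity), ENNReal.le_div_iff_mul_le
    (Or.inl (by simpa using hε.ne')) (Or.inl ENNReal.ofReal_ne_top), mul_comm]
  exact h1

end Maximal


section BrownianSums

variable {Ω : Type*} {mΩ : MeasurableSpace Ω} {n : ℕ} {P : Measure Ω}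
  {W : ℝ≥0 → Ω → EuclideanSpace ℝ (Fin n)}

/-! ### Sums of Brownian increments -/

lemma IsStandardBrownian.integral_sq_coord_increment (hW : IsStandardBrownian W P) {a b : ℝ≥0}
    (hab : a ≤ b) (i : Fin n) : ∫ ω, (W b ω i - W a ω i) ^ 2 ∂P = b - a := by
  have hP := hW.isGaussianProcess.isProbabilityMeasure
  have hm : Measurable (fun ω => W b ω i - W a ω i) :=
    (hW.measurable_coord b i).sub (hW.measurable_coord a i)
  have hvar : Var[fun ω => W b ω i - W a ω i; P] = b - a := by
    have := variance_id_gaussianReal (μ := 0) (v := b - a)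
    rw [← hW.map_increment_coord hab i, variance_map measurable_id.aemeasurable
      hm.aemeasurable, NNReal.coe_sub hab] at this
    exact this
  rw [← hvar, variance_of_integral_eq_zero hm.aemeasurable (hW.integral_coord_increment hab i)]

lemma IsStandardBrownian.memLp_coord_increment (hW : IsStandardBrownian W P) (a b : ℝ≥0)
    (i : Fin n) : MemLp (fun ω => W b ω i - W a ω i) 2 P :=
  (hW.memLp_coord b i).sub (hW.memLp_coord a i)

lemma IsStandardBrownian.memLp_increment (hW : IsStandardBrownian W P) (a b : ℝ≥0) :
    MemLp (fun ω => W b ω - W a ω) 2 P := by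
  have hm : Measurable (fun ω => W b ω - W a ω) := (hW.measurable b).sub (hW.measurable a)
  rw [memLp_two_iff_integrable_sq_norm hm.aestronglyMeasurable]
  simp_rw [EuclideanSpace.real_norm_sq_eq]
  exact integrable_finsetSum _ fun i _ => (hW.memLp_coord_increment a b i).integrable_sq

lemma IsStandardBrownian.integral_norm_sq_increment (hW : IsStandardBrownian W P) {a b : ℝ≥0}
    (hab : a ≤ b) : ∫ ω, ‖W b ω - W a ω‖ ^ 2 ∂P = n * (b - a) := by
  simp_rw [EuclideanSpace.real_norm_sq_eq, PiLp.sub_apply]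
  rw [integral_finsetSum _ fun i _ => (hW.memLp_coord_increment a b i).integrable_sq]
  simp_rw [hW.integral_sq_coord_increment hab]
  simp [mul_sub]

/-- The increment of `W` after time `a`, weighted by past quantities, has mean zero. -/
lemma IsStandardBrownian.integral_mul_inner_increment [IsProbabilityMeasure P] [P.IsComplete]
    (hW : IsStandardBrownian W P)
    {a b : ℝ≥0} (hab : a ≤ b) {φ : Ω → ℝ} {ζ : Ω → EuclideanSpace ℝ (Fin n)} {C : ℝ}
    (hφ : Measurable[brownianFiltration P W hW.measurable a] φ) (hφi : Integrable φ P)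
    (hζ : Measurable[brownianFiltration P W hW.measurable a] ζ) (hC : ∀ ω, ‖ζ ω‖ ≤ C) :
    ∫ ω, φ ω * ⟪ζ ω, W b ω - W a ω⟫ ∂P = 0 := by
  have hle := (brownianFiltration P W hW.measurable).le a
  have hζi : ∀ i, Measurable[brownianFiltration P W hW.measurable a] (fun ω => ζ ω i) := fun i =>
    (by fun_prop : Measurable (fun v : EuclideanSpace ℝ (Fin n) => v i)).comp hζ
  have hint : ∀ i, Integrable (fun ω => φ ω * ζ ω i) P := fun i =>
    hφi.mul_bdd (c := C) ((hζi i).mono hle le_rfl).aestronglyMeasurable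
      (ae_of_all _ fun ω => (PiLp.norm_apply_le (ζ ω) i).trans (hC ω))
  have e : ∀ ω, φ ω * ⟪ζ ω, W b ω - W a ω⟫ = ∑ i, (φ ω * ζ ω i) * (W b ω i - W a ω i) := by
    intro ω
    rw [PiLp.inner_apply, Finset.mul_sum]
    refine Finset.sum_congr rfl fun i _ => ?_
    simp
    ring
  simp_rw [e]
  rw [integral_finsetSum]
  · refine Finset.sum_eq_zero fun i _ => ?_
    have := hW.integral_past_mul_future (hφ.mul (hζi i)) (measurable_future_coord le_rfl hab i)
    rwa [hW.integral_coord_increment hab, mul_zero] at this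
  · exact fun i _ => hW.integrable_past_mul_future (hφ.mul (hζi i))
      (measurable_future_coord le_rfl hab i) (hint i)
      ((hW.memLp_coord_increment a b i).integrable (by norm_num))

lemma IsStandardBrownian.memLp_inner_increment [IsProbabilityMeasure P]
    (hW : IsStandardBrownian W P)
    {a b : ℝ≥0} {ζ : Ω → EuclideanSpace ℝ (Fin n)} {C : ℝ}
    (hζ : Measurable ζ) (hC : ∀ ω, ‖ζ ω‖ ≤ C) :
    MemLp (fun ω => ⟪ζ ω, W b ω - W a ω⟫) 2 P := by
  have hm : Measurable (fun ω => W b ω - W a ω) := (hW.measurable b).sub (hW.measurable a)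
  refine (hW.memLp_increment a b).of_le_mul (c := C) (hζ.inner hm).aestronglyMeasurable
    (ae_of_all _ fun ω => ?_)
  exact (norm_inner_le_norm _ _).trans (mul_le_mul_of_nonneg_right (hC ω) (norm_nonneg _))

lemma IsStandardBrownian.integral_sq_inner_increment_le [IsProbabilityMeasure P]
    (hW : IsStandardBrownian W P)
    {a b : ℝ≥0} (hab : a ≤ b) {ζ : Ω → EuclideanSpace ℝ (Fin n)} {C : ℝ}
    (hζ : Measurable ζ) (hC : ∀ ω, ‖ζ ω‖ ≤ C) :
    ∫ ω, ⟪ζ ω, W b ω - W a ω⟫ ^ 2 ∂P ≤ C ^ 2 * (n * (b - a)) := by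
  rw [← hW.integral_norm_sq_increment hab, ← integral_const_mul]
  refine integral_mono (hW.memLp_inner_increment hζ hC).integrable_sq
    (((memLp_two_iff_integrable_sq_norm (hW.memLp_increment a b).1).1
      (hW.memLp_increment a b)).const_mul _) fun ω => ?_
  have h1 := (abs_real_inner_le_norm (ζ ω) (W b ω - W a ω)).trans
    (mul_le_mul_of_nonneg_right (hC ω) (norm_nonneg _))
  change ⟪ζ ω, W b ω - W a ω⟫ ^ 2 ≤ _
  rw [← sq_abs, ← mul_pow]
  exact pow_le_pow_left₀ (abs_nonneg _) h1 2

/-- A sum of projected increments over a partition is centred Gaussian. -/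
lemma IsStandardBrownian.map_sum_inner [IsProbabilityMeasure P] [P.IsComplete]
    (hW : IsStandardBrownian W P) {s : ℕ → ℝ≥0} (hs : Monotone s)
    (d : ℕ → EuclideanSpace ℝ (Fin n)) (j : ℕ) :
    P.map (fun ω => ∑ i ∈ Finset.range j, ⟪d i, W (s (i + 1)) ω - W (s i) ω⟫) =
      gaussianReal 0 (∑ i ∈ Finset.range j, ‖d i‖₊ ^ 2 * (s (i + 1) - s i)) := by
  induction j with
  | zero => simp [Measure.map_const]
  | succ j ih =>
    have hpast : Measurable[brownianFiltration P W hW.measurable (s j)]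
        (fun ω => ∑ i ∈ Finset.range j, ⟪d i, W (s (i + 1)) ω - W (s i) ω⟫) := by
      refine @Finset.measurable_fun_sum _ _ _ _ _ _ (_) _ _ fun i hi => ?_
      have hi := Finset.mem_range.1 hi
      exact (by fun_prop : Measurable fun v => ⟪d i, v⟫).comp
        ((measurable_past hW.measurable (hs hi)).sub
          (measurable_past hW.measurable (hs hi.le)))
    have hfut : Measurable[futureSigma P W (s j)]
        (fun ω => ⟪d j, W (s (j + 1)) ω - W (s j) ω⟫) :=
      (by fun_prop : Measurable fun v => ⟪d j, v⟫).comp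
        (measurable_future le_rfl (hs j.le_succ))
    have := gaussianReal_add_gaussianReal_of_indepFun (hW.indepFun_past_future hpast hfut) ih
      (hW.map_inner_increment (hs j.le_succ) (d j))
    rw [Finset.sum_range_succ, ← add_zero (0 : ℝ), ← this]
    congr 1
    ext ω
    simp [Finset.sum_range_succ]

/-- Maximal inequality for the elementary integrals of two uniformly close simple processes. -/
lemma IsStandardBrownian.measure_exists_abs_integral_sub_gt_le [IsProbabilityMeasure P]
    [P.IsComplete] (hW : IsStandardBrownian W P)
    (H H' : SimpleProcess (brownianFiltration P W hW.measurable) n) {T : ℝ≥0} {ε c : ℝ}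
    (hc : 0 < c) (hε : ∀ s ∈ Set.Ioc 0 T, ∀ ω, ‖H.val s ω - H'.val s ω‖ ≤ ε) (hε0 : 0 ≤ ε)
    (hcont : ∀ᵐ ω ∂P, Continuous (fun s => W s ω)) :
    P {ω | ∃ s ≤ T, c < |H.integral W 0 s ω - H'.integral W 0 s ω|} ≤
      ENNReal.ofReal (ε ^ 2 * (n * T) / c ^ 2) := by
  classical
  set f : ℝ≥0 → Ω → ℝ := fun s ω => H.integral W 0 s ω - H'.integral W 0 s ω with hf
  have : Nonempty (Set.Icc (0 : ℝ≥0) T) := ⟨⟨0, le_rfl, zero_le⟩⟩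
  -- by continuity of the paths it suffices to test a dense sequence of times
  obtain ⟨q, hq⟩ := TopologicalSpace.exists_dense_seq (Set.Icc (0 : ℝ≥0) T)
  let A : ℕ → Set Ω := fun m => {ω | ∃ j < m, c < |f (q j) ω|}
  have hAm : Monotone A := fun m m' hm ω ⟨j, hj, h⟩ => ⟨j, hj.trans_le hm, h⟩
  have hfin : ∀ m, P (A m) ≤ ENNReal.ofReal (ε ^ 2 * (n * T) / c ^ 2) := by
    intro m
    -- a partition containing all jump times and the first `m` test times turns both integrals into
    -- sums of increments, to which the discrete maximal inequality applies
    obtain ⟨s, N, hs, h0, hN, hS⟩ := exists_partition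
      (H.jumps ∪ H'.jumps ∪ (Finset.range m).image fun j => (q j : ℝ≥0)) (zero_le (a := T))
    have hH : ∀ i, H.JumpFree (s i) (s (i + 1)) := fun i => H.jumpFree_of_jumps fun x hx =>
      hS i x (by simp [hx])
    have hH' : ∀ i, H'.JumpFree (s i) (s (i + 1)) := fun i => H'.jumpFree_of_jumps fun x hx =>
      hS i x (by simp [hx])
    have hsT : ∀ i, s i ≤ T := fun i => by
      rw [← hN (max i N) (le_max_right _ _)]
      exact hs (le_max_left _ _)
    -- on degenerate intervals the values are irrelevant, and not controlled by `hε` at time `0`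
    set ζ : ℕ → Ω → EuclideanSpace ℝ (Fin n) := fun i ω =>
      if s i < s (i + 1) then H.val (s (i + 1)) ω - H'.val (s (i + 1)) ω else 0 with hζ
    have hζm : ∀ i, Measurable[brownianFiltration P W hW.measurable (s i)] (ζ i) := by
      intro i
      by_cases h : s i < s (i + 1)
      · simp only [hζ, if_pos h]
        exact (H.measurable_val (hH i)).sub (H'.measurable_val (hH' i))
      · simp only [hζ, if_neg h]
        exact @measurable_const _ _ _ (_) _
    have hle := (brownianFiltration P W hW.measurable).le
    have hζb : ∀ i ω, ‖ζ i ω‖ ≤ ε := by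
      intro i ω
      by_cases h : s i < s (i + 1)
      · simp only [hζ, if_pos h]
        exact hε _ ⟨lt_of_le_of_lt zero_le h, hsT _⟩ ω
      · simp only [hζ, if_neg h, norm_zero, hε0]
    set D : ℕ → Ω → ℝ := fun i ω => ⟪ζ i ω, W (s (i + 1)) ω - W (s i) ω⟫ with hD
    have hsum : ∀ j ω, f (s j) ω = ∑ i ∈ Finset.range j, D i ω := by
      intro j ω
      simp only [hf]
      rw [← h0, H.integral_partition hs hH, H'.integral_partition hs hH', ← Finset.sum_sub_distrib]
      refine Finset.sum_congr rfl fun i _ => ?_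
      rw [← inner_sub_left]
      by_cases h : s i < s (i + 1)
      · simp only [hD, hζ, if_pos h]
      · have : s (i + 1) = s i := le_antisymm (not_lt.1 h) (hs i.le_succ)
        simp [hD, this]
    have hsub : A m ⊆ {ω | ∃ j ≤ N, c ≤ |∑ i ∈ Finset.range j, D i ω|} := by
      rintro ω ⟨j, hj, h⟩
      obtain ⟨i, hi, hsi⟩ := exists_eq_of_partition h0 hN (q j).2 (fun i => hS i (q j)
        (Finset.mem_union_right _ (Finset.mem_image_of_mem _ (Finset.mem_range.2 hj))))
      refine ⟨i, hi, ?_⟩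
      rw [← hsum, hsi]
      exact h.le
    refine (measure_mono hsub).trans ((measure_exists_abs_sum_ge_le
      (sampleFiltration (brownianFiltration P W hW.measurable) s hs) (D := D)
      ?_ ?_ ?_ N hc).trans ?_)
    · intro i
      have h1 : Measurable[brownianFiltration P W hW.measurable (s (i + 1))] (ζ i) :=
        (hζm i).mono ((brownianFiltration P W hW.measurable).mono (hs i.le_succ)) le_rfl
      exact h1.inner ((measurable_past hW.measurable le_rfl).sub
        (measurable_past hW.measurable (hs i.le_succ)))
    · exact fun i => hW.memLp_inner_increment ((hζm i).mono (hle _) le_rfl) (hζb i)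
    · exact fun i φ hφ hφL => hW.integral_mul_inner_increment (hs i.le_succ) hφ
        (hφL.integrable (by norm_num)) (hζm i) (hζb i)
    · refine ENNReal.ofReal_le_ofReal (div_le_div_of_nonneg_right ?_ (by positivity))
      calc ∑ i ∈ Finset.range N, ∫ ω, D i ω ^ 2 ∂P
          ≤ ∑ i ∈ Finset.range N, ε ^ 2 * (n * ((s (i + 1) : ℝ) - s i)) :=
            Finset.sum_le_sum fun i _ => hW.integral_sq_inner_increment_le (hs i.le_succ)
              ((hζm i).mono (hle _) le_rfl) (hζb i)
        _ = ε ^ 2 * (n * T) := by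
            rw [← Finset.mul_sum, ← Finset.mul_sum, Finset.sum_range_sub (fun i => (s i : ℝ)),
              h0, hN N le_rfl]
            simp
  have hunion : P (⋃ m, A m) ≤ ENNReal.ofReal (ε ^ 2 * (n * T) / c ^ 2) := by
    rw [hAm.measure_iUnion]
    exact iSup_le hfin
  refine le_trans (measure_mono_ae ?_) hunion
  filter_upwards [hcont] with ω hω
  rintro ⟨s, hs, h⟩
  have hfc : Continuous (fun s => f s ω) := by
    simp only [hf, SimpleProcess.integral]
    fun_prop
  -- exceeding `c` is an open condition, so it is witnessed by some test time
  have hopen : IsOpen {x : Set.Icc (0 : ℝ≥0) T | c < |f x ω|} :=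
    isOpen_lt continuous_const (by fun_prop)
  obtain ⟨j, hj⟩ := hq.exists_mem_open hopen ⟨⟨s, zero_le, hs⟩, h⟩
  exact Set.mem_iUnion.2 ⟨j + 1, j, j.lt_succ_self, hj⟩

end BrownianSums


section Limits

variable {Ω : Type*} {mΩ : MeasurableSpace Ω} {P : Measure Ω}

/-! ### The Wiener integral of a continuous function -/

/-- Almost sure limits of centred Gaussian variables are centred Gaussian. -/
lemma map_eq_gaussianReal_of_tendsto [IsProbabilityMeasure P] {X : ℕ → Ω → ℝ} {Y : Ω → ℝ}
    {v : ℕ → ℝ≥0} {w : ℝ≥0} (hX : ∀ k, Measurable (X k)) (hY : Measurable Y)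
    (hlaw : ∀ k, P.map (X k) = gaussianReal 0 (v k))
    (hlim : ∀ᵐ ω ∂P, Tendsto (fun k => X k ω) atTop (𝓝 (Y ω)))
    (hv : Tendsto v atTop (𝓝 w)) : P.map Y = gaussianReal 0 w := by
  have : IsProbabilityMeasure (P.map Y) := Measure.isProbabilityMeasure_map hY.aemeasurable
  have hchar : ∀ (Z : Ω → ℝ), Measurable Z → ∀ t : ℝ,
      charFun (P.map Z) t = ∫ ω, Complex.exp (((t * Z ω : ℝ) : ℂ) * Complex.I) ∂P := by
    intro Z hZ t
    rw [charFun_apply_real, integral_map hZ.aemeasurable (by fun_prop)]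
    simp
  refine Measure.ext_of_charFun (funext fun t => ?_)
  -- characteristic functions converge by dominated convergence
  have h1 : Tendsto (fun k => charFun (P.map (X k)) t) atTop (𝓝 (charFun (P.map Y) t)) := by
    simp_rw [hchar _ (hX _), hchar _ hY]
    refine tendsto_integral_of_dominated_convergence (fun _ => 1)
      (fun k => ((by fun_prop : Continuous fun x : ℝ => Complex.exp (((t * x : ℝ) : ℂ) *
        Complex.I)).measurable.comp (hX k)).aestronglyMeasurable) (integrable_const _)
      (fun k => ae_of_all _ fun ω => (Complex.norm_exp_ofReal_mul_I _).le) ?_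
    filter_upwards [hlim] with ω hω
    exact ((by fun_prop : Continuous fun x : ℝ => Complex.exp (((t * x : ℝ) : ℂ) *
        Complex.I)).tendsto _).comp hω
  refine tendsto_nhds_unique h1 ?_
  simp_rw [hlaw, charFun_gaussianReal]
  have hv' : Tendsto (fun k => ((v k : ℝ) : ℂ)) atTop (𝓝 ((w : ℝ) : ℂ)) :=
    (Complex.continuous_ofReal.tendsto _).comp ((NNReal.continuous_coe.tendsto _).comp hv)
  exact (Complex.continuous_exp.tendsto _).comp
    (tendsto_const_nhds.sub ((hv'.mul_const _).div_const _))

end Limits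

section Grid

variable {Ω : Type*} {mΩ : MeasurableSpace Ω} {n : ℕ} {P : Measure Ω}
  {W : ℝ≥0 → Ω → EuclideanSpace ℝ (Fin n)} {𝓕 : Filtration ℝ≥0 mΩ}

lemma SimpleProcess.val_of_mem (H : SimpleProcess 𝓕 n) {i : ℕ} (hi : i < H.N) {s : ℝ≥0}
    (hs : s ∈ Set.Ioc (H.τ i) (H.τ (i + 1))) (ω : Ω) : H.val s ω = H.ξ i ω := by
  unfold SimpleProcess.val
  rw [Finset.sum_eq_single i, Set.indicator_of_mem hs]
  · intro j _ hji
    refine Set.indicator_of_notMem (fun hj => ?_) _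
    rcases lt_or_gt_of_ne hji with h | h
    · exact absurd (hj.2.trans (H.mono h)) (not_le.2 hs.1)
    · exact absurd (hs.2.trans (H.mono h)) (not_le.2 hj.1)
  · intro h
    exact absurd (Finset.mem_range.2 hi) h

lemma exists_mem_Ioc_of_monotone {τ : ℕ → ℝ≥0} {N : ℕ} {s : ℝ≥0} (hs : s ∈ Set.Ioc (τ 0) (τ N)) :
    ∃ i < N, s ∈ Set.Ioc (τ i) (τ (i + 1)) := by
  induction N with
  | zero => exact absurd hs.1 (not_lt.2 hs.2)
  | succ N ih =>
    rcases le_or_gt s (τ N) with h | h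
    · obtain ⟨i, hi, h'⟩ := ih ⟨hs.1, h⟩
      exact ⟨i, hi.trans N.lt_succ_self, h'⟩
    · exact ⟨N, N.lt_succ_self, h, hs.2⟩

/-- The points of the uniform partition of `[t, T]` into `N` intervals. -/
noncomputable def gridTime (t T : ℝ≥0) (N i : ℕ) : ℝ≥0 := t + (T - t) * (i / N)

lemma gridTime_zero (t T : ℝ≥0) (N : ℕ) : gridTime t T N 0 = t := by simp [gridTime]

lemma gridTime_last {t T : ℝ≥0} (h : t ≤ T) {N : ℕ} (hN : 0 < N) : gridTime t T N N = T := by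
  have : (N : ℝ≥0) ≠ 0 := by positivity
  rw [gridTime, div_self this, mul_one, add_tsub_cancel_of_le h]

lemma gridTime_mono (t T : ℝ≥0) (N : ℕ) : Monotone (gridTime t T N) := by
  intro i j hij
  unfold gridTime
  gcongr

lemma gridTime_succ (t T : ℝ≥0) (N i : ℕ) :
    gridTime t T N (i + 1) = gridTime t T N i + (T - t) / N := by
  unfold gridTime
  push_cast
  ring

/-- The simple process with deterministic values `c i` on `(τ i, τ (i + 1)]`. -/
def constSimple (𝓕 : Filtration ℝ≥0 mΩ) (τ : ℕ → ℝ≥0) (hτ : Monotone τ) (N : ℕ)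
    (c : ℕ → EuclideanSpace ℝ (Fin n)) : SimpleProcess 𝓕 n where
  N := N
  τ i := τ (min i N)
  mono i j hij := hτ (min_le_min_right _ hij)
  ξ i _ := c (min i N)
  measurable _ := measurable_const
  bounded := by
    refine ⟨∑ i ∈ Finset.range (N + 1), ‖c i‖, fun i _ => ?_⟩
    exact Finset.single_le_sum (f := fun i => ‖c i‖) (fun _ _ => norm_nonneg _)
      (Finset.mem_range.2 (by omega : min i N < N + 1))

lemma measurable_past_integral_constSimple (hW : ∀ s, Measurable (W s)) {τ : ℕ → ℝ≥0}
    (hτ : Monotone τ) (N : ℕ) (c : ℕ → EuclideanSpace ℝ (Fin n)) (s : ℝ≥0) :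
    Measurable[brownianFiltration P W hW s]
      ((constSimple (brownianFiltration P W hW) τ hτ N c).integral W 0 s) := by
  unfold SimpleProcess.integral constSimple
  refine @Finset.measurable_fun_sum _ _ _ _ _ _ (_) _ _ fun i _ => ?_
  have h : ∀ u, Measurable[brownianFiltration P W hW s] (W (min s u)) := fun u =>
    measurable_past hW (min_le_left _ _)
  have h0 : ∀ u, Measurable[brownianFiltration P W hW s] (W (min 0 u)) := fun u =>
    measurable_past hW ((min_le_left _ _).trans zero_le)
  have hc : Measurable fun v => ⟪c (min i N), v⟫ := by fun_prop
  exact (hc.comp ((h _).sub (h _))).sub (hc.comp ((h0 _).sub (h0 _)))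

lemma measurable_future_integral_constSimple (hW : ∀ s, Measurable (W s)) {τ : ℕ → ℝ≥0}
    (hτ : Monotone τ) (N : ℕ) (c : ℕ → EuclideanSpace ℝ (Fin n)) {a b : ℝ≥0} (hab : a ≤ b) :
    Measurable[futureSigma P W a] (fun ω =>
      (constSimple (brownianFiltration P W hW) τ hτ N c).integral W 0 b ω -
        (constSimple (brownianFiltration P W hW) τ hτ N c).integral W 0 a ω) := by
  unfold SimpleProcess.integral constSimple
  simp_rw [← Finset.sum_sub_distrib, sub_sub_sub_cancel_right]
  refine @Finset.measurable_fun_sum _ _ _ _ _ _ (_) _ _ fun i _ => ?_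
  have h : ∀ u, Measurable[futureSigma P W a] (fun ω => W (min b u) ω - W (min a u) ω) := by
    intro u
    rcases le_total u a with h | h
    · rw [min_eq_right h, min_eq_right (h.trans hab)]
      simp only [sub_self]
      exact @measurable_const _ _ _ (_) _
    · rw [min_eq_left h]
      exact measurable_future le_rfl (le_min hab h)
  have hc : Measurable fun v => ⟪c (min i N), v⟫ := by fun_prop
  have e : ∀ ω, ⟪c (min i N), W (min b (τ (min (i + 1) N))) ω - W (min b (τ (min i N))) ω⟫ -
      ⟪c (min i N), W (min a (τ (min (i + 1) N))) ω - W (min a (τ (min i N))) ω⟫ =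
      ⟪c (min i N), (W (min b (τ (min (i + 1) N))) ω - W (min a (τ (min (i + 1) N))) ω) -
        (W (min b (τ (min i N))) ω - W (min a (τ (min i N))) ω)⟫ := by
    intro ω
    rw [← inner_sub_right]
    congr 1
    abel
  simp_rw [e]
  exact hc.comp ((h _).sub (h _))

lemma SimpleProcess.continuous_integral (H : SimpleProcess 𝓕 n) {ω : Ω}
    (hω : Continuous fun s => W s ω) (t : ℝ≥0) : Continuous fun s => H.integral W t s ω := by
  simp only [SimpleProcess.integral]
  fun_prop

/-- Continuous functions are uniform limits of step functions. -/
lemma exists_constSimple_approx (𝓕 : Filtration ℝ≥0 mΩ) {θ : ℝ≥0 → EuclideanSpace ℝ (Fin n)}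
    (hθ : Continuous θ) (T : ℝ≥0) {ε : ℝ} (hε : 0 < ε) :
    ∃ (τ : ℕ → ℝ≥0) (hτ : Monotone τ) (N : ℕ) (c : ℕ → EuclideanSpace ℝ (Fin n)),
      ∀ s ∈ Set.Ioc 0 T, ∀ ω, ‖(constSimple 𝓕 τ hτ N c).val s ω - θ s‖ ≤ ε := by
  have huc := (isCompact_Icc (a := (0 : ℝ≥0)) (b := T)).uniformContinuousOn_of_continuous
    hθ.continuousOn
  obtain ⟨δ, hδ, hu⟩ := Metric.uniformContinuousOn_iff.1 huc ε hε
  obtain ⟨N, hN⟩ := exists_nat_gt ((T : ℝ) / δ)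
  have hN0 : 0 < N := by
    have : (0 : ℝ) < N := lt_of_le_of_lt (by positivity) hN
    exact_mod_cast this
  refine ⟨gridTime 0 T N, gridTime_mono 0 T N, N, fun i => θ (gridTime 0 T N i), ?_⟩
  intro s hs ω
  obtain ⟨i, hi, hsi⟩ := exists_mem_Ioc_of_monotone (τ := gridTime 0 T N) (N := N) (s := s)
    (by rwa [gridTime_zero, gridTime_last zero_le hN0])
  rw [SimpleProcess.val_of_mem (constSimple 𝓕 _ (gridTime_mono 0 T N) N _) (i := i) hi
    (by simpa only [constSimple, min_eq_left hi.le, min_eq_left (Nat.succ_le_of_lt hi)])]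
  simp only [constSimple, min_eq_left hi.le]
  rw [← dist_eq_norm]
  refine (hu _ ⟨zero_le, hsi.1.le.trans hs.2⟩ _ ⟨zero_le, hs.2⟩ ?_).le
  rw [gridTime_succ, tsub_zero] at hsi
  have h1 : (gridTime 0 T N i : ℝ) < s := hsi.1
  have h2 : (s : ℝ) ≤ gridTime 0 T N i + T / N := by exact_mod_cast hsi.2
  have h3 : (T : ℝ) / N < δ := by
    rw [div_lt_iff₀ hδ] at hN
    rw [div_lt_iff₀ (by exact_mod_cast hN0)]
    linarith
  rw [NNReal.dist_eq, abs_sub_comm, abs_of_pos (by linarith)]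
  linarith

end Grid


/-- The error of a Riemann sum whose tags approximate the integrand within `η` on each cell. -/
lemma abs_riemann_sum_sub_integral_le {s : ℕ → ℝ} (hs : Monotone s) {f : ℝ → ℝ}
    (hf : ∀ a b, IntervalIntegrable f volume a b) (d : ℕ → ℝ) {η : ℝ} (N : ℕ)
    (h : ∀ i < N, ∀ r ∈ Set.Ioc (s i) (s (i + 1)), |d i - f r| ≤ η) :
    |∑ i ∈ Finset.range N, d i * (s (i + 1) - s i) - ∫ r in (s 0)..(s N), f r| ≤
      η * (s N - s 0) := by
  rw [← intervalIntegral.sum_integral_adjacent_intervals fun k _ => hf _ _,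
    ← Finset.sum_sub_distrib, ← Finset.sum_range_sub s, Finset.mul_sum]
  refine (Finset.abs_sum_le_sum_abs _ _).trans (Finset.sum_le_sum fun i hi => ?_)
  have h1 : d i * (s (i + 1) - s i) - ∫ r in (s i)..(s (i + 1)), f r =
      ∫ r in (s i)..(s (i + 1)), (d i - f r) := by
    rw [intervalIntegral.integral_sub (by simp) (hf _ _), intervalIntegral.integral_const,
      smul_eq_mul, mul_comm]
  rw [h1]
  have h2 := intervalIntegral.norm_integral_le_of_norm_le_const (C := η) (a := s i) (b := s (i + 1))
    (f := fun r => d i - f r) fun r hr => by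
      rw [Set.uIoc_of_le (hs i.le_succ)] at hr
      exact h i (Finset.mem_range.1 hi) r hr
  rwa [Real.norm_eq_abs, abs_of_nonneg (sub_nonneg.2 (hs i.le_succ))] at h2

section Wiener

variable {Ω : Type*} {mΩ : MeasurableSpace Ω} {n : ℕ} {P : Measure Ω}
  {W : ℝ≥0 → Ω → EuclideanSpace ℝ (Fin n)}

lemma IsStandardBrownian.ae_continuous (hW : IsStandardBrownian W P) :
    ∀ᵐ ω ∂P, Continuous fun s => W s ω := by
  filter_upwards [ae_all_iff.2 fun i => (hW.isBrownianReal i).cont] with ω h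
  exact (PiLp.continuous_toLp 2 (fun _ : Fin n => ℝ)).comp (continuous_pi h)

/-- `B` is the Wiener integral `B_s = ∫_0^s θ' dW` on `[0, T]` of a deterministic function `θ`,
frozen after time `T`; the last field encodes the Itô isometry jointly with the increments
of `W`. -/
structure IsWienerIntegral (hW : IsStandardBrownian W P) (θ : ℝ≥0 → EuclideanSpace ℝ (Fin n))
    (T : ℝ≥0) (B : ℝ≥0 → Ω → ℝ) : Prop where
  continuous : ∀ ω, Continuous fun s => B s ω
  past : ∀ s, Measurable[brownianFiltration P W hW.measurable s] (B s)
  future : ∀ a b, a ≤ b → b ≤ T → Measurable[futureSigma P W a] (fun ω => B b ω - B a ω)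
  law : ∀ (c : EuclideanSpace ℝ (Fin n)) (a b : ℝ≥0), a ≤ b → b ≤ T →
    P.map (fun ω => ⟪c, W b ω - W a ω⟫ - (B b ω - B a ω)) =
      gaussianReal 0 (Real.toNNReal (∫ r in (a : ℝ)..b, ‖c - θ r.toNNReal‖ ^ 2))

/-- The Wiener integral of a continuous function exists: it is the almost surely uniform limit of
the elementary integrals of step functions converging uniformly to `θ` at a geometric rate. The
Gaussian law passes to the limit through the variances. -/
theorem exists_isWienerIntegral [IsProbabilityMeasure P] [P.IsComplete]
    (hW : IsStandardBrownian W P) {θ : ℝ≥0 → EuclideanSpace ℝ (Fin n)} (hθ : Continuous θ)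
    (T : ℝ≥0) : ∃ B, IsWienerIntegral hW θ T B := by
  classical
  set 𝓕 := brownianFiltration P W hW.measurable with h𝓕
  choose τ hτ N c hval using fun k : ℕ =>
    exists_constSimple_approx 𝓕 hθ T (ε := (1 / 4 : ℝ) ^ k) (by positivity)
  set H : ℕ → SimpleProcess 𝓕 n := fun k => constSimple 𝓕 (τ k) (hτ k) (N k) (c k) with hH
  set L : ℕ → ℝ≥0 → Ω → ℝ := fun k s ω => (H k).integral W 0 s ω with hL
  -- the distances `(1/4)^k` make the failure probabilities `O((1/4)^k)` summable
  have hBC : ∀ᵐ ω ∂P, ∀ᶠ k in atTop,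
      ω ∉ {ω | ∃ s ≤ T, (1 / 2 : ℝ) ^ k < |L (k + 1) s ω - L k s ω|} := by
    refine ae_eventually_notMem (ne_top_of_le_ne_top
      (Summable.tsum_ofReal_ne_top (f := fun k : ℕ => 4 * (n * T) * (1 / 4 : ℝ) ^ k)
        ((summable_geometric_of_lt_one (by norm_num) (by norm_num)).mul_left _))
      (ENNReal.tsum_le_tsum fun k => ?_))
    refine (hW.measure_exists_abs_integral_sub_gt_le (H (k + 1)) (H k) (T := T)
      (ε := 2 * (1 / 4 : ℝ) ^ k) (by positivity) ?_ (by positivity) hW.ae_continuous).trans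
      (ENNReal.ofReal_le_ofReal ?_)
    · intro s hs ω
      have h1 := hval (k + 1) s hs ω
      have h2 := hval k s hs ω
      have h3 : (1 / 4 : ℝ) ^ (k + 1) ≤ (1 / 4) ^ k :=
        pow_le_pow_of_le_one (by norm_num) (by norm_num) k.le_succ
      calc ‖(H (k + 1)).val s ω - (H k).val s ω‖
          = ‖((H (k + 1)).val s ω - θ s) - ((H k).val s ω - θ s)‖ := by
            rw [sub_sub_sub_cancel_right]
        _ ≤ _ := norm_sub_le _ _
        _ ≤ _ := by linarith
    · rw [div_le_iff₀ (by positivity)]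
      have : ((1 / 2 : ℝ) ^ k) ^ 2 = (1 / 4) ^ k := by
        rw [← pow_mul, mul_comm, pow_mul]
        norm_num
      rw [this]
      apply le_of_eq
      ring
  -- the almost sure event on which the approximations converge to a continuous path
  let Good : Set Ω := {ω | ∃ f : ℝ≥0 → ℝ, Continuous f ∧
    ∀ s, Tendsto (fun k => L k (min s T) ω) atTop (𝓝 (f s))}
  have hGood : ∀ᵐ ω ∂P, ω ∈ Good := by
    filter_upwards [hBC, hW.ae_continuous] with ω h hc
    obtain ⟨K, hK⟩ := eventually_atTop.1 h
    -- a telescoping series dominated by a geometric one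
    set g : ℕ → ℝ≥0 → ℝ := fun j s => L (K + j + 1) (min s T) ω - L (K + j) (min s T) ω with hg
    have hgb : ∀ j s, ‖g j s‖ ≤ (1 / 2 : ℝ) ^ j := by
      intro j s
      have h1 := hK (K + j) (Nat.le_add_right _ _)
      simp only [not_exists, not_and, not_lt] at h1
      exact (h1 _ (min_le_right s T)).trans
        (pow_le_pow_of_le_one (by norm_num) (by norm_num) (Nat.le_add_left _ _))
    have hLc : ∀ k, Continuous fun s => L k (min s T) ω := fun k =>
      ((H k).continuous_integral hc 0).comp (continuous_id.min continuous_const)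
    have hsum := summable_geometric_of_lt_one (r := (1 / 2 : ℝ)) (by norm_num) (by norm_num)
    refine ⟨fun s => L K (min s T) ω + ∑' j, g j s, (hLc K).add
      (continuous_tsum (fun j => (hLc _).sub (hLc _)) hsum hgb), fun s => ?_⟩
    have h2 : Tendsto (fun m => ∑ j ∈ Finset.range m, g j s) atTop (𝓝 (∑' j, g j s)) :=
      (Summable.of_norm_bounded hsum fun j => hgb j s).hasSum.tendsto_sum_nat
    have h3 : ∀ m, L K (min s T) ω + ∑ j ∈ Finset.range m, g j s = L (m + K) (min s T) ω := by
      intro m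
      have := Finset.sum_range_sub (fun j => L (K + j) (min s T) ω) m
      simp only [hg]
      rw [show ∑ j ∈ Finset.range m, (L (K + j + 1) (min s T) ω - L (K + j) (min s T) ω) =
        L (K + m) (min s T) ω - L K (min s T) ω from this, add_comm m K]
      ring
    refine (tendsto_add_atTop_iff_nat K).1 ?_
    simp_rw [← h3]
    exact h2.const_add _
  have hGood0 : P Goodᶜ = 0 := hGood
  -- set to `0` off the good event, the limit is continuous everywhere; measurability with respect
  -- to past and future survives because both `σ`-algebras contain the null sets
  let B : ℝ≥0 → Ω → ℝ := fun s ω => if h : ω ∈ Good then h.choose s else 0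
  have hBlim : ∀ s ω, Tendsto (fun k => Good.indicator (L k (min s T)) ω) atTop (𝓝 (B s ω)) := by
    intro s ω
    by_cases h : ω ∈ Good
    · simp only [B, dif_pos h, Set.indicator_of_mem h]
      exact h.choose_spec.2 s
    · simp only [B, dif_neg h, Set.indicator_of_notMem h]
      exact tendsto_const_nhds
  have hpast : ∀ s, Measurable[𝓕 s] (B s) := by
    intro s
    refine @measurable_of_tendsto_metrizable _ _ (𝓕 s) _ _ _ _ _ _ (fun k => ?_)
      (tendsto_pi_nhds.2 (hBlim s))
    refine Measurable.indicator ?_ ?_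
    · exact (measurable_past_integral_constSimple hW.measurable (hτ k) (N k) (c k)
        (min s T)).mono (𝓕.mono (min_le_left _ _)) le_rfl
    · have := (measurableSet_past_of_null hW.measurable s hGood0).compl
      rwa [compl_compl] at this
  refine ⟨B, ?_, hpast, ?_, ?_⟩
  · intro ω
    by_cases h : ω ∈ Good
    · simp only [B, dif_pos h]
      exact h.choose_spec.1
    · simp only [B, dif_neg h]
      exact continuous_const
  · intro a b hab hbT
    have hlim : ∀ ω, Tendsto (fun k => Good.indicator (fun ω => L k b ω - L k a ω) ω) atTop
        (𝓝 (B b ω - B a ω)) := by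
      intro ω
      have h1 := (hBlim b ω).sub (hBlim a ω)
      rw [min_eq_left hbT, min_eq_left (hab.trans hbT)] at h1
      refine h1.congr fun k => ?_
      by_cases h : ω ∈ Good <;> simp [h]
    refine @measurable_of_tendsto_metrizable _ _ (futureSigma P W a) _ _ _ _ _ _ (fun k => ?_)
      (tendsto_pi_nhds.2 hlim)
    refine Measurable.indicator ?_ ?_
    · exact measurable_future_integral_constSimple hW.measurable (hτ k) (N k) (c k) hab
    · have := (measurableSet_future_of_null (W := W) a hGood0).compl
      rwa [compl_compl] at this
  · intro d a b hab hbT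
    obtain ⟨R, hR⟩ : ∃ R : ℝ, ∀ r ∈ Set.Icc 0 T, ‖d - θ r‖ ≤ R :=
      isCompact_Icc.exists_bound_of_continuousOn (f := fun r => d - θ r) (by fun_prop)
    have hR0 : 0 ≤ R := (norm_nonneg _).trans (hR 0 ⟨le_rfl, zero_le⟩)
    have hfc : Continuous fun r : ℝ => ‖d - θ r.toNNReal‖ ^ 2 :=
      ((continuous_const.sub (hθ.comp continuous_real_toNNReal)).norm).pow 2
    choose s M hs h0 hM hS using fun k => exists_partition (H k).jumps hab
    have hJ : ∀ k i, (H k).JumpFree (s k i) (s k (i + 1)) := fun k i =>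
      (H k).jumpFree_of_jumps (hS k i)
    -- the step functions are deterministic: their values may be read off at one sample point `ω₀`
    have hdet : ∀ k r ω ω', (H k).val r ω = (H k).val r ω' := fun k r ω ω' => rfl
    have hne : Nonempty Ω := nonempty_of_isProbabilityMeasure P
    obtain ⟨ω₀⟩ := hne
    have hsb : ∀ k i, s k i ≤ b := fun k i => by
      rw [← hM k (max i (M k)) (le_max_right _ _)]
      exact hs k (le_max_left _ _)
    set v : ℕ → ℝ≥0 := fun k => ∑ i ∈ Finset.range (M k),
      ‖d - (H k).val (s k (i + 1)) ω₀‖₊ ^ 2 * (s k (i + 1) - s k i) with hv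
    have hmeasL : ∀ k u, Measurable (L k u) := fun k u =>
      (measurable_past_integral_constSimple hW.measurable (hτ k) (N k) (c k) u).mono
        (𝓕.le u) le_rfl
    have hmB : ∀ u, Measurable (B u) := fun u => (hpast u).mono (𝓕.le u) le_rfl
    have hmW : Measurable fun ω => ⟪d, W b ω - W a ω⟫ :=
      (by fun_prop : Measurable fun v => ⟪d, v⟫).comp ((hW.measurable b).sub (hW.measurable a))
    refine map_eq_gaussianReal_of_tendsto (v := v)
      (X := fun k ω => ⟪d, W b ω - W a ω⟫ - (L k b ω - L k a ω))
      (fun k => hmW.sub ((hmeasL k b).sub (hmeasL k a)))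
      (hmW.sub ((hmB b).sub (hmB a))) (fun k => ?_) ?_ ?_
    · rw [hv, ← hW.map_sum_inner (hs k)]
      congr 1
      ext ω
      have h1 : L k b ω - L k a ω = ∑ i ∈ Finset.range (M k),
          ⟪(H k).val (s k (i + 1)) ω, W (s k (i + 1)) ω - W (s k i) ω⟫ := by
        have := Finset.sum_range_sub (fun i => L k (s k i) ω) (M k)
        rw [h0, hM k _ le_rfl] at this
        rw [← this]
        exact Finset.sum_congr rfl fun i _ =>
          (H k).integral_sub 0 (hs k i.le_succ) (hJ k i) ω
      have h2 : W b ω - W a ω = ∑ i ∈ Finset.range (M k), (W (s k (i + 1)) ω - W (s k i) ω) := by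
        rw [Finset.sum_range_sub (fun i => W (s k i) ω), h0, hM k _ le_rfl]
      rw [h1]
      conv_lhs => rw [h2]
      rw [inner_sum, ← Finset.sum_sub_distrib]
      refine Finset.sum_congr rfl fun i _ => ?_
      rw [← inner_sub_left, hdet k _ ω ω₀]
    · filter_upwards [hGood] with ω hω
      have h1 := (hBlim b ω).sub (hBlim a ω)
      rw [min_eq_left hbT, min_eq_left (hab.trans hbT)] at h1
      simp only [Set.indicator_of_mem hω] at h1
      exact tendsto_const_nhds.sub h1
    -- the variances are Riemann sums of `‖d - θ‖²`
    · have hbound : ∀ k, |(v k : ℝ) - ∫ r in (a : ℝ)..b, ‖d - θ r.toNNReal‖ ^ 2| ≤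
          ((1 / 4 : ℝ) ^ k * (2 * R + 1)) * (b - a) := by
        intro k
        have := abs_riemann_sum_sub_integral_le (s := fun i => (s k i : ℝ))
          (fun i j hij => NNReal.coe_le_coe.2 (hs k hij)) (fun a b => hfc.intervalIntegrable a b)
          (fun i => ‖d - (H k).val (s k (i + 1)) ω₀‖ ^ 2) (η := (1 / 4 : ℝ) ^ k * (2 * R + 1))
          (M k) ?_
        · simp only [h0, hM k _ le_rfl] at this
          convert this using 3
          simp only [hv]
          push_cast
          exact Finset.sum_congr rfl fun i _ => by rw [NNReal.coe_sub (hs k i.le_succ)]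
        · intro i _ r hr
          have hr0 : 0 ≤ r := (NNReal.coe_nonneg _).trans hr.1.le
          lift r to ℝ≥0 using hr0
          have hr' : r ∈ Set.Ioc (s k i) (s k (i + 1)) :=
            ⟨NNReal.coe_lt_coe.1 hr.1, NNReal.coe_le_coe.1 hr.2⟩
          have hrT : r ≤ T := hr'.2.trans ((hsb k _).trans hbT)
          rw [Real.toNNReal_coe, ← (H k).val_eq hr' (hJ k i)]
          have h1 := hval k r ⟨lt_of_le_of_lt zero_le hr'.1, hrT⟩ ω₀
          have h2 := hR r ⟨zero_le, hrT⟩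
          have h3 : |‖d - (H k).val r ω₀‖ - ‖d - θ r‖| ≤ (1 / 4 : ℝ) ^ k := by
            refine (abs_norm_sub_norm_le _ _).trans ?_
            rw [sub_sub_sub_cancel_left, ← norm_neg, neg_sub]
            exact h1
          have h4 : (1 / 4 : ℝ) ^ k ≤ 1 := pow_le_one₀ (by norm_num) (by norm_num)
          have h5 := abs_le.1 h3
          have h6 := norm_nonneg (d - θ r)
          have h7 := norm_nonneg (d - (H k).val r ω₀)
          rw [sq_sub_sq, abs_mul, mul_comm]
          refine mul_le_mul h3 ?_ (abs_nonneg _) (by positivity)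
          rw [abs_of_nonneg (by positivity)]
          linarith [h5.2]
      have hlim : Tendsto (fun k => (v k : ℝ)) atTop
          (𝓝 (∫ r in (a : ℝ)..b, ‖d - θ r.toNNReal‖ ^ 2)) := by
        rw [tendsto_iff_norm_sub_tendsto_zero]
        refine squeeze_zero (fun _ => norm_nonneg _) hbound ?_
        have := (tendsto_pow_atTop_nhds_zero_of_lt_one (r := (1 / 4 : ℝ)) (by norm_num)
          (by norm_num)).mul_const ((2 * R + 1) * (b - a))
        simpa [mul_assoc] using this
      have := (continuous_real_toNNReal.tendsto _).comp hlim
      refine this.congr fun k => ?_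
      simp

end Wiener


/-! ### The heat semigroup on smooth payoffs -/

section Heat

/-- The heat semigroup: `heat w G y = E[G (y + N)]` with `N` centred Gaussian of variance `w`. -/
noncomputable def heat (w : ℝ≥0) (G : ℝ → ℝ) (y : ℝ) : ℝ := ∫ u, G (y + u) ∂gaussianReal 0 w

lemma gaussianReal_zero_eq_map (w : ℝ≥0) :
    gaussianReal 0 w = (gaussianReal 0 1).map (fun u => √w * u) := by
  rw [gaussianReal_map_const_mul]
  congr 1
  · simp
  · ext
    simp

lemma heat_eq (w : ℝ≥0) {G : ℝ → ℝ} (hG : Continuous G) (y : ℝ) :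
    heat w G y = ∫ u, G (y + √w * u) ∂gaussianReal 0 1 := by
  rw [heat, gaussianReal_zero_eq_map, integral_map (by fun_prop)
    (by fun_prop : Continuous fun u => G (y + u)).aestronglyMeasurable]

lemma integrable_of_bdd_continuous {μ : Measure ℝ} [IsFiniteMeasure μ] {G : ℝ → ℝ}
    (hG : Continuous G) {C : ℝ} (hC : ∀ y, |G y| ≤ C) : Integrable G μ :=
  Integrable.of_bound hG.aestronglyMeasurable C (ae_of_all _ hC)

lemma continuous_heat {G : ℝ → ℝ} (hG : Continuous G) {C : ℝ} (hC : ∀ y, |G y| ≤ C) :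
    Continuous fun p : ℝ≥0 × ℝ => heat p.1 G p.2 := by
  simp_rw [heat_eq _ hG]
  refine continuous_of_dominated (bound := fun _ => C)
    (fun p => (by fun_prop : Continuous fun u => G (p.2 + √p.1 * u)).aestronglyMeasurable)
    (fun p => ae_of_all _ fun u => hC _) (integrable_const _) (ae_of_all _ fun u => ?_)
  fun_prop

lemma abs_heat_le {G : ℝ → ℝ} {C : ℝ} (hC : ∀ y, |G y| ≤ C) (w : ℝ≥0) (y : ℝ) :
    |heat w G y| ≤ C := by
  have := norm_integral_le_of_norm_le_const (μ := gaussianReal 0 w) (f := fun u => G (y + u))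
    (ae_of_all _ fun u => hC (y + u))
  simpa [heat] using this

lemma heat_mono {G H : ℝ → ℝ} (hG : Continuous G) (hH : Continuous H) {C : ℝ}
    (hCG : ∀ y, |G y| ≤ C) (hCH : ∀ y, |H y| ≤ C) (h : ∀ y, G y ≤ H y) (w : ℝ≥0) (y : ℝ) :
    heat w G y ≤ heat w H y :=
  integral_mono (integrable_of_bdd_continuous (by fun_prop) fun u => hCG (y + u))
    (integrable_of_bdd_continuous (by fun_prop) fun u => hCH (y + u)) fun u => h _

lemma heat_const (w : ℝ≥0) (c y : ℝ) : heat w (fun _ => c) y = c := by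
  simp [heat]

lemma heat_zero (G : ℝ → ℝ) (y : ℝ) : heat 0 G y = G y := by
  simp [heat]

/-- Semigroup property. -/
lemma heat_heat {G : ℝ → ℝ} (hG : Continuous G) {C : ℝ} (hC : ∀ y, |G y| ≤ C) (v w : ℝ≥0) (y : ℝ) :
    heat v (heat w G) y = heat (w + v) G y := by
  have hi : Integrable (fun u => G (y + u)) (gaussianReal 0 v ∗ gaussianReal 0 w) :=
    Integrable.of_bound (by fun_prop : Continuous fun u => G (y + u)).aestronglyMeasurable C
      (ae_of_all _ fun u => hC (y + u))
  have h1 : gaussianReal 0 v ∗ gaussianReal 0 w = gaussianReal 0 (w + v) := by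
    rw [gaussianReal_conv_gaussianReal, add_zero, add_comm]
  have h2 := integral_conv hi
  rw [h1] at h2
  simp only [heat]
  rw [h2]
  simp only [add_assoc]

/-- A bounded payoff with bounded Lipschitz derivative; `C` bounds all three quantities. -/
structure SmoothPayoff (G G' : ℝ → ℝ) (C : ℝ) : Prop where
  hasDerivAt : ∀ y, HasDerivAt G (G' y) y
  bound : ∀ y, |G y| ≤ C
  bound' : ∀ y, |G' y| ≤ C
  lipschitz : ∀ y z, |G' y - G' z| ≤ C * |y - z|

variable {G G' : ℝ → ℝ} {C : ℝ}

lemma SmoothPayoff.nonneg (h : SmoothPayoff G G' C) : 0 ≤ C := (abs_nonneg _).trans (h.bound 0)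

lemma SmoothPayoff.continuous (h : SmoothPayoff G G' C) : Continuous G :=
  continuous_iff_continuousAt.2 fun y => (h.hasDerivAt y).continuousAt

lemma SmoothPayoff.continuous' (h : SmoothPayoff G G' C) : Continuous G' := by
  refine (LipschitzWith.of_dist_le_mul (K := C.toNNReal) fun y z => ?_).continuous
  rw [Real.dist_eq, Real.dist_eq, Real.coe_toNNReal _ h.nonneg]
  exact h.lipschitz y z

/-- First-order Taylor expansion with quadratic remainder. -/
lemma SmoothPayoff.taylor (h : SmoothPayoff G G' C) (y β : ℝ) :
    |G (y + β) - G y - G' y * β| ≤ C * β ^ 2 := by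
  have hmv : ∀ u v : ℝ, u < v → ∃ c ∈ Set.Ioo u v, G v - G u = G' c * (v - u) := by
    intro u v huv
    obtain ⟨c, hc, hc'⟩ := exists_hasDerivAt_eq_slope G G' huv h.continuous.continuousOn
      fun x _ => h.hasDerivAt x
    refine ⟨c, hc, ?_⟩
    rw [hc', div_mul_cancel₀ _ (sub_ne_zero.2 huv.ne')]
  have key : ∃ c, |c - y| ≤ |β| ∧ G (y + β) - G y = G' c * β := by
    rcases lt_trichotomy β 0 with hβ | rfl | hβ
    · obtain ⟨c, hc, e⟩ := hmv (y + β) y (by linarith)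
      refine ⟨c, ?_, by linear_combination -e⟩
      rw [abs_of_neg hβ, abs_le]
      constructor <;> linarith [hc.1, hc.2]
    · exact ⟨y, by simp, by simp⟩
    · obtain ⟨c, hc, e⟩ := hmv y (y + β) (by linarith)
      refine ⟨c, ?_, by linear_combination e⟩
      rw [abs_of_pos hβ, abs_le]
      constructor <;> linarith [hc.1, hc.2]
  obtain ⟨c, hc, e⟩ := key
  rw [e, ← sub_mul, abs_mul, ← sq_abs, pow_two, ← mul_assoc]
  refine mul_le_mul_of_nonneg_right ((h.lipschitz c y).trans ?_) (abs_nonneg _)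
  exact mul_le_mul_of_nonneg_left hc h.nonneg

/-- The heat flow preserves smooth payoffs, with the same bounds. -/
lemma SmoothPayoff.heat (h : SmoothPayoff G G' C) (w : ℝ≥0) :
    SmoothPayoff (heat w G) (heat w G') C where
  hasDerivAt y := by
    have := hasDerivAt_integral_of_dominated_loc_of_deriv_le (μ := gaussianReal 0 w)
      (F := fun y u => G (y + u)) (F' := fun y u => G' (y + u)) (x₀ := y) (s := Set.univ)
      (bound := fun _ => C) Filter.univ_mem
      (Eventually.of_forall fun x => (h.continuous.comp
        (continuous_const.add continuous_id)).aestronglyMeasurable)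
      (integrable_of_bdd_continuous (h.continuous.comp (continuous_const.add continuous_id))
        fun u => h.bound _)
      (h.continuous'.comp (continuous_const.add continuous_id)).aestronglyMeasurable
      (ae_of_all _ fun u x _ => h.bound' _) (integrable_const _)
      (ae_of_all _ fun u x _ => (h.hasDerivAt (x + u)).comp_add_const x u)
    exact this.2
  bound := abs_heat_le h.bound w
  bound' := abs_heat_le h.bound' w
  lipschitz y z := by
    have hi : ∀ y, Integrable (fun u => G' (y + u)) (gaussianReal 0 w) := fun y =>
      integrable_of_bdd_continuous (h.continuous'.comp (continuous_const.add continuous_id))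
        fun u => h.bound' _
    rw [UtilityMax.heat, UtilityMax.heat, ← integral_sub (hi y) (hi z)]
    have := norm_integral_le_of_norm_le_const (μ := gaussianReal 0 w)
      (f := fun u => G' (y + u) - G' (z + u)) (C := C * |y - z|)
      (ae_of_all _ fun u => (h.lipschitz _ _).trans (by rw [add_sub_add_right_eq_sub]))
    simpa using this

lemma integral_sq_gaussianReal (w : ℝ≥0) : ∫ u, u ^ 2 ∂gaussianReal 0 w = w := by
  rw [← variance_fun_id_gaussianReal (μ := 0) (v := w), variance_of_integral_eq_zero
    (by fun_prop) integral_id_gaussianReal]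

lemma integrable_sq_gaussianReal (w : ℝ≥0) : Integrable (fun u : ℝ => u ^ 2) (gaussianReal 0 w) :=
  (memLp_id_gaussianReal 2).integrable_sq

lemma integral_abs_gaussianReal_le (w : ℝ≥0) : ∫ u, |u| ∂gaussianReal 0 w ≤ √w := by
  have h1 : MemLp (fun u : ℝ => |u|) 2 (gaussianReal 0 w) := (memLp_id_gaussianReal 2).abs
  have h2 := variance_nonneg (fun u : ℝ => |u|) (gaussianReal 0 w)
  rw [variance_eq_sub h1] at h2
  simp only [Pi.pow_apply, sq_abs] at h2
  rw [integral_sq_gaussianReal] at h2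
  exact Real.le_sqrt_of_sq_le (by linarith)

/-- The heat flow moves a smooth payoff by `O(Δ)`: the linear Taylor term has mean zero. -/
lemma SmoothPayoff.abs_heat_sub_le (h : SmoothPayoff G G' C) (Δ : ℝ≥0) (y : ℝ) :
    |UtilityMax.heat Δ G y - G y| ≤ C * Δ := by
  have hi : Integrable (fun u => G (y + u)) (gaussianReal 0 Δ) :=
    integrable_of_bdd_continuous (h.continuous.comp (continuous_const.add continuous_id))
        fun u => h.bound _
  have hi2 : Integrable (fun u : ℝ => u) (gaussianReal 0 Δ) :=
    (memLp_id_gaussianReal 1).integrable (by simp)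
  have e : UtilityMax.heat Δ G y - G y = ∫ u, (G (y + u) - G y - G' y * u) ∂gaussianReal 0 Δ := by
    have hi3 : Integrable (fun u => G (y + u) - G y) (gaussianReal 0 Δ) :=
      hi.sub (integrable_const _)
    rw [integral_sub hi3 (hi2.const_mul _), integral_sub hi (integrable_const _),
      integral_const_mul, integral_id_gaussianReal]
    simp [UtilityMax.heat]
  rw [e, ← integral_sq_gaussianReal Δ, ← integral_const_mul, ← Real.norm_eq_abs]
  exact norm_integral_le_of_norm_le ((integrable_sq_gaussianReal Δ).const_mul _)
    (ae_of_all _ fun u => h.taylor y u)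

/-- The heat flow moves the derivative, which is only Lipschitz, by `O(√Δ)`. -/
lemma SmoothPayoff.abs_heat_deriv_sub_le (h : SmoothPayoff G G' C) (Δ : ℝ≥0) (y : ℝ) :
    |UtilityMax.heat Δ G' y - G' y| ≤ C * √Δ := by
  have hi : Integrable (fun u => G' (y + u)) (gaussianReal 0 Δ) :=
    integrable_of_bdd_continuous (h.continuous'.comp (continuous_const.add continuous_id))
        fun u => h.bound' _
  have hi2 : Integrable (fun u : ℝ => |u|) (gaussianReal 0 Δ) :=
    ((memLp_id_gaussianReal 1).integrable (by simp)).abs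
  have e : UtilityMax.heat Δ G' y - G' y = ∫ u, (G' (y + u) - G' y) ∂gaussianReal 0 Δ := by
    rw [integral_sub hi (integrable_const _)]
    simp [UtilityMax.heat]
  rw [e, ← Real.norm_eq_abs]
  refine (norm_integral_le_of_norm_le (hi2.const_mul C) (ae_of_all _ fun u => ?_)).trans ?_
  · exact (h.lipschitz _ _).trans (by simp)
  · rw [integral_const_mul]
    exact mul_le_mul_of_nonneg_left (integral_abs_gaussianReal_le Δ) h.nonneg

/-- The one-step error of delta hedging. -/
lemma SmoothPayoff.abs_hedge_error_le (h : SmoothPayoff G G' C) (w Δ : ℝ≥0) (hΔ : Δ ≤ 1)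
    (y β : ℝ) :
    |UtilityMax.heat w G (y + Δ + β) - UtilityMax.heat (w + Δ) G (y + Δ) -
      UtilityMax.heat (w + Δ) G' y * β| ≤ 3 * C * (β ^ 2 + Δ) := by
  have hw := h.heat w
  have hC := h.nonneg
  have hΔ0 : (0 : ℝ) ≤ Δ := Δ.2
  have hΔ1 : (Δ : ℝ) ≤ 1 := by exact_mod_cast hΔ
  have h1 := hw.taylor (y + Δ) β
  have h2 := hw.abs_heat_sub_le Δ (y + Δ)
  have h3 := hw.lipschitz (y + Δ) y
  have h4 := hw.abs_heat_deriv_sub_le Δ y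
  rw [heat_heat h.continuous h.bound] at h2
  rw [heat_heat h.continuous' h.bound'] at h4
  rw [add_sub_cancel_left, abs_of_nonneg hΔ0] at h3
  have hs0 := Real.sqrt_nonneg (Δ : ℝ)
  have hsq := Real.sq_sqrt hΔ0
  have hb := sq_abs β
  have hsb : √(Δ : ℝ) * |β| ≤ (β ^ 2 + Δ) / 2 := by nlinarith [sq_nonneg (√(Δ : ℝ) - |β|)]
  -- this is where `Δ ≤ 1` enters
  have hΔs : (Δ : ℝ) ≤ √(Δ : ℝ) := by
    rw [Real.le_sqrt hΔ0 hΔ0]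
    nlinarith
  have hΔb : (Δ : ℝ) * |β| ≤ (β ^ 2 + Δ) / 2 :=
    (mul_le_mul_of_nonneg_right hΔs (abs_nonneg _)).trans hsb
  have h3' := mul_le_mul_of_nonneg_right h3 (abs_nonneg β)
  have h4' := mul_le_mul_of_nonneg_right h4 (abs_nonneg β)
  rw [← abs_mul] at h3' h4'
  -- Taylor expansion at time-to-maturity `w`, then correction of the value by the heat flow over
  -- `Δ`, and of the delta by the spatial shift `Δ` and by the heat flow over `Δ`
  have e : UtilityMax.heat w G (y + Δ + β) - UtilityMax.heat (w + Δ) G (y + Δ) -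
      UtilityMax.heat (w + Δ) G' y * β =
      (UtilityMax.heat w G (y + Δ + β) - UtilityMax.heat w G (y + Δ) -
        UtilityMax.heat w G' (y + Δ) * β) -
      (UtilityMax.heat (w + Δ) G (y + Δ) - UtilityMax.heat w G (y + Δ)) +
      (UtilityMax.heat w G' (y + Δ) - UtilityMax.heat w G' y) * β -
      (UtilityMax.heat (w + Δ) G' y - UtilityMax.heat w G' y) * β := by ring
  rw [e]
  have h5 : C * Δ * |β| ≤ C * ((β ^ 2 + Δ) / 2) := by
    rw [mul_assoc]; exact mul_le_mul_of_nonneg_left hΔb hC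
  have h6 : C * √(Δ : ℝ) * |β| ≤ C * ((β ^ 2 + Δ) / 2) := by
    rw [mul_assoc]; exact mul_le_mul_of_nonneg_left hsb hC
  have t1 := abs_le.1 h1
  have t2 := abs_le.1 h2
  have t3 := abs_le.1 (h3'.trans h5)
  have t4 := abs_le.1 (h4'.trans h6)
  have hp : 0 ≤ C * β ^ 2 := by positivity
  have hp' : 0 ≤ C * Δ := by positivity
  rw [abs_le]
  constructor <;> nlinarith [t1.1, t1.2, t2.1, t2.2, t3.1, t3.2, t4.1, t4.2]

end Heat


/-! ### Path oscillation -/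

section Oscillation

variable {Ω : Type*} {mΩ : MeasurableSpace Ω} {P : Measure Ω}

/-- The modulus of continuity of an almost surely continuous process tends to zero in
probability. -/
lemma tendsto_measure_oscillation [IsFiniteMeasure P] {M : Type*} [MetricSpace M]
    [SecondCountableTopology M] [MeasurableSpace M] [BorelSpace M] {Z : ℝ≥0 → Ω → M}
    (hZ : ∀ s, Measurable (Z s)) (hc : ∀ᵐ ω ∂P, Continuous fun s => Z s ω) (T : ℝ≥0)
    {δ : ℕ → ℝ} (hδ : Tendsto δ atTop (𝓝 0)) {ε : ℝ} (hε : 0 < ε) :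
    Tendsto (fun k => P {ω | ∃ s ∈ Set.Icc 0 T, ∃ s' ∈ Set.Icc 0 T,
      dist s s' ≤ δ k ∧ ε < dist (Z s ω) (Z s' ω)}) atTop (𝓝 0) := by
  have : Nonempty (Set.Icc (0 : ℝ≥0) T) := ⟨⟨0, le_rfl, zero_le⟩⟩
  obtain ⟨q, hq⟩ := TopologicalSpace.exists_dense_seq (Set.Icc (0 : ℝ≥0) T)
  -- measurability is secured by comparing only times of a dense sequence; the events `A m` decrease
  -- to the event that the path is not uniformly continuous at level `ε`
  let A : ℕ → Set Ω := fun m => ⋃ (i : ℕ) (j : ℕ) (_ : dist (q i) (q j) < 1 / (m + 1 : ℝ)),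
    {ω | ε < dist (Z (q i) ω) (Z (q j) ω)}
  have hAmeas : ∀ m, MeasurableSet (A m) := fun m =>
    MeasurableSet.iUnion fun i => MeasurableSet.iUnion fun j => MeasurableSet.iUnion fun _ =>
      measurableSet_lt measurable_const ((hZ _).dist (hZ _))
  have hAanti : Antitone A := by
    intro m m' hm ω hω
    simp only [A, Set.mem_iUnion] at hω ⊢
    obtain ⟨i, j, h1, h2⟩ := hω
    refine ⟨i, j, h1.trans_le ?_, h2⟩
    gcongr
  have hnull : P (⋂ m, A m) = 0 := by
    refine measure_mono_null (t := {ω | ¬ Continuous fun s => Z s ω}) (fun ω hω hcont => ?_) hc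
    have huc := (isCompact_Icc (a := (0 : ℝ≥0)) (b := T)).uniformContinuousOn_of_continuous
      hcont.continuousOn
    obtain ⟨d, hd, hu⟩ := Metric.uniformContinuousOn_iff.1 huc ε hε
    obtain ⟨m, hm⟩ := exists_nat_one_div_lt hd
    have h := Set.mem_iInter.1 hω m
    simp only [A, Set.mem_iUnion] at h
    obtain ⟨i, j, h1, h2⟩ := h
    exact absurd (hu (q i) (q i).2 (q j) (q j).2 (h1.trans hm)) (not_lt.2 (le_of_lt h2))
  have hlim : Tendsto (fun m => P (A m)) atTop (𝓝 0) := by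
    rw [← hnull]
    exact tendsto_measure_iInter_atTop (fun m => (hAmeas m).nullMeasurableSet) hAanti
      ⟨0, measure_ne_top _ _⟩
  rw [ENNReal.tendsto_atTop_zero] at hlim ⊢
  intro e he
  obtain ⟨m, hm⟩ := hlim e he
  have hev : ∀ᶠ k in atTop, δ k < 1 / (m + 1 : ℝ) := hδ.eventually_lt_const (by positivity)
  obtain ⟨K, hK⟩ := eventually_atTop.1 hev
  refine ⟨K, fun k hk => le_trans (measure_mono_ae ?_) (hm m le_rfl)⟩
  filter_upwards [hc] with ω hω
  rintro ⟨s, hs, s', hs', h1, h2⟩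
  -- the strict inequalities define an open set of pairs, which meets the dense sequence of pairs
  have hopen : IsOpen {p : Set.Icc (0 : ℝ≥0) T × Set.Icc (0 : ℝ≥0) T |
      dist p.1 p.2 < 1 / (m + 1 : ℝ) ∧ ε < dist (Z p.1 ω) (Z p.2 ω)} := by
    have h3 : Continuous fun p : Set.Icc (0 : ℝ≥0) T × Set.Icc (0 : ℝ≥0) T =>
        dist (Z p.1 ω) (Z p.2 ω) := (hω.comp (continuous_subtype_val.comp continuous_fst)).dist
      (hω.comp (continuous_subtype_val.comp continuous_snd))
    exact (isOpen_lt (continuous_fst.dist continuous_snd) continuous_const).and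
      (isOpen_lt continuous_const h3)
  obtain ⟨⟨i, j⟩, hij⟩ := (DenseRange.prodMap hq hq).exists_mem_open hopen
    ⟨(⟨s, hs⟩, ⟨s', hs'⟩), lt_of_le_of_lt h1 (hK k hk), h2⟩
  exact Set.mem_iUnion.2 ⟨i, Set.mem_iUnion.2 ⟨j, Set.mem_iUnion.2 ⟨hij.1, hij.2⟩⟩⟩

end Oscillation

/-! ### The variance clock -/

section Clock

variable {n : ℕ} {θ : ℝ≥0 → EuclideanSpace ℝ (Fin n)}

/-- The accumulated variance `∫_0^s |θ|²`. -/
noncomputable def clock (θ : ℝ≥0 → EuclideanSpace ℝ (Fin n)) (s : ℝ≥0) : ℝ≥0 :=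
  Real.toNNReal (∫ r in (0 : ℝ)..s, ‖θ r.toNNReal‖ ^ 2)

lemma continuous_sq_norm (hθ : Continuous θ) : Continuous fun r : ℝ => ‖θ r.toNNReal‖ ^ 2 :=
  ((hθ.comp continuous_real_toNNReal).norm).pow 2

lemma coe_clock (θ : ℝ≥0 → EuclideanSpace ℝ (Fin n)) (s : ℝ≥0) :
    (clock θ s : ℝ) = ∫ r in (0 : ℝ)..s, ‖θ r.toNNReal‖ ^ 2 :=
  Real.coe_toNNReal _ (intervalIntegral.integral_nonneg s.2 fun _ _ => by positivity)

lemma coe_clock_sub_coe (hθ : Continuous θ) (a b : ℝ≥0) :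
    (clock θ b : ℝ) - clock θ a = ∫ r in (a : ℝ)..b, ‖θ r.toNNReal‖ ^ 2 := by
  rw [coe_clock, coe_clock]
  exact intervalIntegral.integral_interval_sub_left
    ((continuous_sq_norm hθ).intervalIntegrable _ _)
    ((continuous_sq_norm hθ).intervalIntegrable _ _)

lemma clock_mono (hθ : Continuous θ) : Monotone (clock θ) := by
  intro a b hab
  rw [← NNReal.coe_le_coe, ← sub_nonneg, coe_clock_sub_coe hθ]
  exact intervalIntegral.integral_nonneg (NNReal.coe_le_coe.2 hab) fun _ _ => by positivity

lemma coe_clock_sub (hθ : Continuous θ) {a b : ℝ≥0} (hab : a ≤ b) :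
    ((clock θ b - clock θ a : ℝ≥0) : ℝ) = ∫ r in (a : ℝ)..b, ‖θ r.toNNReal‖ ^ 2 := by
  rw [NNReal.coe_sub (clock_mono hθ hab), coe_clock_sub_coe hθ]

lemma continuous_clock (hθ : Continuous θ) : Continuous (clock θ) :=
  continuous_real_toNNReal.comp ((intervalIntegral.continuous_primitive
    (fun a b => (continuous_sq_norm hθ).intervalIntegrable a b) 0).comp NNReal.continuous_coe)

lemma coe_clock_sub_le (hθ : Continuous θ) {a b T : ℝ≥0} (hab : a ≤ b) (hb : b ≤ T) {R : ℝ}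
    (hR : ∀ r ∈ Set.Icc 0 T, ‖θ r‖ ≤ R) :
    ((clock θ b - clock θ a : ℝ≥0) : ℝ) ≤ R ^ 2 * (b - a) := by
  have hab' := NNReal.coe_le_coe.2 hab
  rw [coe_clock_sub hθ hab]
  have := intervalIntegral.norm_integral_le_of_norm_le_const (C := R ^ 2) (a := (a : ℝ)) (b := b)
    (f := fun r => ‖θ r.toNNReal‖ ^ 2) fun r hr => by
      rw [Set.uIoc_of_le hab'] at hr
      rw [norm_pow, norm_norm]
      refine pow_le_pow_left₀ (norm_nonneg _) (hR _ ⟨zero_le, ?_⟩) 2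
      exact (Real.toNNReal_le_iff_le_coe.2 hr.2).trans hb
  rw [abs_of_nonneg (sub_nonneg.2 hab')] at this
  exact (le_abs_self _).trans this

end Clock

/-! ### Itô's formula along the heat flow -/

section Ito

variable {Ω : Type*} {mΩ : MeasurableSpace Ω} {n : ℕ} {P : Measure Ω}
  {W : ℝ≥0 → Ω → EuclideanSpace ℝ (Fin n)}

/-- Freezing of past variables in an expectation over an independent future. -/
lemma IsStandardBrownian.integral_freeze [IsProbabilityMeasure P] [P.IsComplete]
    (hW : IsStandardBrownian W P)
    {a : ℝ≥0} {φ Z β : Ω → ℝ} {g : ℝ → ℝ} (hg : Continuous g) {C : ℝ} (hC : ∀ y, |g y| ≤ C)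
    (hφ : Measurable[brownianFiltration P W hW.measurable a] φ) (hφi : Integrable φ P)
    (hZ : Measurable[brownianFiltration P W hW.measurable a] Z)
    (hβ : Measurable[futureSigma P W a] β) :
    ∫ ω, φ ω * g (Z ω + β ω) ∂P = ∫ ω, φ ω * (∫ u, g (Z ω + u) ∂(P.map β)) ∂P := by
  have hle := (brownianFiltration P W hW.measurable).le a
  have hφ' : Measurable φ := hφ.mono hle le_rfl
  have hZ' : Measurable Z := hZ.mono hle le_rfl
  have hβ' : Measurable β := hβ.mono (futureSigma_le hW a) le_rfl
  have hind : IndepFun (fun ω => (φ ω, Z ω)) β P := hW.indepFun_past_future (hφ.prodMk hZ) hβ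
  have hprod := (indepFun_iff_map_prod_eq_prod_map_map (hφ'.prodMk hZ').aemeasurable
    hβ'.aemeasurable).1 hind
  have hprob : IsProbabilityMeasure (P.map β) := Measure.isProbabilityMeasure_map hβ'.aemeasurable
  have hprob2 : IsProbabilityMeasure (P.map fun ω => (φ ω, Z ω)) :=
    Measure.isProbabilityMeasure_map (hφ'.prodMk hZ').aemeasurable
  have hFm : Measurable fun p : (ℝ × ℝ) × ℝ => p.1.1 * g (p.1.2 + p.2) := by
    have := hg.measurable
    fun_prop
  have hint : Integrable (fun p : (ℝ × ℝ) × ℝ => p.1.1 * g (p.1.2 + p.2))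
      ((P.map fun ω => (φ ω, Z ω)).prod (P.map β)) := by
    rw [← hprod, integrable_map_measure hFm.aestronglyMeasurable
      ((hφ'.prodMk hZ').prodMk hβ').aemeasurable]
    exact hφi.mul_bdd (c := C) ((hg.measurable.comp (hZ'.add hβ')).aestronglyMeasurable)
      (ae_of_all _ fun ω => hC _)
  calc ∫ ω, φ ω * g (Z ω + β ω) ∂P
      = ∫ p, p.1.1 * g (p.1.2 + p.2) ∂(P.map fun ω => ((φ ω, Z ω), β ω)) := by
        rw [integral_map ((hφ'.prodMk hZ').prodMk hβ').aemeasurable hFm.aestronglyMeasurable]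
    _ = ∫ z, ∫ u, z.1 * g (z.2 + u) ∂(P.map β) ∂(P.map fun ω => (φ ω, Z ω)) := by
        rw [hprod, integral_prod _ hint]
    _ = _ := by
        simp_rw [integral_const_mul]
        rw [integral_map (hφ'.prodMk hZ').aemeasurable]
        refine Measurable.aestronglyMeasurable ?_
        refine measurable_fst.mul ?_
        have := (continuous_of_dominated (μ := P.map β) (F := fun (z : ℝ) u => g (z + u))
          (bound := fun _ => C)
          (fun z => (by fun_prop : Continuous fun u => g (z + u)).aestronglyMeasurable)
          (fun z => ae_of_all _ fun u => hC _) (integrable_const _)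
          (ae_of_all _ fun u => by fun_prop)).measurable
        exact this.comp measurable_snd

variable {hW : IsStandardBrownian W P} {θ : ℝ≥0 → EuclideanSpace ℝ (Fin n)} {T t : ℝ≥0}
  {B : ℝ≥0 → Ω → ℝ}

/-- The process `∫_t^s θ' dW + ∫_t^s |θ|² dr`. -/
noncomputable def driftedWiener (θ : ℝ≥0 → EuclideanSpace ℝ (Fin n)) (B : ℝ≥0 → Ω → ℝ)
    (t s : ℝ≥0) (ω : Ω) : ℝ := B s ω - B t ω + (clock θ s - clock θ t : ℝ)

/-- The value at time `s` of the payoff `G` of the drifted Wiener integral at time `T`, computed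
by the heat flow. -/
noncomputable def hedgeValue (θ : ℝ≥0 → EuclideanSpace ℝ (Fin n)) (B : ℝ≥0 → Ω → ℝ) (T t : ℝ≥0)
    (G : ℝ → ℝ) (s : ℝ≥0) (ω : Ω) : ℝ :=
  heat (clock θ T - clock θ s) G (driftedWiener θ B t s ω)

lemma IsWienerIntegral.map_increment (hB : IsWienerIntegral hW θ T B) (hθ : Continuous θ)
    {a b : ℝ≥0} (hab : a ≤ b) (hb : b ≤ T) [P.IsComplete] :
    P.map (fun ω => B b ω - B a ω) = gaussianReal 0 (clock θ b - clock θ a) := by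
  have h := hB.law 0 a b hab hb
  simp only [inner_zero_left, zero_sub, norm_neg] at h
  have h2 : P.map (fun ω => B b ω - B a ω) =
      (P.map (fun ω => -(B b ω - B a ω))).map (fun x => -x) := by
    have hm : Measurable (fun ω => B b ω - B a ω) :=
      (hB.future a b hab hb).mono (futureSigma_le hW a) le_rfl
    have hm' : Measurable (fun ω => -(B b ω - B a ω)) := hm.neg
    rw [Measure.map_map measurable_neg hm']
    congr 1
    ext ω
    simp
  rw [h2, h, gaussianReal_map_neg, neg_zero]
  congr 1
  rw [← coe_clock_sub hθ hab, Real.toNNReal_coe]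

lemma IsWienerIntegral.continuous_driftedWiener (hB : IsWienerIntegral hW θ T B)
    (hθ : Continuous θ) (t : ℝ≥0) (ω : Ω) : Continuous fun s => driftedWiener θ B t s ω := by
  have h1 := hB.continuous ω
  have h2 := continuous_clock hθ
  unfold driftedWiener
  fun_prop

lemma IsWienerIntegral.continuous_hedgeValue (hB : IsWienerIntegral hW θ T B)
    (hθ : Continuous θ) (t : ℝ≥0) {G : ℝ → ℝ} (hG : Continuous G) {C : ℝ} (hC : ∀ y, |G y| ≤ C)
    (ω : Ω) : Continuous fun s => hedgeValue θ B T t G s ω := by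
  have h2 := continuous_clock hθ
  exact (continuous_heat hG hC).comp
    ((continuous_const.sub h2).prodMk (hB.continuous_driftedWiener hθ t ω))

lemma IsWienerIntegral.measurable_driftedWiener (hB : IsWienerIntegral hW θ T B)
    {s : ℝ≥0} (hts : t ≤ s) :
    Measurable[brownianFiltration P W hW.measurable s] (driftedWiener θ B t s) :=
  ((hB.past s).sub ((hB.past t).mono
    ((brownianFiltration P W hW.measurable).mono hts) le_rfl)).add_const _

lemma IsWienerIntegral.measurable_hedgeValue (hB : IsWienerIntegral hW θ T B)
    {G : ℝ → ℝ} (hG : Continuous G) {C : ℝ} (hC : ∀ y, |G y| ≤ C) {s : ℝ≥0} (hts : t ≤ s) :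
    Measurable[brownianFiltration P W hW.measurable s] (hedgeValue θ B T t G s) :=
  ((continuous_heat hG hC).comp (Continuous.prodMk_right _)).measurable.comp
    (hB.measurable_driftedWiener hts)

lemma driftedWiener_succ {a b : ℝ≥0} (ω : Ω) :
    driftedWiener θ B t b ω = driftedWiener θ B t a ω + (clock θ b - clock θ a : ℝ) +
      (B b ω - B a ω) := by
  unfold driftedWiener
  ring

/-- The hedging error over one step, between times `a` and `b`. -/
noncomputable def hedgeError (W : ℝ≥0 → Ω → EuclideanSpace ℝ (Fin n))
    (θ : ℝ≥0 → EuclideanSpace ℝ (Fin n)) (B : ℝ≥0 → Ω → ℝ) (T t : ℝ≥0)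
    (G G' : ℝ → ℝ) (a b : ℝ≥0) (ω : Ω) : ℝ :=
  hedgeValue θ B T t G b ω -
    heat (clock θ T - clock θ a) G (driftedWiener θ B t a ω + (clock θ b - clock θ a : ℝ)) -
    ⟪hedgeValue θ B T t G' a ω • θ a, W b ω - W a ω⟫

variable {G G' : ℝ → ℝ} {C : ℝ}

/-- The hedging error is a martingale difference: conditionally on the past at time `a`, the heat
flow over `[a, b]` is exactly the expectation of the value at time `b`. -/
lemma IsWienerIntegral.integral_mul_hedgeError [IsProbabilityMeasure P] [P.IsComplete]
    (hB : IsWienerIntegral hW θ T B) (hθ : Continuous θ) (hG : SmoothPayoff G G' C)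
    {a b : ℝ≥0} (hta : t ≤ a) (hab : a ≤ b) (hb : b ≤ T) {φ : Ω → ℝ}
    (hφ : Measurable[brownianFiltration P W hW.measurable a] φ) (hφi : Integrable φ P) :
    ∫ ω, φ ω * hedgeError W θ B T t G G' a b ω ∂P = 0 := by
  have hle := (brownianFiltration P W hW.measurable).le
  have hmY := hB.measurable_driftedWiener (θ := θ) hta
  have h0 := hG.heat (clock θ T - clock θ b)
  have h1 := hG.heat (clock θ T - clock θ a)
  set Z : Ω → ℝ := fun ω => driftedWiener θ B t a ω + (clock θ b - clock θ a : ℝ) with hZ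
  have hmZ : Measurable[brownianFiltration P W hW.measurable a] Z := hmY.add_const _
  have hη := hB.measurable_hedgeValue (T := T) (θ := θ) hG.continuous' hG.bound' hta
  have hξ : Measurable[brownianFiltration P W hW.measurable a]
      (fun ω => hedgeValue θ B T t G' a ω • θ a) := hη.smul_const _
  have hξb : ∀ ω, ‖hedgeValue θ B T t G' a ω • θ a‖ ≤ C * ‖θ a‖ := fun ω => by
    rw [norm_smul]
    exact mul_le_mul_of_nonneg_right (abs_heat_le hG.bound' _ _) (norm_nonneg _)
  have e1 : ∀ ω, hedgeValue θ B T t G b ω =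
      heat (clock θ T - clock θ b) G (Z ω + (B b ω - B a ω)) := fun ω => by
    rw [hedgeValue, driftedWiener_succ (a := a)]
  -- integrating out the increment of `B` runs the heat flow for its variance
  have hfr := hW.integral_freeze h0.continuous h0.bound hφ hφi hmZ (hB.future a b hab hb)
  rw [hB.map_increment hθ hab hb] at hfr
  have e2 : ∀ z, ∫ u, heat (clock θ T - clock θ b) G (z + u)
      ∂gaussianReal 0 (clock θ b - clock θ a) = heat (clock θ T - clock θ a) G z := fun z => by
    have := heat_heat hG.continuous hG.bound (clock θ b - clock θ a) (clock θ T - clock θ b) z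
    rwa [tsub_add_tsub_cancel (clock_mono hθ hb) (clock_mono hθ hab)] at this
  simp_rw [e2] at hfr
  have hi1 : Integrable (fun ω => φ ω * hedgeValue θ B T t G b ω) P :=
    hφi.mul_bdd (c := C) ((hB.measurable_hedgeValue hG.continuous hG.bound
      (hta.trans hab)).mono (hle b) le_rfl).aestronglyMeasurable
      (ae_of_all _ fun ω => abs_heat_le hG.bound _ _)
  have hi2 : Integrable (fun ω => φ ω * heat (clock θ T - clock θ a) G (Z ω)) P :=
    hφi.mul_bdd (c := C) ((h1.continuous.measurable.comp
      hmZ).mono (hle a) le_rfl).aestronglyMeasurable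
      (ae_of_all _ fun ω => abs_heat_le hG.bound _ _)
  have hi3 : Integrable (fun ω => φ ω * ⟪hedgeValue θ B T t G' a ω • θ a, W b ω - W a ω⟫) P := by
    have h5 : ∀ ω, φ ω * ⟪hedgeValue θ B T t G' a ω • θ a, W b ω - W a ω⟫ =
        (φ ω * hedgeValue θ B T t G' a ω) * ⟪θ a, W b ω - W a ω⟫ := fun ω => by
      rw [real_inner_smul_left]
      ring
    simp_rw [h5]
    refine hW.integrable_past_mul_future (hφ.mul hη) ((by fun_prop : Measurable fun v =>
      ⟪θ a, v⟫).comp (measurable_future le_rfl hab)) ?_ ?_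
    · exact hφi.mul_bdd (c := C) (hη.mono (hle a) le_rfl).aestronglyMeasurable
        (ae_of_all _ fun ω => abs_heat_le hG.bound' _ _)
    · exact (hW.memLp_inner_increment (C := ‖θ a‖) measurable_const fun _ => le_rfl).integrable
        (by norm_num)
  have hi12 : Integrable (fun ω => φ ω * hedgeValue θ B T t G b ω -
    φ ω * heat (clock θ T - clock θ a) G (Z ω)) P := hi1.sub hi2
  have e3 : ∀ ω, φ ω * hedgeError W θ B T t G G' a b ω =
      (φ ω * hedgeValue θ B T t G b ω - φ ω * heat (clock θ T - clock θ a) G (Z ω)) -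
        φ ω * ⟪hedgeValue θ B T t G' a ω • θ a, W b ω - W a ω⟫ := fun ω => by
    simp only [hedgeError, hZ]
    ring
  simp_rw [e3]
  rw [integral_sub hi12 hi3, integral_sub hi1 hi2,
    hW.integral_mul_inner_increment hab hφ hφi hξ hξb]
  simp_rw [e1]
  rw [hfr, sub_self, sub_zero]

end Ito


section Ito

variable {Ω : Type*} {mΩ : MeasurableSpace Ω} {n : ℕ} {P : Measure Ω}
  {W : ℝ≥0 → Ω → EuclideanSpace ℝ (Fin n)}
  {hW : IsStandardBrownian W P} {θ : ℝ≥0 → EuclideanSpace ℝ (Fin n)} {T t : ℝ≥0}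
  {B : ℝ≥0 → Ω → ℝ} {G G' : ℝ → ℝ} {C : ℝ}

lemma integral_pow_four_gaussianReal (w : ℝ≥0) :
    ∫ u, u ^ 4 ∂gaussianReal 0 w = w ^ 2 * ∫ u, u ^ 4 ∂gaussianReal 0 1 := by
  rw [gaussianReal_zero_eq_map, integral_map (by fun_prop) (by fun_prop), ← integral_const_mul]
  congr 1
  ext u
  rw [mul_pow]
  congr 1
  rw [show (4 : ℕ) = 2 * 2 from rfl, pow_mul, Real.sq_sqrt (NNReal.coe_nonneg w)]

lemma integrable_pow_four_gaussianReal (w : ℝ≥0) :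
    Integrable (fun u : ℝ => u ^ 4) (gaussianReal 0 w) := by
  have h := (memLp_id_gaussianReal (μ := 0) (v := w) 4).integrable_norm_pow (by norm_num)
  refine h.congr (ae_of_all _ fun u => ?_)
  simp only [id, Real.norm_eq_abs]
  exact Even.pow_abs (by decide) u

lemma IsWienerIntegral.measurable_hedgeError (hB : IsWienerIntegral hW θ T B)
    (hG : SmoothPayoff G G' C) {a b : ℝ≥0} (hta : t ≤ a) (hab : a ≤ b) :
    Measurable[brownianFiltration P W hW.measurable b] (hedgeError W θ B T t G G' a b) := by
  have hm := (brownianFiltration P W hW.measurable).mono hab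
  have h1 := hB.measurable_hedgeValue (T := T) hG.continuous hG.bound (hta.trans hab)
  have h2 := (hB.measurable_driftedWiener (θ := θ) hta).add_const (clock θ b - clock θ a : ℝ)
  have h3 := (hG.heat (clock θ T - clock θ a)).continuous.measurable.comp h2
  have h4 : Measurable[brownianFiltration P W hW.measurable a]
      (fun ω => hedgeValue θ B T t G' a ω • θ a) :=
    (hB.measurable_hedgeValue hG.continuous' hG.bound' hta).smul_const _
  exact (h1.sub (h3.mono hm le_rfl)).sub ((h4.mono hm le_rfl).inner
    ((measurable_past hW.measurable le_rfl).sub (measurable_past hW.measurable hab)))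

/-- The hedging error is controlled by the one-step error of delta hedging with respect to `B`, and
by the discrepancy between the increment of `B` and its Euler approximation `⟨θ_a, W_b - W_a⟩`. -/
lemma abs_hedgeError_le (hθ : Continuous θ)
    (hG : SmoothPayoff G G' C) {a b : ℝ≥0} (hab : a ≤ b) (hb : b ≤ T)
    (hΔ : clock θ b - clock θ a ≤ 1) (ω : Ω) :
    |hedgeError W θ B T t G G' a b ω| ≤
      3 * C * ((B b ω - B a ω) ^ 2 + (clock θ b - clock θ a : ℝ≥0)) +
        C * |⟪θ a, W b ω - W a ω⟫ - (B b ω - B a ω)| := by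
  have h1 := hG.abs_hedge_error_le (clock θ T - clock θ b) (clock θ b - clock θ a) hΔ
    (driftedWiener θ B t a ω) (B b ω - B a ω)
  rw [tsub_add_tsub_cancel (clock_mono hθ hb) (clock_mono hθ hab)] at h1
  have h2 : |hedgeValue θ B T t G' a ω| ≤ C := abs_heat_le hG.bound' _ _
  have h3 := mul_le_mul_of_nonneg_right h2
    (abs_nonneg (⟪θ a, W b ω - W a ω⟫ - (B b ω - B a ω)))
  rw [← abs_mul] at h3
  have e : hedgeError W θ B T t G G' a b ω =
      (heat (clock θ T - clock θ b) G (driftedWiener θ B t a ω +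
        (clock θ b - clock θ a : ℝ≥0) + (B b ω - B a ω)) -
      heat (clock θ T - clock θ a) G (driftedWiener θ B t a ω + (clock θ b - clock θ a : ℝ≥0)) -
      heat (clock θ T - clock θ a) G' (driftedWiener θ B t a ω) * (B b ω - B a ω)) -
      hedgeValue θ B T t G' a ω * (⟪θ a, W b ω - W a ω⟫ - (B b ω - B a ω)) := by
    rw [hedgeError, real_inner_smul_left, hedgeValue, driftedWiener_succ (a := a), hedgeValue,
      NNReal.coe_sub (clock_mono hθ hab)]
    ring
  rw [e]
  exact (abs_sub _ _).trans (add_le_add h1 h3)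

lemma IsWienerIntegral.memLp_hedgeError [IsProbabilityMeasure P]
    (hB : IsWienerIntegral hW θ T B)
    (hG : SmoothPayoff G G' C) {a b : ℝ≥0} (hta : t ≤ a) (hab : a ≤ b) :
    MemLp (hedgeError W θ B T t G G' a b) 2 P := by
  have hle := (brownianFiltration P W hW.measurable).le
  have h1 := hB.measurable_hedgeValue (T := T) hG.continuous hG.bound (hta.trans hab)
  have h2 := (hB.measurable_driftedWiener (θ := θ) hta).add_const (clock θ b - clock θ a : ℝ)
  have h3 := (hG.heat (clock θ T - clock θ a)).continuous.measurable.comp h2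
  have h4 : Measurable[brownianFiltration P W hW.measurable a]
      (fun ω => hedgeValue θ B T t G' a ω • θ a) :=
    (hB.measurable_hedgeValue hG.continuous' hG.bound' hta).smul_const _
  refine ((MemLp.of_bound (h1.mono (hle _) le_rfl).aestronglyMeasurable C
    (ae_of_all _ fun ω => abs_heat_le hG.bound _ _)).sub
    (MemLp.of_bound (h3.mono (hle _) le_rfl).aestronglyMeasurable C
    (ae_of_all _ fun ω => abs_heat_le hG.bound _ _))).sub
    (hW.memLp_inner_increment (h4.mono (hle _) le_rfl) (C := C * ‖θ a‖) fun ω => ?_)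
  rw [norm_smul]
  exact mul_le_mul_of_nonneg_right (abs_heat_le hG.bound' _ _) (norm_nonneg _)

/-- The second moment of the hedging error over a step of length `h` is `O(h²) + O(ρ² h)`, where `ρ`
is the oscillation of `θ` over the step; summed over a partition it is `O(mesh) + O(ρ²)`. -/
lemma IsWienerIntegral.integral_sq_hedgeError_le [IsProbabilityMeasure P] [P.IsComplete]
    (hB : IsWienerIntegral hW θ T B) (hθ : Continuous θ)
    (hG : SmoothPayoff G G' C) {a b : ℝ≥0} (hta : t ≤ a) (hab : a ≤ b) (hb : b ≤ T)
    {R ρ : ℝ} (hR : ∀ r ∈ Set.Icc 0 T, ‖θ r‖ ≤ R) (hΔ : R ^ 2 * (b - a) ≤ 1)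
    (hρ : ∀ r ∈ Set.Icc a b, ‖θ a - θ r‖ ≤ ρ) :
    ∫ ω, hedgeError W θ B T t G G' a b ω ^ 2 ∂P ≤
      36 * C ^ 2 * ((∫ u, u ^ 4 ∂gaussianReal 0 1) + 1) * (R ^ 2 * (b - a)) ^ 2 +
        2 * C ^ 2 * (ρ ^ 2 * (b - a)) := by
  set Δ : ℝ≥0 := clock θ b - clock θ a with hΔdef
  have hΔR : (Δ : ℝ) ≤ R ^ 2 * (b - a) := coe_clock_sub_le hθ hab hb hR
  have hΔ1 : Δ ≤ 1 := by exact_mod_cast hΔR.trans hΔ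
  have hab' : (a : ℝ) ≤ b := NNReal.coe_le_coe.2 hab
  have hmβ : Measurable (fun ω => B b ω - B a ω) :=
    (hB.future a b hab hb).mono (futureSigma_le hW a) le_rfl
  have hmγ : Measurable (fun ω => ⟪θ a, W b ω - W a ω⟫ - (B b ω - B a ω)) :=
    ((by fun_prop : Measurable fun v => ⟪θ a, v⟫).comp
      ((hW.measurable b).sub (hW.measurable a))).sub hmβ
  have hβlaw := hB.map_increment hθ hab hb
  have hγlaw := hB.law (θ a) a b hab hb
  have hβ4 : ∫ ω, (B b ω - B a ω) ^ 4 ∂P = Δ ^ 2 * ∫ u, u ^ 4 ∂gaussianReal 0 1 := by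
    rw [← integral_pow_four_gaussianReal, ← hβlaw, integral_map hmβ.aemeasurable (by fun_prop)]
  have hβ4i : Integrable (fun ω => (B b ω - B a ω) ^ 4) P := by
    have := integrable_pow_four_gaussianReal Δ
    rw [← hβlaw] at this
    exact (integrable_map_measure (by fun_prop) hmβ.aemeasurable).1 this
  have hγ2i : Integrable (fun ω => (⟪θ a, W b ω - W a ω⟫ - (B b ω - B a ω)) ^ 2) P := by
    have := integrable_sq_gaussianReal (∫ r in (a : ℝ)..b, ‖θ a - θ r.toNNReal‖ ^ 2).toNNReal
    rw [← hγlaw] at this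
    exact (integrable_map_measure (by fun_prop) hmγ.aemeasurable).1 this
  -- Itô isometry for `∫ (θ_a - θ_r)' dW_r`
  have hγ2 : ∫ ω, (⟪θ a, W b ω - W a ω⟫ - (B b ω - B a ω)) ^ 2 ∂P ≤ ρ ^ 2 * (b - a) := by
    have := integral_sq_gaussianReal (∫ r in (a : ℝ)..b, ‖θ a - θ r.toNNReal‖ ^ 2).toNNReal
    rw [← hγlaw, integral_map hmγ.aemeasurable (by fun_prop)] at this
    rw [this, Real.coe_toNNReal _ (intervalIntegral.integral_nonneg hab' fun _ _ => by positivity)]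
    have h2 := intervalIntegral.norm_integral_le_of_norm_le_const (C := ρ ^ 2) (a := (a : ℝ))
      (b := b) (f := fun r => ‖θ a - θ r.toNNReal‖ ^ 2) fun r hr => by
        rw [Set.uIoc_of_le hab'] at hr
        rw [norm_pow, norm_norm]
        refine pow_le_pow_left₀ (norm_nonneg _) (hρ _ ⟨?_, ?_⟩) 2
        · exact NNReal.le_toNNReal_of_coe_le hr.1.le
        · exact Real.toNNReal_le_iff_le_coe.2 hr.2
    rw [abs_of_nonneg (sub_nonneg.2 hab')] at h2
    exact (le_abs_self _).trans h2
  have hM4 : 0 ≤ ∫ u, u ^ 4 ∂gaussianReal 0 1 := integral_nonneg fun u => by positivity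
  calc ∫ ω, hedgeError W θ B T t G G' a b ω ^ 2 ∂P
      ≤ ∫ ω, (36 * C ^ 2 * ((B b ω - B a ω) ^ 4 + (Δ : ℝ) ^ 2) +
        2 * C ^ 2 * (⟪θ a, W b ω - W a ω⟫ - (B b ω - B a ω)) ^ 2) ∂P := by
        refine integral_mono (hB.memLp_hedgeError hG hta hab).integrable_sq
          (((hβ4i.add (integrable_const _)).const_mul _).add (hγ2i.const_mul _)) fun ω => ?_
        have h1 := abs_hedgeError_le (W := W) (B := B) (t := t) hθ hG hab hb hΔ1 ω
        set x := (B b ω - B a ω)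
        set y := (⟪θ a, W b ω - W a ω⟫ - x)
        have h2 := pow_le_pow_left₀ (abs_nonneg _) h1 2
        rw [sq_abs] at h2
        refine h2.trans ?_
        have h3 := sq_abs y
        have h4 := sq_nonneg (3 * C * (x ^ 2 + Δ) - C * |y|)
        have h5 := mul_nonneg (sq_nonneg C) (sq_nonneg (x ^ 2 - (Δ : ℝ)))
        have e1 : (3 * C * (x ^ 2 + Δ) + C * |y|) ^ 2 = 2 * (3 * C * (x ^ 2 + Δ)) ^ 2 +
          2 * (C ^ 2 * |y| ^ 2) - (3 * C * (x ^ 2 + Δ) - C * |y|) ^ 2 := by ring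
        rw [e1, h3]
        have e2 : 2 * (3 * C * (x ^ 2 + Δ)) ^ 2 = 36 * C ^ 2 * (x ^ 4 + (Δ : ℝ) ^ 2) -
          18 * (C ^ 2 * (x ^ 2 - (Δ : ℝ)) ^ 2) := by ring
        rw [e2]
        linarith
    _ = 36 * C ^ 2 * ((∫ u, u ^ 4 ∂gaussianReal 0 1) + 1) * (Δ : ℝ) ^ 2 +
        2 * C ^ 2 * ∫ ω, (⟪θ a, W b ω - W a ω⟫ - (B b ω - B a ω)) ^ 2 ∂P := by
        have hi : Integrable (fun ω => (B b ω - B a ω) ^ 4 + (Δ : ℝ) ^ 2) P :=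
          hβ4i.add (integrable_const _)
        rw [integral_add (hi.const_mul _) (hγ2i.const_mul _), integral_const_mul,
          integral_const_mul, integral_add hβ4i (integrable_const _), hβ4]
        simp
        ring
    _ ≤ _ := by
        have : (Δ : ℝ) ^ 2 ≤ (R ^ 2 * (b - a)) ^ 2 := pow_le_pow_left₀ Δ.2 hΔR 2
        gcongr

/-- One step of Itô's formula, up to the martingale difference `hedgeError`. -/
lemma IsWienerIntegral.abs_ito_step_le (hB : IsWienerIntegral hW θ T B) (hθ : Continuous θ)
    (hG : SmoothPayoff G G' C) {a b : ℝ≥0} (hab : a ≤ b) (hb : b ≤ T)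
    {R ε : ℝ} (hR : ∀ r ∈ Set.Icc 0 T, ‖θ r‖ ≤ R) (ω : Ω)
    (hε : ∀ r ∈ Set.Icc a b,
      |hedgeValue θ B T t G' a ω - hedgeValue θ B T t G' r ω| ≤ ε) :
    |hedgeValue θ B T t G b ω - hedgeValue θ B T t G a ω -
      ⟪hedgeValue θ B T t G' a ω • θ a, W b ω - W a ω⟫ -
      (∫ r in (a : ℝ)..b, hedgeValue θ B T t G' r.toNNReal ω * ‖θ r.toNNReal‖ ^ 2) -
      hedgeError W θ B T t G G' a b ω| ≤ C * (R ^ 2 * (b - a)) ^ 2 + ε * R ^ 2 * (b - a) := by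
  have hab' : (a : ℝ) ≤ b := NNReal.coe_le_coe.2 hab
  have hC := hG.nonneg
  set Δ : ℝ≥0 := clock θ b - clock θ a with hΔdef
  have hΔR : (Δ : ℝ) ≤ R ^ 2 * (b - a) := coe_clock_sub_le hθ hab hb hR
  have h1 := (hG.heat (clock θ T - clock θ a)).taylor (driftedWiener θ B t a ω) Δ
  have h1' : C * (Δ : ℝ) ^ 2 ≤ C * (R ^ 2 * (b - a)) ^ 2 :=
    mul_le_mul_of_nonneg_left (pow_le_pow_left₀ Δ.2 hΔR 2) hC
  have hηc : Continuous fun r : ℝ => hedgeValue θ B T t G' r.toNNReal ω :=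
    (hB.continuous_hedgeValue hθ t hG.continuous' hG.bound' ω).comp continuous_real_toNNReal
  have hsq := continuous_sq_norm hθ
  -- the error of freezing the integrand at the left end of the step
  have h2 : hedgeValue θ B T t G' a ω * Δ -
      ∫ r in (a : ℝ)..b, hedgeValue θ B T t G' r.toNNReal ω * ‖θ r.toNNReal‖ ^ 2 =
      ∫ r in (a : ℝ)..b, (hedgeValue θ B T t G' a ω - hedgeValue θ B T t G' r.toNNReal ω) *
        ‖θ r.toNNReal‖ ^ 2 := by
    have hi : Continuous fun r : ℝ => hedgeValue θ B T t G' r.toNNReal ω * ‖θ r.toNNReal‖ ^ 2 :=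
      hηc.mul hsq
    simp_rw [sub_mul]
    rw [intervalIntegral.integral_sub ((hsq.const_mul _).intervalIntegrable _ _)
      (hi.intervalIntegrable _ _), intervalIntegral.integral_const_mul,
      ← coe_clock_sub hθ hab]
  have h3 : |hedgeValue θ B T t G' a ω * Δ -
      ∫ r in (a : ℝ)..b, hedgeValue θ B T t G' r.toNNReal ω * ‖θ r.toNNReal‖ ^ 2| ≤
      ε * R ^ 2 * (b - a) := by
    rw [h2]
    have := intervalIntegral.norm_integral_le_of_norm_le_const (C := ε * R ^ 2) (a := (a : ℝ))
      (b := b) (f := fun r => (hedgeValue θ B T t G' a ω - hedgeValue θ B T t G' r.toNNReal ω) *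
        ‖θ r.toNNReal‖ ^ 2) fun r hr => by
        rw [Set.uIoc_of_le hab'] at hr
        rw [norm_mul, norm_pow, norm_norm]
        have hr1 : a ≤ r.toNNReal := NNReal.le_toNNReal_of_coe_le hr.1.le
        have hr2 : r.toNNReal ≤ b := Real.toNNReal_le_iff_le_coe.2 hr.2
        exact mul_le_mul (hε _ ⟨hr1, hr2⟩) (pow_le_pow_left₀ (norm_nonneg _)
          (hR _ ⟨zero_le, hr2.trans hb⟩) 2) (by positivity)
          ((abs_nonneg _).trans (hε _ ⟨hr1, hr2⟩))
    rwa [abs_of_nonneg (sub_nonneg.2 hab')] at this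
  have e : hedgeValue θ B T t G b ω - hedgeValue θ B T t G a ω -
      ⟪hedgeValue θ B T t G' a ω • θ a, W b ω - W a ω⟫ -
      (∫ r in (a : ℝ)..b, hedgeValue θ B T t G' r.toNNReal ω * ‖θ r.toNNReal‖ ^ 2) -
      hedgeError W θ B T t G G' a b ω =
      (heat (clock θ T - clock θ a) G (driftedWiener θ B t a ω + Δ) -
        heat (clock θ T - clock θ a) G (driftedWiener θ B t a ω) -
        heat (clock θ T - clock θ a) G' (driftedWiener θ B t a ω) * Δ) +
      (hedgeValue θ B T t G' a ω * Δ -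
        ∫ r in (a : ℝ)..b, hedgeValue θ B T t G' r.toNNReal ω * ‖θ r.toNNReal‖ ^ 2) := by
    rw [hedgeError, hedgeValue, hedgeValue, hedgeValue, hΔdef,
      NNReal.coe_sub (clock_mono hθ hab)]
    ring
  rw [e]
  exact (abs_add_le _ _).trans (add_le_add (h1.trans h1') h3)

end Ito


section Ito

variable {Ω : Type*} {mΩ : MeasurableSpace Ω} {n : ℕ} {P : Measure Ω}
  {W : ℝ≥0 → Ω → EuclideanSpace ℝ (Fin n)}
  {hW : IsStandardBrownian W P} {θ : ℝ≥0 → EuclideanSpace ℝ (Fin n)} {T t : ℝ≥0}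
  {B : ℝ≥0 → Ω → ℝ} {G G' : ℝ → ℝ} {C : ℝ}

lemma gridTime_le {t T : ℝ≥0} (h : t ≤ T) {N : ℕ} (hN : 0 < N) {i : ℕ} (hi : i ≤ N) :
    gridTime t T N i ≤ T := by
  conv_rhs => rw [← gridTime_last h hN]
  exact gridTime_mono t T N hi

lemma le_gridTime (t T : ℝ≥0) (N i : ℕ) : t ≤ gridTime t T N i := le_self_add

/-- The delta hedging strategy rebalanced at the points of the uniform partition. -/
noncomputable def hedgeSimple (hB : IsWienerIntegral hW θ T B) (t : ℝ≥0)
    (hG : SmoothPayoff G G' C) (N : ℕ) :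
    SimpleProcess (brownianFiltration P W hW.measurable) n where
  N := N
  τ i := gridTime t T N (min i N)
  mono i j hij := gridTime_mono t T N (min_le_min_right _ hij)
  ξ i ω := hedgeValue θ B T t G' (gridTime t T N (min i N)) ω • θ (gridTime t T N (min i N))
  measurable i := (hB.measurable_hedgeValue hG.continuous' hG.bound'
    (le_gridTime t T N _)).smul_const _
  bounded := by
    refine ⟨∑ i ∈ Finset.range (N + 1), C * ‖θ (gridTime t T N i)‖, fun i ω => ?_⟩
    refine le_trans ?_ (Finset.single_le_sum (f := fun i => C * ‖θ (gridTime t T N i)‖)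
      (fun _ _ => mul_nonneg hG.nonneg (norm_nonneg _))
      (Finset.mem_range.2 (by omega : min i N < N + 1)))
    rw [norm_smul]
    exact mul_le_mul_of_nonneg_right (abs_heat_le hG.bound' _ _) (norm_nonneg _)

lemma hedgeSimple_val (hB : IsWienerIntegral hW θ T B) (hG : SmoothPayoff G G' C) {N i : ℕ}
    (hi : i < N) {s : ℝ≥0} (hs : s ∈ Set.Ioc (gridTime t T N i) (gridTime t T N (i + 1))) (ω : Ω) :
    (hedgeSimple hB t hG N).val s ω =
      hedgeValue θ B T t G' (gridTime t T N i) ω • θ (gridTime t T N i) := by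
  rw [SimpleProcess.val_of_mem (hedgeSimple hB t hG N) (i := i) hi (by
    simpa only [hedgeSimple, min_eq_left hi.le, min_eq_left (Nat.succ_le_of_lt hi)])]
  simp only [hedgeSimple, min_eq_left hi.le]

lemma hedgeSimple_jumpFree (hB : IsWienerIntegral hW θ T B) (hG : SmoothPayoff G G' C) {N i : ℕ}
    {s : ℝ≥0} (hs : s ≤ gridTime t T N (i + 1)) :
    (hedgeSimple hB t hG N).JumpFree (gridTime t T N i) s := by
  intro l hl
  have hl' : l ≤ N := hl
  simp only [hedgeSimple, min_eq_left hl']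
  rcases le_or_gt l i with h | h
  · exact Or.inl (gridTime_mono t T N h)
  · exact Or.inr (hs.trans (gridTime_mono t T N h))

lemma gridTime_lt_succ {t T : ℝ≥0} (h : t < T) {N : ℕ} (hN : 0 < N) (i : ℕ) :
    gridTime t T N i < gridTime t T N (i + 1) := by
  rw [gridTime_succ]
  have h1 : 0 < T - t := tsub_pos_of_lt h
  have h2 : (0 : ℝ≥0) < N := by exact_mod_cast hN
  exact lt_add_of_pos_right _ (by positivity)

lemma coe_gridTime_succ_sub {t T : ℝ≥0} (h : t ≤ T) (N i : ℕ) :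
    (gridTime t T N (i + 1) : ℝ) - gridTime t T N i = (T - t) / N := by
  rw [gridTime_succ]
  push_cast [NNReal.coe_sub h]
  ring

lemma hedgeSimple_integral_grid (hB : IsWienerIntegral hW θ T B) (hG : SmoothPayoff G G' C)
    (htT : t < T) {N j : ℕ} (hj : j ≤ N) (ω : Ω) :
    (hedgeSimple hB t hG N).integral W t (gridTime t T N j) ω = ∑ i ∈ Finset.range j,
      ⟪hedgeValue θ B T t G' (gridTime t T N i) ω • θ (gridTime t T N i),
        W (gridTime t T N (i + 1)) ω - W (gridTime t T N i) ω⟫ := by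
  have h := (hedgeSimple hB t hG N).integral_partition (W := W) (gridTime_mono t T N)
    (fun i => hedgeSimple_jumpFree hB hG le_rfl) j ω
  rw [gridTime_zero] at h
  rw [h]
  refine Finset.sum_congr rfl fun i hi => ?_
  have hi' := Finset.mem_range.1 hi
  rw [hedgeSimple_val hB hG (hi'.trans_le hj) ⟨gridTime_lt_succ htT (by omega) i, le_rfl⟩]

/-- On paths with small oscillation and small accumulated hedging error, the discrete hedge tracks
the heat flow. -/
lemma IsWienerIntegral.abs_hedgeSimple_integral_sub_le (hB : IsWienerIntegral hW θ T B)
    (hθ : Continuous θ) (hG : SmoothPayoff G G' C) (htT : t < T) {N : ℕ} (hN : 0 < N)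
    {R ε : ℝ} (hR : ∀ r ∈ Set.Icc 0 T, ‖θ r‖ ≤ R) (hε0 : 0 ≤ ε) (ω : Ω)
    (hWosc : ∀ s ∈ Set.Icc 0 T, ∀ s' ∈ Set.Icc 0 T, dist s s' ≤ (T - t : ℝ) / N →
      ‖W s ω - W s' ω‖ ≤ ε)
    (hXosc : ∀ s ∈ Set.Icc 0 T, ∀ s' ∈ Set.Icc 0 T, dist s s' ≤ (T - t : ℝ) / N →
      |hedgeValue θ B T t G s ω - hedgeValue θ B T t G s' ω| ≤ ε)
    (hηosc : ∀ s ∈ Set.Icc 0 T, ∀ s' ∈ Set.Icc 0 T, dist s s' ≤ (T - t : ℝ) / N →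
      |hedgeValue θ B T t G' s ω - hedgeValue θ B T t G' s' ω| ≤ ε)
    (hD : ∀ j ≤ N, |∑ i ∈ Finset.range j, hedgeError W θ B T t G G' (gridTime t T N i)
      (gridTime t T N (i + 1)) ω| ≤ ε) :
    ∀ s ∈ Set.Icc t T, |(hedgeSimple hB t hG N).integral W t s ω -
      (hedgeValue θ B T t G s ω - hedgeValue θ B T t G t ω -
        ∫ r in (t : ℝ)..s, hedgeValue θ B T t G' r.toNNReal ω * ‖θ r.toNNReal‖ ^ 2)| ≤
      ε * (2 + R ^ 2 * T + C * R) + (T - t) / N * (C * R ^ 4 * T + C * R ^ 2) := by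
  have hC := hG.nonneg
  have hR0 : 0 ≤ R := (norm_nonneg _).trans (hR 0 ⟨le_rfl, zero_le⟩)
  have htT' : (t : ℝ) < T := NNReal.coe_lt_coe.2 htT
  have hNr : (0 : ℝ) < N := by exact_mod_cast hN
  have ht0 : (0 : ℝ) ≤ t := t.2
  set h : ℝ := (T - t) / N with hh
  have hh0 : 0 < h := div_pos (by linarith) hNr
  have hNh : N * h = T - t := by
    rw [hh]
    field_simp
  set s : ℕ → ℝ≥0 := gridTime t T N with hs
  set g : ℝ → ℝ := fun r => hedgeValue θ B T t G' r.toNNReal ω * ‖θ r.toNNReal‖ ^ 2 with hg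
  have hgc : Continuous g := ((hB.continuous_hedgeValue hθ t hG.continuous' hG.bound' ω).comp
    continuous_real_toNNReal).mul (continuous_sq_norm hθ)
  have hgi : ∀ a b, IntervalIntegrable g volume a b := fun a b => hgc.intervalIntegrable a b
  have hsT : ∀ i ≤ N, s i ≤ T := fun i hi => gridTime_le htT.le hN hi
  have hstep : ∀ i < N, |hedgeValue θ B T t G (s (i + 1)) ω - hedgeValue θ B T t G (s i) ω -
      ⟪hedgeValue θ B T t G' (s i) ω • θ (s i), W (s (i + 1)) ω - W (s i) ω⟫ -
      (∫ r in (s i : ℝ)..s (i + 1), g r) - hedgeError W θ B T t G G' (s i) (s (i + 1)) ω| ≤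
      C * (R ^ 2 * h) ^ 2 + ε * R ^ 2 * h := by
    intro i hi
    have := hB.abs_ito_step_le hθ hG (gridTime_mono t T N i.le_succ) (hsT (i + 1) hi) hR ω
      (ε := ε) (t := t) fun r hr => hηosc _ ⟨zero_le, hsT i hi.le⟩ r
        ⟨zero_le, hr.2.trans (hsT (i + 1) hi)⟩ (by
          have h1 : (gridTime t T N i : ℝ) ≤ r := hr.1
          have h2 : (r : ℝ) ≤ gridTime t T N (i + 1) := hr.2
          have h3 := coe_gridTime_succ_sub htT.le N i
          rw [NNReal.dist_eq, abs_sub_comm, abs_of_nonneg (by linarith)]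
          linarith)
    rwa [Nat.succ_eq_add_one, coe_gridTime_succ_sub htT.le N i] at this
  -- the estimate at grid points, by summing the steps
  have hgrid : ∀ j ≤ N, |hedgeValue θ B T t G (s j) ω - hedgeValue θ B T t G t ω -
      (∫ r in (t : ℝ)..s j, g r) - (hedgeSimple hB t hG N).integral W t (s j) ω| ≤
      ε + (T - t) * (C * R ^ 4 * h + ε * R ^ 2) := by
    intro j hj
    have e1 : hedgeValue θ B T t G (s j) ω - hedgeValue θ B T t G t ω =
        ∑ i ∈ Finset.range j, (hedgeValue θ B T t G (s (i + 1)) ω -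
          hedgeValue θ B T t G (s i) ω) := by
      rw [Finset.sum_range_sub (fun i => hedgeValue θ B T t G (s i) ω)]
      simp only [hs, gridTime_zero]
    have e2 : ∫ r in (t : ℝ)..s j, g r =
        ∑ i ∈ Finset.range j, ∫ r in (s i : ℝ)..s (i + 1), g r := by
      rw [intervalIntegral.sum_integral_adjacent_intervals (a := fun i => (s i : ℝ))
        fun k _ => hgi _ _]
      simp only [hs, gridTime_zero]
    rw [hedgeSimple_integral_grid hB hG htT hj, e1, e2]
    have e3 : ∑ i ∈ Finset.range j, (hedgeValue θ B T t G (s (i + 1)) ω -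
          hedgeValue θ B T t G (s i) ω) -
        (∑ i ∈ Finset.range j, ∫ r in (s i : ℝ)..s (i + 1), g r) -
        ∑ i ∈ Finset.range j, ⟪hedgeValue θ B T t G' (s i) ω • θ (s i),
          W (s (i + 1)) ω - W (s i) ω⟫ =
        ∑ i ∈ Finset.range j, (hedgeValue θ B T t G (s (i + 1)) ω - hedgeValue θ B T t G (s i) ω -
          ⟪hedgeValue θ B T t G' (s i) ω • θ (s i), W (s (i + 1)) ω - W (s i) ω⟫ -
          (∫ r in (s i : ℝ)..s (i + 1), g r) - hedgeError W θ B T t G G' (s i) (s (i + 1)) ω) +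
        ∑ i ∈ Finset.range j, hedgeError W θ B T t G G' (s i) (s (i + 1)) ω := by
      simp only [← Finset.sum_sub_distrib, ← Finset.sum_add_distrib]
      exact Finset.sum_congr rfl fun i _ => by ring
    rw [e3]
    refine (abs_add_le _ _).trans ?_
    rw [add_comm]
    refine add_le_add (hD j hj) ((Finset.abs_sum_le_sum_abs _ _).trans
      ((Finset.sum_le_sum fun i hi => hstep i ((Finset.mem_range.1 hi).trans_le hj)).trans ?_))
    rw [Finset.sum_const, Finset.card_range, nsmul_eq_mul]
    have hjN : (j : ℝ) ≤ N := by exact_mod_cast hj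
    calc (j : ℝ) * (C * (R ^ 2 * h) ^ 2 + ε * R ^ 2 * h)
        ≤ N * (C * (R ^ 2 * h) ^ 2 + ε * R ^ 2 * h) :=
          mul_le_mul_of_nonneg_right hjN (by positivity)
      _ = (N * h) * (C * R ^ 4 * h + ε * R ^ 2) := by ring
      _ = _ := by rw [hNh]
  have hfin : ε + (T - t) * (C * R ^ 4 * h + ε * R ^ 2) ≤
      ε + ε * (R ^ 2 * T) + h * (C * R ^ 4 * T) := by
    have : 0 ≤ t * (C * R ^ 4 * h + ε * R ^ 2) := by positivity
    linarith
  intro u hu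
  rcases hu.1.eq_or_lt with rfl | htu
  · rw [SimpleProcess.integral_self]
    simp only [intervalIntegral.integral_same, sub_self, abs_zero]
    positivity
  -- inside a cell all the terms move by no more than the oscillations over the cell
  obtain ⟨j, hj, huj⟩ := exists_mem_Ioc_of_monotone (τ := gridTime t T N) (N := N) (s := u)
    (by rw [gridTime_zero, gridTime_last htT.le hN]; exact ⟨htu, hu.2⟩)
  have hju : s j ≤ u := huj.1.le
  have h1 : (s j : ℝ) ≤ u := hju
  have h2 : (u : ℝ) ≤ s (j + 1) := huj.2
  have h3 : (s (j + 1) : ℝ) - s j = h := coe_gridTime_succ_sub htT.le N j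
  have hdist : dist u (s j) ≤ h := by
    rw [NNReal.dist_eq, abs_of_nonneg (by linarith)]
    linarith
  have hInt := (hedgeSimple hB t hG N).integral_sub (W := W) t hju
    (hedgeSimple_jumpFree hB hG huj.2) ω
  rw [hedgeSimple_val hB hG hj huj] at hInt
  have hWj : |⟪hedgeValue θ B T t G' (s j) ω • θ (s j), W u ω - W (s j) ω⟫| ≤ C * R * ε := by
    refine (abs_real_inner_le_norm _ _).trans (mul_le_mul ?_
      (hWosc u ⟨zero_le, hu.2⟩ (s j) ⟨zero_le, hsT j hj.le⟩ hdist) (norm_nonneg _) (by positivity))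
    rw [norm_smul]
    exact mul_le_mul (abs_heat_le hG.bound' _ _) (hR _ ⟨zero_le, hsT j hj.le⟩) (norm_nonneg _) hC
  have hXj := hXosc u ⟨zero_le, hu.2⟩ (s j) ⟨zero_le, hsT j hj.le⟩ hdist
  have hgint : |∫ r in (s j : ℝ)..u, g r| ≤ C * R ^ 2 * h := by
    have := intervalIntegral.norm_integral_le_of_norm_le_const (C := C * R ^ 2) (a := (s j : ℝ))
      (b := u) (f := g) fun r hr => by
        rw [Set.uIoc_of_le h1] at hr
        simp only [hg]
        rw [norm_mul, norm_pow, norm_norm]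
        exact mul_le_mul (abs_heat_le hG.bound' _ _) (pow_le_pow_left₀ (norm_nonneg _)
          (hR _ ⟨zero_le, (Real.toNNReal_le_iff_le_coe.2 hr.2).trans hu.2⟩) 2) (by positivity) hC
    rw [abs_of_nonneg (by linarith), Real.norm_eq_abs] at this
    exact this.trans (mul_le_mul_of_nonneg_left (by linarith) (by positivity))
  have hadd : ∫ r in (t : ℝ)..u, g r = (∫ r in (t : ℝ)..s j, g r) + ∫ r in (s j : ℝ)..u, g r :=
    (intervalIntegral.integral_add_adjacent_intervals (hgi _ _) (hgi _ _)).symm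
  have hG1 := abs_le.1 ((hgrid j hj.le).trans hfin)
  rw [hadd]
  have hInt' : (hedgeSimple hB t hG N).integral W t u ω =
      (hedgeSimple hB t hG N).integral W t (s j) ω +
        ⟪hedgeValue θ B T t G' (s j) ω • θ (s j), W u ω - W (s j) ω⟫ := by linarith [hInt]
  rw [hInt']
  have a1 := abs_le.1 hWj
  have a2 := abs_le.1 hXj
  have a3 := abs_le.1 hgint
  rw [abs_le]
  constructor <;> linarith [hG1.1, hG1.2, a1.1, a1.2, a2.1, a2.2, a3.1, a3.2]

end Ito


section ItoLimit

variable {Ω : Type*} {mΩ : MeasurableSpace Ω} {n : ℕ} {P : Measure Ω}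
  {W : ℝ≥0 → Ω → EuclideanSpace ℝ (Fin n)}
  {hW : IsStandardBrownian W P} {θ : ℝ≥0 → EuclideanSpace ℝ (Fin n)} {T t : ℝ≥0}
  {B : ℝ≥0 → Ω → ℝ} {G G' : ℝ → ℝ} {C : ℝ}

lemma exists_norm_le_of_continuous (hθ : Continuous θ) (T : ℝ≥0) :
    ∃ R : ℝ, ∀ r ∈ Set.Icc 0 T, ‖θ r‖ ≤ R :=
  (isCompact_Icc (a := (0 : ℝ≥0)) (b := T)).exists_bound_of_continuousOn hθ.continuousOn

lemma tendsto_mesh (t T : ℝ≥0) : Tendsto (fun k : ℕ => ((T : ℝ) - t) / (k + 1 : ℕ)) atTop (𝓝 0) :=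
  (tendsto_const_nhds (x := (T : ℝ) - t)).div_atTop
    (tendsto_natCast_atTop_atTop.comp (tendsto_add_atTop_nat 1))

/-- The accumulated hedging error vanishes in probability as the mesh tends to zero. -/
lemma IsWienerIntegral.tendsto_measure_hedgeError [IsProbabilityMeasure P] [P.IsComplete]
    (hB : IsWienerIntegral hW θ T B) (hθ : Continuous θ) (hG : SmoothPayoff G G' C)
    (htT : t < T) {ε : ℝ} (hε : 0 < ε) :
    Tendsto (fun k : ℕ => P {ω | ∃ j ≤ k + 1, ε ≤ |∑ i ∈ Finset.range j,
      hedgeError W θ B T t G G' (gridTime t T (k + 1) i) (gridTime t T (k + 1) (i + 1)) ω|})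
      atTop (𝓝 0) := by
  obtain ⟨R, hR⟩ := exists_norm_le_of_continuous hθ T
  have htT' : (0 : ℝ) < T - t := sub_pos.2 (NNReal.coe_lt_coe.2 htT)
  set C₁ : ℝ := 36 * C ^ 2 * ((∫ u, u ^ 4 ∂gaussianReal 0 1) + 1) with hC₁
  set h : ℕ → ℝ := fun k => ((T : ℝ) - t) / (k + 1 : ℕ) with hh
  have hh0 : Tendsto h atTop (𝓝 0) := tendsto_mesh t T
  have key : ∀ ρ : ℝ, 0 < ρ → ∀ᶠ k : ℕ in atTop, P {ω | ∃ j ≤ k + 1, ε ≤ |∑ i ∈ Finset.range j,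
      hedgeError W θ B T t G G' (gridTime t T (k + 1) i) (gridTime t T (k + 1) (i + 1)) ω|} ≤
      ENNReal.ofReal ((C₁ * R ^ 4 * (T - t) * h k + 2 * C ^ 2 * ρ ^ 2 * (T - t)) / ε ^ 2) := by
    intro ρ hρ
    have huc := (isCompact_Icc (a := (0 : ℝ≥0)) (b := T)).uniformContinuousOn_of_continuous
      hθ.continuousOn
    obtain ⟨δ, hδ, hu⟩ := Metric.uniformContinuousOn_iff.1 huc ρ hρ
    have hR0 : Tendsto (fun k => R ^ 2 * h k) atTop (𝓝 0) := by simpa using hh0.const_mul (R ^ 2)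
    filter_upwards [hh0.eventually_lt_const hδ, hR0.eventually_le_const one_pos] with k hk1 hk2
    -- the grid, frozen after `T` so that every step is a martingale difference
    set s : ℕ → ℝ≥0 := fun i => gridTime t T (k + 1) (min i (k + 1)) with hs
    have hsm : Monotone s := fun i j hij => gridTime_mono t T (k + 1) (min_le_min_right _ hij)
    have hsT : ∀ i, s i ≤ T := fun i => gridTime_le htT.le k.succ_pos (min_le_right _ _)
    have hts : ∀ i, t ≤ s i := fun i => le_gridTime t T _ _
    have heq : ∀ i < k + 1, s i = gridTime t T (k + 1) i ∧
        s (i + 1) = gridTime t T (k + 1) (i + 1) :=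
      fun i hi => ⟨by simp only [hs, min_eq_left hi.le],
        by simp only [hs, min_eq_left (Nat.succ_le_of_lt hi)]⟩
    have hkol := measure_exists_abs_sum_ge_le (P := P)
      (sampleFiltration (brownianFiltration P W hW.measurable) s hsm)
      (D := fun i => hedgeError W θ B T t G G' (s i) (s (i + 1)))
      (fun i => hB.measurable_hedgeError hG (hts i) (hsm i.le_succ))
      (fun i => hB.memLp_hedgeError hG (hts i) (hsm i.le_succ))
      (fun i φ hφ hφL => hB.integral_mul_hedgeError hθ hG (hts i) (hsm i.le_succ) (hsT _) hφ
        (hφL.integrable (by norm_num))) (k + 1) hε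
    refine le_trans (measure_mono ?_) (hkol.trans (ENNReal.ofReal_le_ofReal
      (div_le_div_of_nonneg_right ?_ (by positivity))))
    · rintro ω ⟨j, hj, hω⟩
      refine ⟨j, hj, hω.trans (le_of_eq ?_)⟩
      congr 1
      refine Finset.sum_congr rfl fun i hi => ?_
      obtain ⟨e1, e2⟩ := heq i ((Finset.mem_range.1 hi).trans_le hj)
      rw [e1, e2]
    · have hstep : ∀ i ∈ Finset.range (k + 1),
          ∫ ω, hedgeError W θ B T t G G' (s i) (s (i + 1)) ω ^ 2 ∂P ≤
            C₁ * (R ^ 2 * h k) ^ 2 + 2 * C ^ 2 * (ρ ^ 2 * h k) := by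
        intro i hi
        obtain ⟨e1, e2⟩ := heq i (Finset.mem_range.1 hi)
        have hΔ : (s (i + 1) : ℝ) - s i = h k := by
          rw [e1, e2]
          exact coe_gridTime_succ_sub htT.le (k + 1) i
        have := hB.integral_sq_hedgeError_le hθ hG (hts i) (hsm i.le_succ) (hsT (i + 1)) hR
          (ρ := ρ) (by rwa [Nat.succ_eq_add_one, hΔ]) fun r hr => by
            rw [← dist_eq_norm]
            refine (hu _ ⟨zero_le, hsT i⟩ _ ⟨zero_le, hr.2.trans (hsT _)⟩ ?_).le
            have h1 : (s i : ℝ) ≤ r := hr.1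
            have h2 : (r : ℝ) ≤ s (i + 1) := hr.2
            rw [NNReal.dist_eq, abs_sub_comm, abs_of_nonneg (by linarith)]
            linarith
        rwa [Nat.succ_eq_add_one, hΔ] at this
      refine (Finset.sum_le_sum hstep).trans (le_of_eq ?_)
      rw [Finset.sum_const, Finset.card_range, nsmul_eq_mul]
      have hN : ((k + 1 : ℕ) : ℝ) * h k = T - t := by
        rw [hh]
        field_simp
      linear_combination (C₁ * R ^ 4 * h k + 2 * C ^ 2 * ρ ^ 2) * hN
  rw [ENNReal.tendsto_atTop_zero]
  intro e he
  obtain ⟨e', he', hee⟩ := ENNReal.lt_iff_exists_nnreal_btwn.1 he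
  have he'' : (0 : ℝ) < e' := by exact_mod_cast he'
  -- choose the oscillation `ρ` of `θ` first, then the mesh
  have hlim1 : Tendsto (fun ρ : ℝ => 2 * C ^ 2 * ρ ^ 2 * (T - t) / ε ^ 2) (𝓝[>] 0) (𝓝 0) := by
    have : Continuous fun ρ : ℝ => 2 * C ^ 2 * ρ ^ 2 * (T - t) / ε ^ 2 := by fun_prop
    simpa using (this.tendsto 0).mono_left nhdsWithin_le_nhds
  obtain ⟨ρ, hρ1, hρ⟩ := ((hlim1.eventually_lt_const he'').and self_mem_nhdsWithin).exists
  have hlim2 : Tendsto (fun k => (C₁ * R ^ 4 * (T - t) * h k + 2 * C ^ 2 * ρ ^ 2 * (T - t)) / ε ^ 2)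
      atTop (𝓝 (2 * C ^ 2 * ρ ^ 2 * (T - t) / ε ^ 2)) := by
    simpa using ((hh0.const_mul (C₁ * R ^ 4 * (T - t))).add_const
      (2 * C ^ 2 * ρ ^ 2 * (T - t))).div_const (ε ^ 2)
  obtain ⟨k₀, hk₀⟩ := eventually_atTop.1 ((key ρ hρ).and (hlim2.eventually_lt_const hρ1))
  refine ⟨k₀, fun k hk => ((hk₀ k hk).1.trans ?_).trans hee.le⟩
  rw [← ENNReal.ofReal_coe_nnreal]
  exact ENNReal.ofReal_le_ofReal (hk₀ k hk).2.le

/-- Itô's formula for the heat flow of a smooth payoff along the drifted Wiener integral. -/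
theorem IsWienerIntegral.isItoIntegral_hedgeValue [IsProbabilityMeasure P] [P.IsComplete]
    (hB : IsWienerIntegral hW θ T B) (hθ : Continuous θ) (hG : SmoothPayoff G G' C)
    (htT : t < T) :
    IsItoIntegral P (brownianFiltration P W hW.measurable) W t T
      (fun s ω => hedgeValue θ B T t G' s ω • θ s)
      (fun s ω => hedgeValue θ B T t G s ω - hedgeValue θ B T t G t ω -
        ∫ r in (t : ℝ)..s, hedgeValue θ B T t G' r.toNNReal ω * ‖θ r.toNNReal‖ ^ 2) := by
  obtain ⟨R, hR⟩ := exists_norm_le_of_continuous hθ T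
  have hR0 : 0 ≤ R := (norm_nonneg _).trans (hR 0 ⟨le_rfl, zero_le⟩)
  have hC := hG.nonneg
  have htT' : (0 : ℝ) < T - t := sub_pos.2 (NNReal.coe_lt_coe.2 htT)
  set h : ℕ → ℝ := fun k => ((T : ℝ) - t) / (k + 1 : ℕ) with hh
  have hh0 : Tendsto h atTop (𝓝 0) := tendsto_mesh t T
  have hle := (brownianFiltration P W hW.measurable).le
  have hmY : ∀ s, Measurable (driftedWiener θ B t s) := fun s =>
    (((hB.past s).mono (hle s) le_rfl).sub ((hB.past t).mono (hle t) le_rfl)).add_const _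
  have hmX : ∀ s, Measurable (hedgeValue θ B T t G s) := fun s =>
    ((continuous_heat hG.continuous hG.bound).comp (Continuous.prodMk_right _)).measurable.comp
      (hmY s)
  have hmη : ∀ s, Measurable (hedgeValue θ B T t G' s) := fun s =>
    ((continuous_heat hG.continuous' hG.bound').comp (Continuous.prodMk_right _)).measurable.comp
      (hmY s)
  -- all the oscillations are controlled at once through a product process
  set Z : ℝ≥0 → Ω → EuclideanSpace ℝ (Fin n) × ℝ × ℝ × EuclideanSpace ℝ (Fin n) := fun s ω =>
    (W s ω, hedgeValue θ B T t G s ω, hedgeValue θ B T t G' s ω,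
      hedgeValue θ B T t G' s ω • θ s) with hZ
  have hmZ : ∀ s, Measurable (Z s) := fun s =>
    (hW.measurable s).prodMk ((hmX s).prodMk ((hmη s).prodMk ((hmη s).smul_const _)))
  have hcZ : ∀ᵐ ω ∂P, Continuous fun s => Z s ω := by
    filter_upwards [hW.ae_continuous] with ω hω
    have h1 := hB.continuous_hedgeValue hθ t hG.continuous hG.bound ω
    have h2 := hB.continuous_hedgeValue hθ t hG.continuous' hG.bound' ω
    exact hω.prodMk (h1.prodMk (h2.prodMk (h2.smul hθ)))
  have hosc : ∀ ε : ℝ, 0 < ε → Tendsto (fun k => P {ω | ∃ s ∈ Set.Icc 0 T, ∃ s' ∈ Set.Icc 0 T,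
      dist s s' ≤ h k ∧ ε < dist (Z s ω) (Z s' ω)}) atTop (𝓝 0) := fun ε hε =>
    tendsto_measure_oscillation hmZ hcZ T hh0 hε
  refine ⟨fun k => hedgeSimple hB t hG (k + 1), fun ε hε => ?_, fun ε hε => ?_⟩
  -- convergence of the integrands: the integrand oscillates by at most `d` over each cell
  · obtain ⟨e, he0, heε⟩ := ENNReal.lt_iff_exists_nnreal_btwn.1 hε
    have he0' : (0 : ℝ) < e := by exact_mod_cast he0
    set d : ℝ := √(e / (T - t)) with hd
    have hd0 : 0 < d := Real.sqrt_pos.2 (by positivity)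
    have hd2 : d ^ 2 * (T - t) = e := by
      rw [hd, Real.sq_sqrt (by positivity)]
      field_simp
    refine tendsto_of_tendsto_of_tendsto_of_le_of_le tendsto_const_nhds (hosc d hd0)
      (fun _ => zero_le) fun k => measure_mono fun ω hω => ?_
    by_contra hcon
    simp only [Set.mem_ofPred_eq, not_exists, not_and, not_lt] at hcon
    refine absurd (Set.mem_ofPred_eq ▸ hω) (not_le.2 (lt_of_le_of_lt ?_ heε))
    rw [setLIntegral_congr (Ioc_ae_eq_Icc (μ := volume) (a := (t : ℝ)) (b := T)).symm]
    calc ∫⁻ r in Set.Ioc (t : ℝ) T, ‖(hedgeSimple hB t hG (k + 1)).val r.toNNReal ω -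
          hedgeValue θ B T t G' r.toNNReal ω • θ r.toNNReal‖ₑ ^ 2
        ≤ ∫⁻ _ in Set.Ioc (t : ℝ) T, ENNReal.ofReal d ^ 2 := by
          refine setLIntegral_mono' measurableSet_Ioc fun r hr => ?_
          have hr' : r.toNNReal ∈ Set.Ioc t T :=
            ⟨Real.lt_toNNReal_iff_coe_lt.2 hr.1, Real.toNNReal_le_iff_le_coe.2 hr.2⟩
          obtain ⟨i, hi, hri⟩ := exists_mem_Ioc_of_monotone (τ := gridTime t T (k + 1))
            (N := k + 1) (s := r.toNNReal)
            (by rwa [gridTime_zero, gridTime_last htT.le k.succ_pos])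
          have hdist := hcon (gridTime t T (k + 1) i)
            ⟨zero_le, gridTime_le htT.le k.succ_pos hi.le⟩ r.toNNReal ⟨zero_le, hr'.2⟩ (by
              have h1 : (gridTime t T (k + 1) i : ℝ) < r.toNNReal := hri.1
              have h2 : (r.toNNReal : ℝ) ≤ gridTime t T (k + 1) (i + 1) := hri.2
              have h3 : _ = h k := coe_gridTime_succ_sub htT.le (k + 1) i
              rw [NNReal.dist_eq, abs_sub_comm, abs_of_nonneg (by linarith)]
              linarith)
          rw [hedgeSimple_val hB hG hi hri]
          simp only [hZ, Prod.dist_eq, max_le_iff] at hdist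
          have h4 := hdist.2.2.2
          rw [dist_eq_norm] at h4
          rw [← ofReal_norm]
          gcongr
      _ = ENNReal.ofReal (d ^ 2 * (T - t)) := by
          rw [setLIntegral_const, Real.volume_Ioc, ENNReal.ofReal_mul (by positivity),
            ENNReal.ofReal_pow hd0.le]
      _ = e := by rw [hd2, ENNReal.ofReal_coe_nnreal]
  -- convergence of the integrals, uniformly in time
  · obtain ⟨e, he0, heε⟩ := ENNReal.lt_iff_exists_nnreal_btwn.1 hε
    have he0' : (0 : ℝ) < e := by exact_mod_cast he0
    set A : ℝ := 2 + R ^ 2 * T + C * R with hA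
    have hA0 : 0 < A := by positivity
    set d : ℝ := e / 2 / A with hd
    have hd0 : 0 < d := by positivity
    have hdA : d * A = e / 2 := by
      rw [hd]
      field_simp
    have hsum : Tendsto (fun k : ℕ => P {ω | ∃ s ∈ Set.Icc 0 T, ∃ s' ∈ Set.Icc 0 T,
        dist s s' ≤ h k ∧ d < dist (Z s ω) (Z s' ω)} + P {ω | ∃ j ≤ k + 1,
        d ≤ |∑ i ∈ Finset.range j, hedgeError W θ B T t G G' (gridTime t T (k + 1) i)
          (gridTime t T (k + 1) (i + 1)) ω|}) atTop (𝓝 0) := by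
      simpa using (hosc d hd0).add (hB.tendsto_measure_hedgeError hθ hG htT hd0)
    have hsmall : Tendsto (fun k => h k * (C * R ^ 4 * T + C * R ^ 2)) atTop (𝓝 0) := by
      simpa using hh0.mul_const (C * R ^ 4 * T + C * R ^ 2)
    refine tendsto_of_tendsto_of_tendsto_of_le_of_le' tendsto_const_nhds hsum
      (Eventually.of_forall fun _ => zero_le) ?_
    filter_upwards [hsmall.eventually_le_const (half_pos he0')] with k hk
    refine (measure_mono fun ω hω => ?_).trans (measure_union_le _ _)
    by_contra hcon
    simp only [Set.mem_union, Set.mem_ofPred_eq, not_or, not_exists, not_and, not_lt,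
      not_le] at hcon
    obtain ⟨hc1, hc2⟩ := hcon
    have hc1' := fun s hs s' hs' hss' => by
      have := hc1 s hs s' hs' hss'
      simpa only [hZ, Prod.dist_eq, max_le_iff] using this
    have hmain := hB.abs_hedgeSimple_integral_sub_le hθ hG htT k.succ_pos hR hd0.le ω
      (fun s hs s' hs' hss' => by
        rw [← dist_eq_norm]
        exact (hc1' s hs s' hs' hss').1)
      (fun s hs s' hs' hss' => (hc1' s hs s' hs' hss').2.1)
      (fun s hs s' hs' hss' => (hc1' s hs s' hs' hss').2.2.1)
      (fun j hj => (hc2 j hj).le)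
    refine absurd (Set.mem_ofPred_eq ▸ hω) (not_le.2 (lt_of_le_of_lt (iSup₂_le fun s hs => ?_) heε))
    rw [← ofReal_norm, Real.norm_eq_abs, ← ENNReal.ofReal_coe_nnreal]
    refine ENNReal.ofReal_le_ofReal ((hmain s hs).trans ?_)
    change d * A + h k * _ ≤ _
    linarith

end ItoLimit


/-! ### The dual minimizer and the hedging portfolio -/

section Dual

variable {n : ℕ}

lemma inner_transpose_toEuclideanLin (A : Matrix (Fin n) (Fin n) ℝ)
    (x y : EuclideanSpace ℝ (Fin n)) :
    ⟪x, A.transpose.toEuclideanLin y⟫ = ⟪A.toEuclideanLin x, y⟫ := by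
  rw [← Matrix.conjTranspose_eq_transpose_of_trivial,
    Matrix.toEuclideanLin_conjTranspose_eq_adjoint,
    LinearMap.adjoint_inner_right]

lemma toEuclideanLin_mul (A B : Matrix (Fin n) (Fin n) ℝ) (x : EuclideanSpace ℝ (Fin n)) :
    (A * B).toEuclideanLin x = A.toEuclideanLin (B.toEuclideanLin x) := by
  ext i
  simp [Matrix.toLpLin_apply, Matrix.mulVec_mulVec]

lemma toEuclideanLin_one (x : EuclideanSpace ℝ (Fin n)) :
    (1 : Matrix (Fin n) (Fin n) ℝ).toEuclideanLin x = x := by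
  ext i
  simp

variable (b : EuclideanSpace ℝ (Fin n)) {σ : Matrix (Fin n) (Fin n) ℝ} (hσ : IsUnit σ.det)
  (K : ProperCone ℝ (EuclideanSpace ℝ (Fin n)))

include hσ

lemma isDualMinimizer_dualMinimizer : IsDualMinimizer b σ K (dualMinimizer b σ K) :=
  Classical.epsilon_spec (existsUnique_isDualMinimizer b σ hσ K).exists

/-- Since `q` is a direction in which the minimizer may be moved, `⟨θ̂, σ⁻¹ q⟩` is a nonnegative
directional derivative. -/
lemma inner_thetaHat_nonneg_of_add_mem {q : EuclideanSpace ℝ (Fin n)}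
    (hq : ∀ ε : ℝ, 0 < ε → ε < 1 → dualMinimizer b σ K + ε • q ∈
      ProperCone.innerDual (K : Set (EuclideanSpace ℝ (Fin n)))) :
    0 ≤ ⟪thetaHat b σ K, σ⁻¹.toEuclideanLin q⟫ := by
  have hmin := (isDualMinimizer_dualMinimizer b hσ K).2
  by_contra! hneg
  set c := ⟪thetaHat b σ K, σ⁻¹.toEuclideanLin q⟫ with hc
  set m := ‖σ⁻¹.toEuclideanLin q‖ ^ 2 with hm
  have hm0 : 0 ≤ m := by positivity
  have key : ∀ ε : ℝ, 0 < ε → ε < 1 → 0 ≤ 2 * c + ε * m := by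
    intro ε h0 h1
    have h := hmin _ (hq ε h0 h1)
    have e : shiftedPrice b σ (dualMinimizer b σ K + ε • q) =
        thetaHat b σ K + ε • σ⁻¹.toEuclideanLin q := by
      rw [thetaHat, shiftedPrice, shiftedPrice, map_add, map_smul]
      abel
    rw [e, norm_add_sq_real, norm_smul, inner_smul_right, ← hc, mul_pow, ← hm, Real.norm_eq_abs,
      sq_abs] at h
    change ‖thetaHat b σ K‖ ^ 2 ≤ _ at h
    nlinarith
  have hε : 0 < min (1 / 2) (-c / (m + 1)) := lt_min (by norm_num) (div_pos (by linarith)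
    (by linarith))
  have h := key _ hε (lt_of_le_of_lt (min_le_left _ _) (by norm_num))
  have h2 : min (1 / 2) (-c / (m + 1)) * m ≤ -c := by
    calc min (1 / 2) (-c / (m + 1)) * m ≤ -c / (m + 1) * (m + 1) := by
          gcongr
          · exact div_nonneg (by linarith) (by linarith)
          · exact min_le_right _ _
          · linarith
      _ = -c := by field_simp
  linarith

/-- Complementary slackness: the minimizer can be rescaled upwards and downwards inside the cone. -/
lemma inner_thetaHat_dualMinimizer :
    ⟪thetaHat b σ K, σ⁻¹.toEuclideanLin (dualMinimizer b σ K)⟫ = 0 := by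
  have hp := (isDualMinimizer_dualMinimizer b hσ K).1
  set D := ProperCone.innerDual (K : Set (EuclideanSpace ℝ (Fin n)))
  have h1 := inner_thetaHat_nonneg_of_add_mem b hσ K (q := dualMinimizer b σ K)
    fun ε h0 _ => D.toPointedCone.add_mem hp (D.toPointedCone.smul_mem h0.le hp)
  have h2 := inner_thetaHat_nonneg_of_add_mem b hσ K (q := -dualMinimizer b σ K)
    fun ε _ h1 => by
      have e : dualMinimizer b σ K + ε • -dualMinimizer b σ K =
          (1 - ε) • dualMinimizer b σ K := by module
      rw [e]
      exact D.toPointedCone.smul_mem (by linarith) hp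
  rw [map_neg, inner_neg_right] at h2
  linarith

/-- The portfolio `(σ')⁻¹ θ̂`, which exposes wealth to the direction `θ̂` of the noise, belongs to
the constraint cone: it is in the polar of the polar of `K`. -/
lemma transpose_inv_thetaHat_mem : σ⁻¹.transpose.toEuclideanLin (thetaHat b σ K) ∈ K := by
  have hp := (isDualMinimizer_dualMinimizer b hσ K).1
  set D := ProperCone.innerDual (K : Set (EuclideanSpace ℝ (Fin n))) with hD
  have h : σ⁻¹.transpose.toEuclideanLin (thetaHat b σ K) ∈
      ProperCone.innerDual (D : Set (EuclideanSpace ℝ (Fin n))) := by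
    rw [ProperCone.mem_innerDual]
    intro q hq
    rw [inner_transpose_toEuclideanLin, real_inner_comm]
    exact inner_thetaHat_nonneg_of_add_mem b hσ K fun ε h0 _ =>
      D.toPointedCone.add_mem hp (D.toPointedCone.smul_mem h0.le hq)
  rwa [hD, ProperCone.innerDual_innerDual] at h

lemma transpose_toEuclideanLin_inv (v : EuclideanSpace ℝ (Fin n)) :
    σ.transpose.toEuclideanLin (σ⁻¹.transpose.toEuclideanLin v) = v := by
  rw [← toEuclideanLin_mul, ← Matrix.transpose_mul, Matrix.nonsing_inv_mul σ hσ,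
    Matrix.transpose_one, toEuclideanLin_one]

/-- The drift of the portfolio `(σ')⁻¹ θ̂` is `|θ̂|²`, by complementary slackness. -/
lemma inner_transpose_inv_thetaHat :
    ⟪σ⁻¹.transpose.toEuclideanLin (thetaHat b σ K), b⟫ = ‖thetaHat b σ K‖ ^ 2 := by
  have h := inner_thetaHat_dualMinimizer b hσ K
  rw [real_inner_comm, inner_transpose_toEuclideanLin, real_inner_comm,
    ← real_inner_self_eq_norm_sq]
  have e : thetaHat b σ K = σ⁻¹.toEuclideanLin b + σ⁻¹.toEuclideanLin (dualMinimizer b σ K) := rfl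
  conv_rhs => rhs; rw [e]
  rw [inner_add_right, h, add_zero]

/-- The drift of an admissible portfolio is dominated by its exposure to `θ̂`. -/
lemma inner_le_of_mem_cone {π : EuclideanSpace ℝ (Fin n)} (hπ : π ∈ K) :
    ⟪π, b⟫ ≤ ⟪σ.transpose.toEuclideanLin π, thetaHat b σ K⟫ := by
  have hp : 0 ≤ ⟪π, dualMinimizer b σ K⟫ := (isDualMinimizer_dualMinimizer b hσ K).1 hπ
  have e : σ.toEuclideanLin (thetaHat b σ K) = b + dualMinimizer b σ K := by
    rw [thetaHat, shiftedPrice, map_add, ← toEuclideanLin_mul, ← toEuclideanLin_mul,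
      Matrix.mul_nonsing_inv σ hσ, toEuclideanLin_one, toEuclideanLin_one]
  rw [real_inner_comm (thetaHat b σ K), inner_transpose_toEuclideanLin, e, inner_add_left,
    real_inner_comm π b, real_inner_comm π (dualMinimizer b σ K)]
  linarith

end Dual

/-! ### Replication by admissible portfolios -/

section Wealth

variable {Ω : Type*} {mΩ : MeasurableSpace Ω} {n : ℕ} {P : Measure Ω}
  {W : ℝ≥0 → Ω → EuclideanSpace ℝ (Fin n)}

lemma IsItoIntegral.congr {𝓕 : Filtration ℝ≥0 mΩ} {t T : ℝ≥0}
    {H H' : ℝ≥0 → Ω → EuclideanSpace ℝ (Fin n)} {I I' : ℝ≥0 → Ω → ℝ}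
    (h : IsItoIntegral P 𝓕 W t T H I) (hH : ∀ s ∈ Set.Icc t T, H s = H' s)
    (hI : ∀ s ∈ Set.Icc t T, I s = I' s) : IsItoIntegral P 𝓕 W t T H' I' := by
  obtain ⟨Hs, h1, h2⟩ := h
  refine ⟨Hs, fun ε hε => ?_, fun ε hε => ?_⟩
  · convert h1 ε hε using 5 with k ω
    refine iff_of_eq (congrArg (ε ≤ ·) (setLIntegral_congr_fun measurableSet_Icc fun r hr => ?_))
    have : r.toNNReal ∈ Set.Icc t T :=
      ⟨NNReal.le_toNNReal_of_coe_le hr.1, Real.toNNReal_le_iff_le_coe.2 hr.2⟩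
    simp only [hH _ this]
  · convert h2 ε hε using 5 with k ω
    refine iff_of_eq (congrArg (ε ≤ ·) (iSup_congr fun s => iSup_congr fun hs => ?_))
    rw [hI s hs]

/-- `θ̂` as a function on `[0, ∞)`, frozen after time `T`. -/
noncomputable def stoppedThetaHat (b : ℝ≥0 → EuclideanSpace ℝ (Fin n))
    (σ : ℝ≥0 → Matrix (Fin n) (Fin n) ℝ) (K : ProperCone ℝ (EuclideanSpace ℝ (Fin n)))
    (T s : ℝ≥0) : EuclideanSpace ℝ (Fin n) :=
  thetaHat (b (min s T)) (σ (min s T)) K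

variable {b : ℝ≥0 → EuclideanSpace ℝ (Fin n)} {σ : ℝ≥0 → Matrix (Fin n) (Fin n) ℝ}
  {K : ProperCone ℝ (EuclideanSpace ℝ (Fin n))} {T t : ℝ≥0}

lemma stoppedThetaHat_of_le {s : ℝ≥0} (hs : s ≤ T) :
    stoppedThetaHat b σ K T s = thetaHat (b s) (σ s) K := by
  rw [stoppedThetaHat, min_eq_left hs]

lemma ParabolicityAssumption.continuous (hθ : ParabolicityAssumption b σ K T) :
    Continuous (stoppedThetaHat b σ K T) :=
  hθ.1.comp_continuous (continuous_id.min continuous_const) fun _ => ⟨zero_le, min_le_right _ _⟩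

/-- Since `θ̂` does not vanish, the variance remaining at each time before `T` is positive. -/
lemma ParabolicityAssumption.clock_lt (hθ : ParabolicityAssumption b σ K T) (htT : t < T) :
    clock (stoppedThetaHat b σ K T) t < clock (stoppedThetaHat b σ K T) T := by
  obtain ⟨θ₀, h0, hθ₀⟩ := hθ.2
  have htT' : (t : ℝ) < T := NNReal.coe_lt_coe.2 htT
  rw [← NNReal.coe_lt_coe, ← sub_pos, coe_clock_sub_coe hθ.continuous]
  refine intervalIntegral.intervalIntegral_pos_of_pos_on
    ((continuous_sq_norm hθ.continuous).intervalIntegrable _ _) (fun r _ => ?_) htT'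
  exact pow_pos (h0.trans_le (hθ₀ _ ⟨zero_le, min_le_right _ _⟩)) 2

lemma continuous_transpose_inv_stoppedThetaHat (hσ : ContinuousOn σ (Set.Icc 0 T))
    (hσ_det : ∀ s ∈ Set.Icc 0 T, IsUnit (σ s).det) (hθ : ParabolicityAssumption b σ K T) :
    Continuous fun s => (σ (min s T))⁻¹.transpose.toEuclideanLin (stoppedThetaHat b σ K T s) := by
  have h1 : Continuous fun s => σ (min s T) :=
    hσ.comp_continuous (continuous_id.min continuous_const) fun _ => ⟨zero_le, min_le_right _ _⟩
  have h2 : Continuous fun s => (σ (min s T))⁻¹ := continuous_iff_continuousAt.2 fun s => by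
    refine ContinuousAt.comp (f := fun s => σ (min s T)) (continuousAt_matrix_inv _ ?_)
      h1.continuousAt
    rw [Ring.inverse_eq_inv']
    exact continuousAt_inv₀ (hσ_det _ ⟨zero_le, min_le_right _ _⟩).ne_zero
  have h3 : Continuous fun s => WithLp.ofLp (stoppedThetaHat b σ K T s) :=
    (PiLp.continuous_ofLp 2 _).comp hθ.continuous
  simp only [Matrix.toLpLin_apply]
  exact (PiLp.continuous_toLp 2 _).comp (h2.matrix_transpose.matrix_mulVec h3)

variable {hW : IsStandardBrownian W P} {B : ℝ≥0 → Ω → ℝ} {G G' : ℝ → ℝ} {C c : ℝ}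

lemma le_heat (hG : SmoothPayoff G G' C) (hc : ∀ y, c ≤ G y) (hc0 : 0 < c) (w : ℝ≥0) (y : ℝ) :
    c ≤ heat w G y := by
  have h := heat_mono (G := fun _ => c) (C := C) continuous_const hG.continuous (fun z => by
    rw [abs_of_pos hc0]
    exact (hc z).trans ((le_abs_self _).trans (hG.bound z))) hG.bound hc w y
  rwa [heat_const] at h

lemma driftedWiener_self {θ : ℝ≥0 → EuclideanSpace ℝ (Fin n)} (ω : Ω) :
    driftedWiener θ B t t ω = 0 := by
  simp [driftedWiener]

/-- The heat flow of a smooth positive increasing payoff is the wealth process of an admissible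
portfolio, proportional to `(σ')⁻¹ θ̂`. -/
theorem IsWienerIntegral.isWealthProcess_hedgeValue [IsProbabilityMeasure P] [P.IsComplete]
    (hσ : ContinuousOn σ (Set.Icc 0 T)) (hσ_det : ∀ s ∈ Set.Icc 0 T, IsUnit (σ s).det)
    (hθ : ParabolicityAssumption b σ K T) (htT : t < T)
    (hB : IsWienerIntegral hW (stoppedThetaHat b σ K T) T B)
    (hG : SmoothPayoff G G' C) (hc0 : 0 < c) (hc : ∀ y, c ≤ G y) (hG' : ∀ y, 0 ≤ G' y) :
    ∃ π, IsWealthProcess P (brownianFiltration P W hW.measurable) W b σ K T t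
      (heat (clock (stoppedThetaHat b σ K T) T - clock (stoppedThetaHat b σ K T) t) G 0) π
      (hedgeValue (stoppedThetaHat b σ K T) B T t G) := by
  set θ := stoppedThetaHat b σ K T with hθdef
  set κ : ℝ≥0 → EuclideanSpace ℝ (Fin n) := fun s =>
    (σ (min s T))⁻¹.transpose.toEuclideanLin (θ s) with hκ
  have hθc : Continuous θ := hθ.continuous
  have hκc : Continuous κ := continuous_transpose_inv_stoppedThetaHat hσ hσ_det hθ
  have hX : ∀ s ω, c ≤ hedgeValue θ B T t G s ω := fun s ω => le_heat hG hc hc0 _ _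
  have hX0 : ∀ s ω, hedgeValue θ B T t G s ω ≠ 0 := fun s ω => (hc0.trans_le (hX s ω)).ne'
  have hη : ∀ s ω, 0 ≤ hedgeValue θ B T t G' s ω := fun s ω => integral_nonneg fun u => hG' _
  have hXc := fun ω => hB.continuous_hedgeValue hθc t hG.continuous hG.bound ω
  have hηc := fun ω => hB.continuous_hedgeValue hθc t hG.continuous' hG.bound' ω
  -- freezing the ratio before time `t` keeps the portfolio adapted on all of `[0, ∞)`
  set π : ℝ≥0 → Ω → EuclideanSpace ℝ (Fin n) := fun s ω =>
    (hedgeValue θ B T t G' (max s t) ω / hedgeValue θ B T t G (max s t) ω) • κ s with hπ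
  have hπc : ∀ ω, Continuous fun s => π s ω := fun ω =>
    (((hηc ω).comp (continuous_id.max continuous_const)).div
      ((hXc ω).comp (continuous_id.max continuous_const)) fun s => hX0 _ _).smul hκc
  have hadapt : ∀ {F : ℝ → ℝ}, Continuous F → (∀ y, |F y| ≤ C) → ∀ s,
      Measurable[brownianFiltration P W hW.measurable s] (hedgeValue θ B T t F (max s t)) := by
    intro F hF hFC s
    rcases le_or_gt t s with h | h
    · rw [max_eq_left h]
      exact hB.measurable_hedgeValue hF hFC h
    · rw [max_eq_right h.le]
      have : hedgeValue θ B T t F t = fun _ => heat (clock θ T - clock θ t) F 0 := by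
        ext ω
        rw [hedgeValue, driftedWiener_self]
      rw [this]
      exact measurable_const
  have hκmem : ∀ s, κ s ∈ K := fun s =>
    transpose_inv_thetaHat_mem _ (hσ_det _ ⟨zero_le, min_le_right _ _⟩) K
  have hdrift : ∀ s ∈ Set.Icc t T, ∀ ω, hedgeValue θ B T t G s ω * ⟪π s ω, b s⟫ =
      hedgeValue θ B T t G' s ω * ‖θ s‖ ^ 2 := by
    intro s hs ω
    have h1 : ⟪κ s, b s⟫ = ‖θ s‖ ^ 2 := by
      simp only [hκ, hθdef, stoppedThetaHat_of_le hs.2, min_eq_left hs.2]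
      exact inner_transpose_inv_thetaHat _ (hσ_det s ⟨zero_le, hs.2⟩) K
    simp only [hπ, max_eq_left hs.1]
    rw [real_inner_smul_left, h1]
    have := hX0 s ω
    field_simp
  have hvol : ∀ s ∈ Set.Icc t T, ∀ ω, hedgeValue θ B T t G s ω •
      (σ s).transpose.toEuclideanLin (π s ω) = hedgeValue θ B T t G' s ω • θ s := by
    intro s hs ω
    have h1 : (σ s).transpose.toEuclideanLin (κ s) = θ s := by
      simp only [hκ, min_eq_left hs.2]
      exact transpose_toEuclideanLin_inv (hσ_det s ⟨zero_le, hs.2⟩) _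
    simp only [hπ, max_eq_left hs.1]
    rw [map_smul, h1, smul_smul, mul_div_cancel₀ _ (hX0 s ω)]
  have hdrift' : ∀ s ∈ Set.Icc t T, ∀ ω, Set.EqOn
      (fun r : ℝ => hedgeValue θ B T t G' r.toNNReal ω * ‖θ r.toNNReal‖ ^ 2)
      (fun r : ℝ => hedgeValue θ B T t G r.toNNReal ω * ⟪π r.toNNReal ω, b r.toNNReal⟫)
      (Set.uIcc (t : ℝ) s) := by
    intro s hs ω r hr
    rw [Set.uIcc_of_le (NNReal.coe_le_coe.2 hs.1)] at hr
    exact (hdrift _ ⟨NNReal.le_toNNReal_of_coe_le hr.1,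
      (Real.toNNReal_le_iff_le_coe.2 hr.2).trans hs.2⟩ ω).symm
  refine ⟨π, ⟨?_, fun s _ => ae_of_all _ fun ω => ?_, fun s hs => ?_,
    ae_of_all _ fun ω => (hXc ω).continuousOn, ae_of_all _ fun ω s _ => hc0.le.trans (hX s ω),
    ae_of_all _ fun ω => ?_, ?_⟩⟩
  · refine (StronglyAdapted.isStronglyProgressive_of_continuous (fun s => ?_) hπc).isProgressive
    exact (((hadapt hG.continuous' hG.bound' s).div
      (hadapt hG.continuous hG.bound s)).smul_const (κ s)).stronglyMeasurable
  · exact K.toPointedCone.smul_mem (div_nonneg (hη _ _) (hc0.le.trans (hX _ _))) (hκmem s)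
  · exact hB.measurable_hedgeValue hG.continuous hG.bound hs.1
  · have hi : IntervalIntegrable
        (fun r : ℝ => hedgeValue θ B T t G' r.toNNReal ω * ‖θ r.toNNReal‖ ^ 2) volume t T :=
      (((hηc ω).comp continuous_real_toNNReal).mul (continuous_sq_norm hθc)).intervalIntegrable _ _
    exact IntervalIntegrable.congr_uIoo hi
      ((hdrift' T ⟨htT.le, le_rfl⟩ ω).mono Set.uIoo_subset_uIcc_self)
  · refine (hB.isItoIntegral_hedgeValue hθc hG htT).congr (fun s hs => ?_) fun s hs => ?_
    · ext1 ω
      exact (hvol s hs ω).symm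
    · ext1 ω
      rw [intervalIntegral.integral_congr (hdrift' s hs ω)]
      congr 2
      rw [hedgeValue, driftedWiener_self]

end Wealth


/-! ### Exponential tilting of Gaussian laws -/

section Tilt

/-- The normalized exponential tilt `e ^ (c x)` shifts the mean of a Gaussian law by `c` times its
variance. -/
lemma withDensity_exp_gaussianReal (m c : ℝ) (w : ℝ≥0) :
    (gaussianReal m w).withDensity
      (fun x => ENNReal.ofReal (Real.exp (c * x - (c * m + c ^ 2 * w / 2)))) =
      gaussianReal (m + c * w) w := by
  by_cases hw : w = 0
  · subst hw
    rw [gaussianReal_zero_var, gaussianReal_zero_var]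
    ext s hs
    rw [withDensity_apply _ hs, ← lintegral_indicator hs, lintegral_dirac]
    by_cases hms : m ∈ s <;> simp [hms, Measure.dirac_apply' _ hs]
  · rw [gaussianReal_of_var_ne_zero _ hw, gaussianReal_of_var_ne_zero _ hw,
      ← withDensity_mul _ (measurable_gaussianPDF m w) (by fun_prop)]
    congr 1
    ext x
    rw [Pi.mul_apply, gaussianPDF, gaussianPDF, ← ENNReal.ofReal_mul (gaussianPDFReal_nonneg _ _ _),
      gaussianPDFReal, gaussianPDFReal, mul_assoc, ← Real.exp_add]
    congr 3
    have : (w : ℝ) ≠ 0 := by exact_mod_cast hw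
    field_simp
    ring

lemma integral_exp_mul_gaussianReal (m c : ℝ) (w : ℝ≥0) (f : ℝ → ℝ) :
    ∫ x, Real.exp (c * x - (c * m + c ^ 2 * w / 2)) * f x ∂gaussianReal m w =
      ∫ x, f x ∂gaussianReal (m + c * w) w := by
  rw [← withDensity_exp_gaussianReal m c w, integral_withDensity_eq_integral_toReal_smul
    (by fun_prop) (ae_of_all _ fun _ => ENNReal.ofReal_lt_top)]
  refine integral_congr_ae (ae_of_all _ fun x => ?_)
  simp only [ENNReal.toReal_ofReal (Real.exp_nonneg _), smul_eq_mul]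

lemma integrable_exp_mul_gaussianReal_iff (m c : ℝ) (w : ℝ≥0) (f : ℝ → ℝ) :
    Integrable (fun x => Real.exp (c * x - (c * m + c ^ 2 * w / 2)) * f x) (gaussianReal m w) ↔
      Integrable f (gaussianReal (m + c * w) w) := by
  rw [← withDensity_exp_gaussianReal m c w, integrable_withDensity_iff_integrable_smul'
    (by fun_prop) (ae_of_all _ fun _ => ENNReal.ofReal_lt_top)]
  refine integrable_congr (ae_of_all _ fun x => ?_)
  simp only [ENNReal.toReal_ofReal (Real.exp_nonneg _), smul_eq_mul]

end Tilt

/-! ### Smoothing of monotone payoffs -/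

section Smoothing

/-- The average of `m` over the interval `[y - h, y]`. For monotone `m` it lies below `m`. -/
noncomputable def leftAverage (h : ℝ) (m : ℝ → ℝ) (y : ℝ) : ℝ :=
  h⁻¹ * ∫ r in (-h)..0, m (y + r)

variable {h : ℝ} {m : ℝ → ℝ}

lemma leftAverage_le (hh : 0 < h) (hm : Monotone m) (hc : Continuous m) (y : ℝ) :
    leftAverage h m y ≤ m y := by
  have h1 : ∫ r in (-h)..0, m (y + r) ≤ ∫ _ in (-h)..0, m y :=
    intervalIntegral.integral_mono_on (by linarith) ((by fun_prop : Continuous fun r =>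
      m (y + r)).intervalIntegrable _ _) (by simp) fun r hr => hm (by linarith [hr.2])
  rw [intervalIntegral.integral_const, sub_neg_eq_add, zero_add, smul_eq_mul] at h1
  rw [leftAverage, inv_mul_le_iff₀ hh]
  exact h1

lemma le_leftAverage (hh : 0 < h) (hm : Monotone m) (hc : Continuous m) (y : ℝ) :
    m (y - h) ≤ leftAverage h m y := by
  have h1 : ∫ _ in (-h)..0, m (y - h) ≤ ∫ r in (-h)..0, m (y + r) :=
    intervalIntegral.integral_mono_on (by linarith) (by simp) ((by fun_prop : Continuous fun r =>
      m (y + r)).intervalIntegrable _ _) fun r hr => hm (by linarith [hr.1])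
  rw [intervalIntegral.integral_const, sub_neg_eq_add, zero_add, smul_eq_mul] at h1
  rw [leftAverage, le_inv_mul_iff₀ hh]
  exact h1

lemma monotone_leftAverage (hh : 0 < h) (hm : Monotone m) (hc : Continuous m) :
    Monotone (leftAverage h m) := fun y z hyz =>
  mul_le_mul_of_nonneg_left (intervalIntegral.integral_mono_on (by linarith)
    ((by fun_prop : Continuous fun r => m (y + r)).intervalIntegrable _ _)
    ((by fun_prop : Continuous fun r => m (z + r)).intervalIntegrable _ _)
    fun r _ => hm (by linarith)) (inv_nonneg.2 hh.le)

lemma hasDerivAt_leftAverage (hc : Continuous m) (y : ℝ) :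
    HasDerivAt (leftAverage h m) (h⁻¹ * (m y - m (y - h))) y := by
  have hi : ∀ a b, IntervalIntegrable m volume a b := fun a b => hc.intervalIntegrable a b
  have e : leftAverage h m = fun y => h⁻¹ * ((∫ r in (0 : ℝ)..y, m r) -
      ∫ r in (0 : ℝ)..(y - h), m r) := by
    ext y
    rw [leftAverage, intervalIntegral.integral_comp_add_left (fun r => m r),
      intervalIntegral.integral_interval_sub_left (hi _ _) (hi _ _), add_zero, ← sub_eq_add_neg]
  rw [e]
  have h1 : ∀ y, HasDerivAt (fun y => ∫ r in (0 : ℝ)..y, m r) (m y) y := fun y =>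
    intervalIntegral.integral_hasDerivAt_right (hi _ _) (hc.stronglyMeasurableAtFilter _ _)
      hc.continuousAt
  refine HasDerivAt.const_mul _ ((h1 y).sub ?_)
  have := (h1 (y - h)).comp y ((hasDerivAt_id y).sub_const h)
  rwa [mul_one] at this

lemma continuous_leftAverage (hc : Continuous m) : Continuous (leftAverage h m) :=
  continuous_iff_continuousAt.2 fun y => (hasDerivAt_leftAverage hc y).continuousAt

/-- Averaging twice makes a bounded monotone function a smooth payoff. -/
lemma smoothPayoff_leftAverage {k : ℝ} (hh : 0 < h) (hm : Monotone m) (hc : Continuous m)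
    (h0 : ∀ y, 0 ≤ m y) (hk : ∀ y, m y ≤ k) :
    SmoothPayoff (leftAverage h (leftAverage h m))
      (fun y => h⁻¹ * (leftAverage h m y - leftAverage h m (y - h)))
      (k + h⁻¹ * k + 2 * h⁻¹ ^ 2 * k) := by
  have hk0 : 0 ≤ k := (h0 0).trans (hk 0)
  have hA := hasDerivAt_leftAverage (h := h) hc
  have hAm := monotone_leftAverage hh hm hc
  have hAc := continuous_leftAverage (h := h) hc
  have hA0 : ∀ y, 0 ≤ leftAverage h m y := fun y => (h0 _).trans (le_leftAverage hh hm hc y)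
  have hAk : ∀ y, leftAverage h m y ≤ k := fun y => (leftAverage_le hh hm hc y).trans (hk y)
  have hi : 0 < h⁻¹ := inv_pos.2 hh
  have hlip : ∀ y z, |leftAverage h m y - leftAverage h m z| ≤ h⁻¹ * k * |y - z| := by
    intro y z
    have := Convex.norm_image_sub_le_of_norm_hasDerivWithin_le (f := leftAverage h m)
      (C := h⁻¹ * k) (s := Set.univ) (x := z) (y := y)
      (fun x _ => (hA x).hasDerivWithinAt) (fun x _ => by
        rw [norm_mul, Real.norm_of_nonneg hi.le, Real.norm_eq_abs]
        refine mul_le_mul_of_nonneg_left ?_ hi.le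
        rw [abs_le]
        constructor <;> linarith [h0 x, h0 (x - h), hk x, hk (x - h)]) convex_univ trivial trivial
    exact this
  refine ⟨hasDerivAt_leftAverage hAc, fun y => ?_, fun y => ?_, fun y z => ?_⟩
  · have h1 := leftAverage_le hh hAm hAc y
    have h2 := le_leftAverage hh hAm hAc y
    rw [abs_of_nonneg ((hA0 _).trans h2)]
    have : 0 ≤ h⁻¹ * k + 2 * h⁻¹ ^ 2 * k := by positivity
    linarith [hAk y]
  · have h1 : |leftAverage h m y - leftAverage h m (y - h)| ≤ k := by
      rw [abs_le]
      constructor <;> linarith [hA0 y, hA0 (y - h), hAk y, hAk (y - h)]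
    rw [abs_mul, abs_of_pos hi]
    have h2 := mul_le_mul_of_nonneg_left h1 hi.le
    have : 0 ≤ k + 2 * h⁻¹ ^ 2 * k := by positivity
    linarith
  · have h1 := hlip y z
    have h2 := hlip (y - h) (z - h)
    rw [sub_sub_sub_cancel_right] at h2
    rw [← mul_sub, abs_mul, abs_of_pos hi]
    have h3 : |leftAverage h m y - leftAverage h m (y - h) -
        (leftAverage h m z - leftAverage h m (z - h))| ≤ 2 * (h⁻¹ * k * |y - z|) := by
      have e : leftAverage h m y - leftAverage h m (y - h) -
        (leftAverage h m z - leftAverage h m (z - h)) =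
        (leftAverage h m y - leftAverage h m z) -
          (leftAverage h m (y - h) - leftAverage h m (z - h)) := by ring
      rw [e]
      exact (abs_sub _ _).trans (by linarith)
    have h4 := mul_le_mul_of_nonneg_left h3 hi.le
    have h5 : 0 ≤ (k + h⁻¹ * k) * |y - z| := by positivity
    nlinarith

lemma SmoothPayoff.const_mul {G G' : ℝ → ℝ} {C a : ℝ} (hG : SmoothPayoff G G' C) (ha : 0 ≤ a) :
    SmoothPayoff (fun y => a * G y) (fun y => a * G' y) (a * C) where
  hasDerivAt y := (hG.hasDerivAt y).const_mul a
  bound y := by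
    rw [abs_mul, abs_of_nonneg ha]
    exact mul_le_mul_of_nonneg_left (hG.bound y) ha
  bound' y := by
    rw [abs_mul, abs_of_nonneg ha]
    exact mul_le_mul_of_nonneg_left (hG.bound' y) ha
  lipschitz y z := by
    rw [← mul_sub, abs_mul, abs_of_nonneg ha, mul_assoc]
    exact mul_le_mul_of_nonneg_left (hG.lipschitz y z) ha

end Smoothing

/-! ### The lower bound for the value function -/

section LowerBound

variable {Ω : Type*} {mΩ : MeasurableSpace Ω} {n : ℕ} {P : Measure Ω}
  {W : ℝ≥0 → Ω → EuclideanSpace ℝ (Fin n)} {hW : IsStandardBrownian W P}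
  {b : ℝ≥0 → EuclideanSpace ℝ (Fin n)} {σ : ℝ≥0 → Matrix (Fin n) (Fin n) ℝ}
  {K : ProperCone ℝ (EuclideanSpace ℝ (Fin n))} {T t v : ℝ≥0} {U : ℝ → ℝ}

lemma UtilityAssumption.continuous_comp (hU : UtilityAssumption U) {α : Type*} [TopologicalSpace α]
    {f : α → ℝ} (hf : Continuous f) (h0 : ∀ y, 0 ≤ f y) : Continuous fun y => U (f y) :=
  hU.continuousOn.comp_continuous hf h0

/-- Replication of smooth payoffs: the hedge starts from the Gaussian expectation of the payoff and
ends at the payoff of the drifted Wiener integral. -/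
lemma lintegral_le_valueFunction_of_smoothPayoff [IsProbabilityMeasure P] [P.IsComplete]
    (hσ : ContinuousOn σ (Set.Icc 0 T)) (hσ_det : ∀ s ∈ Set.Icc 0 T, IsUnit (σ s).det)
    (hθ : ParabolicityAssumption b σ K T) (hU : UtilityAssumption U) (htT : t < T)
    (hv : v = clock (stoppedThetaHat b σ K T) T - clock (stoppedThetaHat b σ K T) t)
    {G G' : ℝ → ℝ} {C c : ℝ} (hG : SmoothPayoff G G' C) (hc0 : 0 < c) (hc : ∀ y, c ≤ G y)
    (hG' : ∀ y, 0 ≤ G' y) :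
    ∫⁻ u, ENNReal.ofReal (U (G (v + u))) ∂gaussianReal 0 v ≤
      valueFunction P (brownianFiltration P W hW.measurable) W b σ K U T t
        (∫ u, G u ∂gaussianReal 0 v) := by
  obtain ⟨B, hB⟩ := exists_isWienerIntegral hW hθ.continuous T
  obtain ⟨π, hπ⟩ := hB.isWealthProcess_hedgeValue hσ hσ_det hθ htT hG hc0 hc hG'
  rw [← hv] at hπ
  have hx : heat v G 0 = ∫ u, G u ∂gaussianReal 0 v := by simp [heat]
  rw [hx] at hπ
  refine le_trans (le_of_eq ?_) (le_iSup₂_of_le π _ (le_iSup_of_le hπ le_rfl))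
  have hm : Measurable fun u => ENNReal.ofReal (U (G (v + u))) :=
    ENNReal.measurable_ofReal.comp (hU.continuous_comp (f := fun u => G (v + u))
      (hG.continuous.comp (by fun_prop)) fun y => hc0.le.trans (hc _)).measurable
  rw [hv] at hm ⊢
  rw [← hB.map_increment hθ.continuous htT.le le_rfl, lintegral_map hm
    ((hB.future t T htT.le le_rfl).mono (futureSigma_le hW t) le_rfl)]
  refine lintegral_congr fun ω => ?_
  rw [hedgeValue, tsub_self, heat_zero, driftedWiener,
    NNReal.coe_sub (clock_mono hθ.continuous htT.le), add_comm]

/-- Every nonnegative nondecreasing payoff of the drifted Wiener integral can be replicated, up to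
approximation, from its Gaussian expectation. -/
theorem lintegral_le_valueFunction_of_monotone [IsProbabilityMeasure P] [P.IsComplete]
    (hσ : ContinuousOn σ (Set.Icc 0 T)) (hσ_det : ∀ s ∈ Set.Icc 0 T, IsUnit (σ s).det)
    (hθ : ParabolicityAssumption b σ K T) (hU : UtilityAssumption U) (htT : t < T)
    (hv : v = clock (stoppedThetaHat b σ K T) T - clock (stoppedThetaHat b σ K T) t)
    {ξ : ℝ → ℝ} (hξm : Monotone ξ) (hξc : Continuous ξ) (hξ0 : ∀ y, 0 ≤ ξ y)
    (hξi : Integrable ξ (gaussianReal 0 v)) (hpos : 0 < ∫ u, ξ u ∂gaussianReal 0 v) :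
    ∫⁻ u, ENNReal.ofReal (U (ξ (v + u))) ∂gaussianReal 0 v ≤
      valueFunction P (brownianFiltration P W hW.measurable) W b σ K U T t
        (∫ u, ξ u ∂gaussianReal 0 v) := by
  set x := ∫ u, ξ u ∂gaussianReal 0 v with hx
  -- truncate above at level `k + 1`, shift up by `1 / (k + 1)`, and smooth at scale `1 / (k + 1)`
  set h : ℕ → ℝ := fun k => 1 / ((k : ℝ) + 1) with hh
  have hh0 : ∀ k, 0 < h k := fun k => by positivity
  have hhlim : Tendsto h atTop (𝓝 0) := tendsto_one_div_add_atTop_nhds_zero_nat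
  set m : ℕ → ℝ → ℝ := fun k y => min (ξ y) (k + 1) + h k with hm
  have hmm : ∀ k, Monotone (m k) := fun k y z hyz => by
    simp only [hm]
    gcongr
    exact hξm hyz
  have hmc : ∀ k, Continuous (m k) := fun k => by fun_prop
  have hmpos : ∀ k y, h k ≤ m k y := fun k y => by
    have : 0 ≤ min (ξ y) (k + 1 : ℝ) := le_min (hξ0 y) (by positivity)
    simp only [hm]
    linarith
  have hmk : ∀ k y, m k y ≤ k + 1 + h k := fun k y => by
    simp only [hm]
    gcongr
    exact min_le_right _ _
  set A : ℕ → ℝ → ℝ := fun k => leftAverage (h k) (m k) with hA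
  have hAm : ∀ k, Monotone (A k) := fun k => monotone_leftAverage (hh0 k) (hmm k) (hmc k)
  have hAc : ∀ k, Continuous (A k) := fun k => continuous_leftAverage (hmc k)
  set G : ℕ → ℝ → ℝ := fun k => leftAverage (h k) (A k) with hGdef
  have hG : ∀ k, SmoothPayoff (G k) _ _ := fun k =>
    smoothPayoff_leftAverage (hh0 k) (hmm k) (hmc k) (fun y => (hh0 k).le.trans (hmpos k y)) (hmk k)
  have hGle : ∀ k y, G k y ≤ m k y := fun k y =>
    (leftAverage_le (hh0 k) (hAm k) (hAc k) y).trans (leftAverage_le (hh0 k) (hmm k) (hmc k) y)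
  have hleG : ∀ k y, m k (y - h k - h k) ≤ G k y := fun k y =>
    (le_leftAverage (hh0 k) (hmm k) (hmc k) _).trans (le_leftAverage (hh0 k) (hAm k) (hAc k) y)
  have hGpos : ∀ k y, h k ≤ G k y := fun k y => (hmpos k _).trans (hleG k y)
  have hGlim : ∀ y, Tendsto (fun k => G k y) atTop (𝓝 (ξ y)) := by
    intro y
    have hm_ev : ∀ z, ∀ᶠ k : ℕ in atTop, ∀ z' ≤ z, m k z' = ξ z' + h k := fun z => by
      filter_upwards [tendsto_natCast_atTop_atTop.eventually_ge_atTop (ξ z)] with k hk z' hz'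
      simp only [hm]
      rw [min_eq_left]
      linarith [hξm hz']
    have hl : Tendsto (fun k => ξ (y - h k - h k) + h k) atTop (𝓝 (ξ y)) := by
      have h1 : Continuous fun a : ℝ => ξ (y - a - a) + a := by fun_prop
      simpa [Function.comp_def] using (h1.tendsto 0).comp hhlim
    have hu : Tendsto (fun k => ξ y + h k) atTop (𝓝 (ξ y)) := by simpa using hhlim.const_add (ξ y)
    refine tendsto_of_tendsto_of_tendsto_of_le_of_le' hl hu ?_ ?_
    · filter_upwards [hm_ev y] with k hk
      rw [← hk _ (by linarith [hh0 k])]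
      exact hleG k y
    · filter_upwards [hm_ev y] with k hk
      rw [← hk _ le_rfl]
      exact hGle k y
  set a : ℕ → ℝ := fun k => ∫ u, G k u ∂gaussianReal 0 v with ha
  have hapos : ∀ k, 0 < a k := fun k => by
    have h1 := integral_mono (μ := gaussianReal 0 v) (integrable_const (h k))
      (integrable_of_bdd_continuous (hG k).continuous (hG k).bound) (hGpos k)
    simp only [integral_const, probReal_univ, one_smul] at h1
    exact (hh0 k).trans_le h1
  have halim : Tendsto a atTop (𝓝 x) := by
    refine tendsto_integral_of_dominated_convergence (fun u => ξ u + 1)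
      (fun k => (hG k).continuous.aestronglyMeasurable) (hξi.add (integrable_const 1))
      (fun k => ae_of_all _ fun u => ?_) (ae_of_all _ hGlim)
    rw [Real.norm_of_nonneg ((hh0 k).le.trans (hGpos k u))]
    refine (hGle k u).trans (add_le_add (min_le_left _ _) ?_)
    simp only [hh]
    rw [div_le_one (by positivity)]
    linarith [(Nat.cast_nonneg k : (0 : ℝ) ≤ k)]
  -- rescaling the approximating payoff by `x / a k` makes its replication cost exactly `x`
  have hstep : ∀ k, ∫⁻ u, ENNReal.ofReal (U (x / a k * G k (v + u))) ∂gaussianReal 0 v ≤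
      valueFunction P (brownianFiltration P W hW.measurable) W b σ K U T t x := by
    intro k
    have hxa : 0 < x / a k := div_pos hpos (hapos k)
    have := lintegral_le_valueFunction_of_smoothPayoff (hW := hW) hσ hσ_det hθ hU htT hv
      ((hG k).const_mul hxa.le) (mul_pos hxa (hh0 k))
      (fun y => mul_le_mul_of_nonneg_left (hGpos k y) hxa.le)
      (fun y => mul_nonneg hxa.le (mul_nonneg (inv_nonneg.2 (hh0 k).le)
        (sub_nonneg.2 (hAm k (by linarith [hh0 k])))))
    rwa [integral_const_mul, div_mul_cancel₀ _ (hapos k).ne'] at this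
  have hUlim : ∀ u, Tendsto (fun k => ENNReal.ofReal (U (x / a k * G k (v + u)))) atTop
      (𝓝 (ENNReal.ofReal (U (ξ (v + u))))) := by
    intro u
    refine (ENNReal.continuous_ofReal.tendsto _).comp ?_
    have h1 : Tendsto (fun k => x / a k * G k (v + u)) atTop (𝓝 (ξ (v + u))) := by
      have := (tendsto_const_nhds (x := x)).div halim hpos.ne' |>.mul (hGlim (v + u))
      rwa [div_self hpos.ne', one_mul] at this
    refine (hU.continuousOn (ξ (v + u)) (hξ0 _)).tendsto.comp
      (tendsto_nhdsWithin_of_tendsto_nhds_of_eventually_within _ h1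
        (Eventually.of_forall fun k => ?_))
    exact mul_nonneg (div_nonneg hpos.le (hapos k).le) ((hh0 k).le.trans (hGpos k _))
  -- Fatou's lemma
  calc ∫⁻ u, ENNReal.ofReal (U (ξ (v + u))) ∂gaussianReal 0 v
      = ∫⁻ u, liminf (fun k => ENNReal.ofReal (U (x / a k * G k (v + u)))) atTop
          ∂gaussianReal 0 v := lintegral_congr fun u => ((hUlim u).liminf_eq).symm
    _ ≤ liminf (fun k => ∫⁻ u, ENNReal.ofReal (U (x / a k * G k (v + u))) ∂gaussianReal 0 v)
          atTop := lintegral_liminf_le fun k => ENNReal.measurable_ofReal.comp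
            (hU.continuous_comp (continuous_const.mul ((hG k).continuous.comp (by fun_prop)))
              fun y => mul_nonneg (div_nonneg hpos.le (hapos k).le)
                ((hh0 k).le.trans (hGpos k _))).measurable
    _ ≤ _ := by
      refine (liminf_le_liminf (Eventually.of_forall hstep)).trans ?_
      rw [liminf_const]

end LowerBound


/-! ### Change of measure on a partition -/

section Girsanov

variable {Ω : Type*} {mΩ : MeasurableSpace Ω} {n : ℕ} {P : Measure Ω}
  {W : ℝ≥0 → Ω → EuclideanSpace ℝ (Fin n)}

/-- The Girsanov density of a constant drift `-d` over `[a, b]`. -/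
noncomputable def stepWeight (W : ℝ≥0 → Ω → EuclideanSpace ℝ (Fin n))
    (d : EuclideanSpace ℝ (Fin n)) (a b : ℝ≥0) (ω : Ω) : ℝ :=
  Real.exp (-⟪d, W b ω - W a ω⟫ - ‖d‖ ^ 2 * (b - a) / 2)

lemma stepWeight_pos (d : EuclideanSpace ℝ (Fin n)) (a b : ℝ≥0) (ω : Ω) :
    0 < stepWeight W d a b ω := Real.exp_pos _

lemma measurable_stepWeight_past (hW : ∀ s, Measurable (W s)) (d : EuclideanSpace ℝ (Fin n))
    {a b : ℝ≥0} (hab : a ≤ b) : Measurable[brownianFiltration P W hW b] (stepWeight W d a b) :=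
  (by fun_prop : Measurable fun v : EuclideanSpace ℝ (Fin n) =>
    Real.exp (-⟪d, v⟫ - ‖d‖ ^ 2 * (b - a) / 2)).comp
    ((measurable_past hW le_rfl).sub (measurable_past hW hab))

lemma measurable_stepWeight_future (d : EuclideanSpace ℝ (Fin n)) {c a b : ℝ≥0} (hca : c ≤ a)
    (hcb : c ≤ b) : Measurable[futureSigma P W c] (stepWeight W d a b) :=
  (by fun_prop : Measurable fun v : EuclideanSpace ℝ (Fin n) =>
    Real.exp (-⟪d, v⟫ - ‖d‖ ^ 2 * (b - a) / 2)).comp (measurable_future hca hcb)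

/-- The density of a constant drift has total mass one. -/
lemma IsStandardBrownian.integrable_stepWeight (hW : IsStandardBrownian W P)
    (d : EuclideanSpace ℝ (Fin n)) {a b : ℝ≥0} (hab : a ≤ b) :
    Integrable (stepWeight W d a b) P ∧ ∫ ω, stepWeight W d a b ω ∂P = 1 := by
  have hm : Measurable fun ω => ⟪d, W b ω - W a ω⟫ :=
    (by fun_prop : Measurable fun v : EuclideanSpace ℝ (Fin n) => ⟪d, v⟫).comp
      ((hW.measurable b).sub (hW.measurable a))
  have hlaw := hW.map_inner_increment hab d
  set w : ℝ≥0 := ‖d‖₊ ^ 2 * (b - a) with hw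
  have hwr : (w : ℝ) = ‖d‖ ^ 2 * (b - a) := by
    rw [hw]
    push_cast [NNReal.coe_sub hab]
    rfl
  have e : stepWeight W d a b =
      (fun x => Real.exp (-1 * x - (-1 * 0 + (-1) ^ 2 * w / 2)) * 1) ∘
        fun ω => ⟪d, W b ω - W a ω⟫ := by
    ext ω
    simp only [stepWeight, Function.comp, hwr]
    ring_nf
  constructor
  · rw [e, ← integrable_map_measure (by fun_prop) hm.aemeasurable, hlaw]
    exact (integrable_exp_mul_gaussianReal_iff 0 (-1) w fun _ => 1).2 (integrable_const _)
  · rw [e]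
    simp only [Function.comp]
    rw [← integral_map (φ := fun ω => ⟪d, W b ω - W a ω⟫) (f := fun x =>
      Real.exp (-1 * x - (-1 * 0 + (-1) ^ 2 * w / 2)) * 1) hm.aemeasurable (by fun_prop), hlaw,
      integral_exp_mul_gaussianReal]
    simp

/-- Under the change of measure a coordinate increment becomes centred Gaussian after adding the
drift. -/
lemma IsStandardBrownian.integrable_stepWeight_mul (hW : IsStandardBrownian W P)
    (d : EuclideanSpace ℝ (Fin n)) {a b : ℝ≥0} (hab : a ≤ b) (c : Fin n) {f : ℝ → ℝ}
    (hf : Measurable f) (hfi : Integrable f (gaussianReal 0 (b - a))) :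
    Integrable (fun ω => stepWeight W d a b ω * f (W b ω c - W a ω c + d c * (b - a))) P ∧
      ∫ ω, stepWeight W d a b ω * f (W b ω c - W a ω c + d c * (b - a)) ∂P =
        ∫ x, f x ∂gaussianReal 0 (b - a) := by
  set Δ : ℝ≥0 := b - a with hΔ
  have hΔr : (Δ : ℝ) = b - a := NNReal.coe_sub hab
  -- split the drift into its `c`-th coordinate, handled by exponential tilting, and the others,
  -- whose weight is independent of the `c`-th increment and integrates to `1`
  set d' : EuclideanSpace ℝ (Fin n) := d - EuclideanSpace.single c (d c) with hd'
  have hmc : ∀ j, Measurable fun ω => W b ω j - W a ω j := fun j =>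
    (hW.measurable_coord b j).sub (hW.measurable_coord a j)
  have hsplit : ∀ v : EuclideanSpace ℝ (Fin n), ⟪d, v⟫ = d c * v c + ⟪d', v⟫ := fun v => by
    rw [hd', inner_sub_left, EuclideanSpace.inner_single_left]
    simp
  have hnorm : ‖d‖ ^ 2 = d c ^ 2 + ‖d'‖ ^ 2 := by
    have h1 := hsplit d
    have h2 := hsplit d'
    have h3 : d' c = 0 := by simp [hd']
    rw [real_inner_self_eq_norm_sq] at h1
    rw [real_inner_self_eq_norm_sq, h3, real_inner_comm] at h2
    linarith
  set F : ℝ → ℝ := fun x => Real.exp (-d c * x - (-d c * 0 + (-d c) ^ 2 * Δ / 2)) *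
    f (x + d c * Δ) with hF
  have hFm : Measurable F := by fun_prop
  have e : ∀ ω, stepWeight W d a b ω * f (W b ω c - W a ω c + d c * (b - a)) =
      stepWeight W d' a b ω * F (W b ω c - W a ω c) := fun ω => by
    simp only [hF, stepWeight]
    rw [← mul_assoc, ← Real.exp_add, hsplit, hnorm, hΔr]
    congr 2
    simp only [PiLp.sub_apply]
    ring
  have hind : IndepFun (stepWeight W d' a b) (fun ω => F (W b ω c - W a ω c)) P := by
    have h1 := (hW.iIndepFun_increment a b).indepFun_finset (Finset.univ.erase c) {c}
      (by simp) hmc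
    have h2 := h1.comp (φ := fun v : ({j // j ∈ Finset.univ.erase c}) → ℝ =>
        Real.exp (-(∑ j : {j // j ∈ Finset.univ.erase c}, d' j * v j) -
        ‖d'‖ ^ 2 * (b - a) / 2)) (ψ := fun v : {j // j ∈ ({c} : Finset (Fin n))} → ℝ =>
          F (v ⟨c, Finset.mem_singleton_self c⟩)) (by fun_prop) (hFm.comp (measurable_pi_apply _))
    refine h2.congr (ae_of_all _ fun ω => ?_) (ae_of_all _ fun ω => rfl)
    simp only [Function.comp, stepWeight]
    congr 3
    rw [Finset.sum_coe_sort (Finset.univ.erase c) fun j => d' j * (W b ω j - W a ω j),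
      Finset.sum_erase _ (by simp [hd']), PiLp.inner_apply]
    refine Finset.sum_congr rfl fun j _ => ?_
    simp [mul_comm]
  obtain ⟨hi1, hint1⟩ := hW.integrable_stepWeight d' hab
  have hlaw := hW.map_increment_coord hab c
  have hshift : (gaussianReal (0 + -d c * Δ) Δ).map (fun x => x + d c * Δ) = gaussianReal 0 Δ := by
    rw [gaussianReal_map_add_const]
    congr 1
    ring
  have hFi : Integrable F (gaussianReal 0 Δ) := by
    rw [hF, integrable_exp_mul_gaussianReal_iff 0 (-d c) Δ fun x => f (x + d c * Δ)]
    rw [← hshift] at hfi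
    exact (integrable_map_measure hf.aestronglyMeasurable (by fun_prop)).1 hfi
  have hFint : ∫ x, F x ∂gaussianReal 0 Δ = ∫ x, f x ∂gaussianReal 0 Δ := by
    rw [hF, integral_exp_mul_gaussianReal 0 (-d c) Δ fun x => f (x + d c * Δ)]
    conv_rhs => rw [← hshift]
    rw [integral_map (by fun_prop) hf.aestronglyMeasurable]
  have hi2 : Integrable (fun ω => F (W b ω c - W a ω c)) P := by
    rw [← hlaw] at hFi
    exact (integrable_map_measure hFm.aestronglyMeasurable (hmc c).aemeasurable).1 hFi
  simp_rw [e]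
  refine ⟨hind.integrable_mul hi1 hi2, ?_⟩
  rw [hind.integral_fun_mul_eq_mul_integral hi1.aestronglyMeasurable hi2.aestronglyMeasurable,
    hint1, one_mul, ← hFint, ← hlaw, integral_map (hmc c).aemeasurable hFm.aestronglyMeasurable]

/-- The Girsanov density of the step function drift `-d` over the steps `i, …, j - 1`. -/
noncomputable def partitionWeight (W : ℝ≥0 → Ω → EuclideanSpace ℝ (Fin n)) (s : ℕ → ℝ≥0)
    (d : ℕ → EuclideanSpace ℝ (Fin n)) (i j : ℕ) (ω : Ω) : ℝ :=
  ∏ l ∈ Finset.Ico i j, stepWeight W (d l) (s l) (s (l + 1)) ω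

variable {s : ℕ → ℝ≥0} {d : ℕ → EuclideanSpace ℝ (Fin n)}

lemma partitionWeight_pos (i j : ℕ) (ω : Ω) : 0 < partitionWeight W s d i j ω :=
  Finset.prod_pos fun _ _ => stepWeight_pos _ _ _ _

lemma measurable_partitionWeight_past (hW : ∀ s, Measurable (W s)) (hs : Monotone s) (i j : ℕ) :
    Measurable[brownianFiltration P W hW (s j)] (partitionWeight W s d i j) :=
  @Finset.measurable_fun_prod _ _ _ _ _ _ (brownianFiltration P W hW (s j)) _ _ fun l hl =>
    (measurable_stepWeight_past hW (d l) (hs l.le_succ)).mono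
      ((brownianFiltration P W hW).mono (hs (Finset.mem_Ico.1 hl).2)) le_rfl

lemma measurable_partitionWeight_future (hs : Monotone s) (i j : ℕ) :
    Measurable[futureSigma P W (s i)] (partitionWeight W s d i j) :=
  @Finset.measurable_fun_prod _ _ _ _ _ _ (futureSigma P W (s i)) _ _ fun l hl =>
    measurable_stepWeight_future (d l) (hs (Finset.mem_Ico.1 hl).1)
      (hs ((Finset.mem_Ico.1 hl).1.trans l.le_succ))

lemma IsStandardBrownian.integrable_partitionWeight [P.IsComplete] (hW : IsStandardBrownian W P)
    (hs : Monotone s) {i j : ℕ} (hij : i ≤ j) :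
    Integrable (partitionWeight W s d i j) P ∧ ∫ ω, partitionWeight W s d i j ω ∂P = 1 := by
  have := hW.isGaussianProcess.isProbabilityMeasure
  induction j, hij using Nat.le_induction with
  | base =>
    have e : partitionWeight W s d i i = fun _ => 1 := by
      ext ω
      simp [partitionWeight]
    rw [e]
    simp
  | succ j hij ih =>
    have e : partitionWeight W s d i (j + 1) = fun ω => partitionWeight W s d i j ω *
        stepWeight W (d j) (s j) (s (j + 1)) ω := by
      ext ω
      rw [partitionWeight, Finset.prod_Ico_succ_top hij, partitionWeight]
    have hm := measurable_partitionWeight_past (P := P) (d := d) hW.measurable hs i j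
    have hm' := measurable_stepWeight_future (P := P) (W := W) (d j) (le_refl (s j)) (hs j.le_succ)
    obtain ⟨h1, h2⟩ := hW.integrable_stepWeight (d j) (hs j.le_succ)
    rw [e]
    exact ⟨hW.integrable_past_mul_future hm hm' ih.1 h1, by
      rw [hW.integral_past_mul_future hm hm', ih.2, one_mul]
      exact h2⟩

/-- Factorization of a weighted expectation of a function of the past of step `i` times a function
of a coordinate of the `i`-th increment. -/
lemma IsStandardBrownian.integrable_partitionWeight_mul [P.IsComplete]
    (hW : IsStandardBrownian W P) (hs : Monotone s) {i N : ℕ} (hi : i < N) {φ : Ω → ℝ}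
    (hφ : Measurable[brownianFiltration P W hW.measurable (s i)] φ)
    (hφi : Integrable (fun ω => partitionWeight W s d 0 i ω * φ ω) P) (c : Fin n) {f : ℝ → ℝ}
    (hf : Measurable f) (hfi : Integrable f (gaussianReal 0 (s (i + 1) - s i))) :
    Integrable (fun ω => partitionWeight W s d 0 N ω *
      (φ ω * f (W (s (i + 1)) ω c - W (s i) ω c + d i c * (s (i + 1) - s i)))) P ∧
    ∫ ω, partitionWeight W s d 0 N ω *
      (φ ω * f (W (s (i + 1)) ω c - W (s i) ω c + d i c * (s (i + 1) - s i))) ∂P =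
      (∫ ω, partitionWeight W s d 0 i ω * φ ω ∂P) *
        ∫ x, f x ∂gaussianReal 0 (s (i + 1) - s i) := by
  set g : Ω → ℝ := fun ω => stepWeight W (d i) (s i) (s (i + 1)) ω *
    f (W (s (i + 1)) ω c - W (s i) ω c + d i c * (s (i + 1) - s i)) with hg
  obtain ⟨hgi, hgint⟩ := hW.integrable_stepWeight_mul (d i) (hs i.le_succ) c hf hfi
  obtain ⟨hRi, hRint⟩ := hW.integrable_partitionWeight (d := d) hs (Nat.succ_le_of_lt hi)
  -- the weight splits into the steps before, at and after `i`; the last part integrates to `1`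
  have hmid : ∀ ω, partitionWeight W s d 0 N ω = partitionWeight W s d 0 i ω *
      (stepWeight W (d i) (s i) (s (i + 1)) ω * partitionWeight W s d (i + 1) N ω) := fun ω => by
    simp only [partitionWeight]
    rw [← Finset.prod_Ico_consecutive _ (Nat.zero_le i) hi.le, Finset.prod_eq_prod_Ico_succ_bot hi]
  have e : ∀ ω, partitionWeight W s d 0 N ω *
      (φ ω * f (W (s (i + 1)) ω c - W (s i) ω c + d i c * (s (i + 1) - s i))) =
      (partitionWeight W s d 0 i ω * φ ω) * (g ω * partitionWeight W s d (i + 1) N ω) := fun ω => by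
    rw [hmid]
    simp only [hg]
    ring
  have hgp : Measurable[brownianFiltration P W hW.measurable (s (i + 1))] g :=
    (measurable_stepWeight_past hW.measurable _ (hs i.le_succ)).mul
      (hf.comp (((by fun_prop : Measurable fun v : EuclideanSpace ℝ (Fin n) => v c).comp
        (measurable_past hW.measurable le_rfl)).sub
        ((by fun_prop : Measurable fun v : EuclideanSpace ℝ (Fin n) => v c).comp
          (measurable_past hW.measurable (hs i.le_succ))) |>.add_const _))
  have hgf : Measurable[futureSigma P W (s i)] g :=
    (measurable_stepWeight_future _ le_rfl (hs i.le_succ)).mul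
      (hf.comp ((measurable_future_coord le_rfl (hs i.le_succ) c).add_const _))
  have hRf1 := measurable_partitionWeight_future (P := P) (W := W) (d := d) hs (i + 1) N
  have hRf : Measurable[futureSigma P W (s i)] (partitionWeight W s d (i + 1) N) :=
    @Finset.measurable_fun_prod _ _ _ _ _ _ (futureSigma P W (s i)) _ _ fun l hl =>
      measurable_stepWeight_future (d l) (hs (i.le_succ.trans (Finset.mem_Ico.1 hl).1))
        (hs (i.le_succ.trans ((Finset.mem_Ico.1 hl).1.trans l.le_succ)))
  have hpast := (measurable_partitionWeight_past (P := P) (d := d) hW.measurable hs 0 i).mul hφ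
  simp_rw [e]
  refine ⟨hW.integrable_past_mul_future hpast (hgf.mul hRf) hφi
    (hW.integrable_past_mul_future hgp hRf1 hgi hRi), ?_⟩
  have h1 := hW.integral_past_mul_future hpast (hgf.mul hRf)
  have h2 := hW.integral_past_mul_future hgp hRf1
  simp only [Pi.mul_apply] at h1
  rw [h1, h2, hRint, mul_one]
  congr 1

end Girsanov


/-! ### Drifted increments under the change of measure -/

section WeightedSums

variable {Ω : Type*} {mΩ : MeasurableSpace Ω} {n : ℕ} {P : Measure Ω}
  {W : ℝ≥0 → Ω → EuclideanSpace ℝ (Fin n)} {s : ℕ → ℝ≥0} {d : ℕ → EuclideanSpace ℝ (Fin n)}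

/-- The increment of `W` with drift `d` over the `i`-th step of a partition. -/
noncomputable def driftedIncrement (W : ℝ≥0 → Ω → EuclideanSpace ℝ (Fin n)) (s : ℕ → ℝ≥0)
    (d : ℕ → EuclideanSpace ℝ (Fin n)) (i : ℕ) (ω : Ω) : EuclideanSpace ℝ (Fin n) :=
  W (s (i + 1)) ω - W (s i) ω + ((s (i + 1) : ℝ) - s i) • d i

lemma driftedIncrement_apply (i : ℕ) (c : Fin n) (ω : Ω) : driftedIncrement W s d i ω c =
    W (s (i + 1)) ω c - W (s i) ω c + d i c * (s (i + 1) - s i) := by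
  simp [driftedIncrement, mul_comm]

lemma measurable_driftedIncrement (hW : ∀ s, Measurable (W s)) (hs : Monotone s) (i : ℕ) :
    Measurable[brownianFiltration P W hW (s (i + 1))] (driftedIncrement W s d i) :=
  ((measurable_past hW le_rfl).sub (measurable_past hW (hs i.le_succ))).add_const _

/-- Discrete stochastic integrals against the drifted increments are centred under the change of
measure. -/
lemma IsStandardBrownian.integral_partitionWeight_mul_sum [P.IsComplete]
    (hW : IsStandardBrownian W P) (hs : Monotone s) (N : ℕ) {ζ : ℕ → Ω → EuclideanSpace ℝ (Fin n)}
    (hζ : ∀ i, Measurable[brownianFiltration P W hW.measurable (s i)] (ζ i)) {C : ℝ}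
    (hC : ∀ i ω, ‖ζ i ω‖ ≤ C) :
    Integrable (fun ω => partitionWeight W s d 0 N ω *
      ∑ i ∈ Finset.range N, ⟪ζ i ω, driftedIncrement W s d i ω⟫) P ∧
    ∫ ω, partitionWeight W s d 0 N ω *
      ∑ i ∈ Finset.range N, ⟪ζ i ω, driftedIncrement W s d i ω⟫ ∂P = 0 := by
  have hmc : ∀ i c, Measurable[brownianFiltration P W hW.measurable (s i)] fun ω => ζ i ω c :=
    fun i c => (by fun_prop : Measurable fun v : EuclideanSpace ℝ (Fin n) => v c).comp (hζ i)
  have hterm : ∀ i ∈ Finset.range N, ∀ c, Integrable (fun ω => partitionWeight W s d 0 N ω *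
      (ζ i ω c * driftedIncrement W s d i ω c)) P ∧ ∫ ω, partitionWeight W s d 0 N ω *
      (ζ i ω c * driftedIncrement W s d i ω c) ∂P = 0 := by
    intro i hi c
    have h := hW.integrable_partitionWeight_mul (d := d) hs (Finset.mem_range.1 hi) (hmc i c)
      ((hW.integrable_partitionWeight hs (Nat.zero_le i)).1.mul_bdd (c := C)
        ((hmc i c).mono ((brownianFiltration P W hW.measurable).le _) le_rfl).aestronglyMeasurable
        (ae_of_all _ fun ω => (PiLp.norm_apply_le (ζ i ω) c).trans (hC i ω))) c measurable_id
      ((memLp_id_gaussianReal 1).integrable (by norm_num))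
    simp only [id, integral_id_gaussianReal, mul_zero] at h
    simpa only [driftedIncrement_apply] using h
  have e : ∀ ω, partitionWeight W s d 0 N ω *
      ∑ i ∈ Finset.range N, ⟪ζ i ω, driftedIncrement W s d i ω⟫ =
      ∑ i ∈ Finset.range N, ∑ c, partitionWeight W s d 0 N ω *
        (ζ i ω c * driftedIncrement W s d i ω c) := fun ω => by
    rw [Finset.mul_sum]
    refine Finset.sum_congr rfl fun i _ => ?_
    rw [PiLp.inner_apply, Finset.mul_sum]
    refine Finset.sum_congr rfl fun c _ => ?_
    simp [mul_comm]
  simp_rw [e]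
  refine ⟨integrable_finsetSum _ fun i hi => integrable_finsetSum _ fun c _ =>
    (hterm i hi c).1, ?_⟩
  rw [integral_finsetSum _ fun i hi => integrable_finsetSum _ fun c _ => (hterm i hi c).1]
  refine Finset.sum_eq_zero fun i hi => ?_
  rw [integral_finsetSum _ fun c _ => (hterm i hi c).1]
  exact Finset.sum_eq_zero fun c _ => (hterm i hi c).2

lemma norm_pow_four_le (v : EuclideanSpace ℝ (Fin n)) : ‖v‖ ^ 4 ≤ n * ∑ c, v c ^ 4 := by
  have h1 : ‖v‖ ^ 4 = (∑ c, v c ^ 2) ^ 2 := by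
    rw [← EuclideanSpace.real_norm_sq_eq, ← pow_mul]
  have h2 := sq_sum_le_card_mul_sum_sq (s := (Finset.univ : Finset (Fin n))) (f := fun c => v c ^ 2)
  rw [h1]
  refine h2.trans (le_of_eq ?_)
  simp only [Finset.card_univ, Fintype.card_fin, ← pow_mul]

/-- Under the change of measure the drifted increments have the fourth moments of centred Gaussian
increments; these control the overshoot of a stopped sum. -/
lemma IsStandardBrownian.integral_partitionWeight_mul_norm_pow_four_le [P.IsComplete]
    (hW : IsStandardBrownian W P) (hs : Monotone s) {i N : ℕ} (hi : i < N) :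
    Integrable (fun ω => partitionWeight W s d 0 N ω * ‖driftedIncrement W s d i ω‖ ^ 4) P ∧
    ∫ ω, partitionWeight W s d 0 N ω * ‖driftedIncrement W s d i ω‖ ^ 4 ∂P ≤
      n ^ 2 * (∫ u, u ^ 4 ∂gaussianReal 0 1) * (s (i + 1) - s i) ^ 2 := by
  have hterm : ∀ c, Integrable (fun ω => partitionWeight W s d 0 N ω *
      driftedIncrement W s d i ω c ^ 4) P ∧ ∫ ω, partitionWeight W s d 0 N ω *
      driftedIncrement W s d i ω c ^ 4 ∂P =
        (∫ u, u ^ 4 ∂gaussianReal 0 1) * (s (i + 1) - s i) ^ 2 := by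
    intro c
    obtain ⟨h1, h2⟩ := hW.integrable_partitionWeight (d := d) hs (Nat.zero_le i)
    have h := hW.integrable_partitionWeight_mul (d := d) hs hi (φ := fun _ => 1) measurable_const
      (by simpa using h1) c (f := fun x => x ^ 4) (by fun_prop) (integrable_pow_four_gaussianReal _)
    simp only [one_mul, mul_one, h2, ← driftedIncrement_apply] at h
    refine ⟨h.1, h.2.trans ?_⟩
    rw [integral_pow_four_gaussianReal, NNReal.coe_sub (hs i.le_succ), mul_comm]
  have hsum : Integrable (fun ω => (n : ℝ) * ∑ c, partitionWeight W s d 0 N ω *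
      driftedIncrement W s d i ω c ^ 4) P :=
    (integrable_finsetSum _ fun c _ => (hterm c).1).const_mul _
  have hle : ∀ ω, partitionWeight W s d 0 N ω * ‖driftedIncrement W s d i ω‖ ^ 4 ≤
      (n : ℝ) * ∑ c, partitionWeight W s d 0 N ω * driftedIncrement W s d i ω c ^ 4 := fun ω => by
    rw [← Finset.mul_sum, mul_left_comm]
    exact mul_le_mul_of_nonneg_left (norm_pow_four_le _) (partitionWeight_pos _ _ _).le
  have hint : Integrable (fun ω => partitionWeight W s d 0 N ω *
      ‖driftedIncrement W s d i ω‖ ^ 4) P := by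
    refine hsum.mono' (Measurable.aestronglyMeasurable ?_) (ae_of_all _ fun ω => ?_)
    · have h1 := (measurable_partitionWeight_past (P := P) (d := d) hW.measurable hs 0 N).mono
        ((brownianFiltration P W hW.measurable).le _) le_rfl
      have h2 := (measurable_driftedIncrement (P := P) (d := d) hW.measurable hs i).mono
        ((brownianFiltration P W hW.measurable).le _) le_rfl
      exact h1.mul (h2.norm.pow_const 4)
    · rw [Real.norm_of_nonneg (mul_nonneg (partitionWeight_pos _ _ _).le (by positivity))]
      exact hle ω
  refine ⟨hint, (integral_mono hint hsum hle).trans (le_of_eq ?_)⟩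
  rw [integral_const_mul, integral_finsetSum _ fun c _ => (hterm c).1,
    Finset.sum_congr rfl fun c _ => (hterm c).2, Finset.sum_const, Finset.card_univ,
    Fintype.card_fin, nsmul_eq_mul]
  ring

end WeightedSums

/-! ### Stopping a discrete sum -/

section Stopping

open Classical in
/-- The partial sums of the increments of `J`, stopped once `J` has fallen below `-L`. -/
noncomputable def stoppedSum (J : ℕ → ℝ) (L : ℝ) (N : ℕ) : ℝ :=
  ∑ i ∈ Finset.range N, if ∀ l ≤ i, -L ≤ J l then J (i + 1) - J i else 0

variable {J : ℕ → ℝ} {L : ℝ} {N : ℕ}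

lemma stoppedSum_eq (h0 : J 0 = 0) (h : ∀ l < N, -L ≤ J l) : stoppedSum J L N = J N := by
  rw [← sub_zero (J N), ← h0, ← Finset.sum_range_sub]
  exact Finset.sum_congr rfl fun i hi => if_pos fun l hl =>
    h l (hl.trans_lt (Finset.mem_range.1 hi))

/-- The stopped sum undershoots the barrier by at most the size of one increment. -/
lemma neg_sub_le_stoppedSum (h0 : J 0 = 0) (hL : 0 ≤ L) {o : ℝ} (ho0 : 0 ≤ o)
    (ho : ∀ i < N, |J (i + 1) - J i| ≤ o) : -L - o ≤ stoppedSum J L N := by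
  induction N with
  | zero =>
    simp only [stoppedSum, Finset.range_zero, Finset.sum_empty]
    linarith
  | succ N ih =>
    by_cases h : ∀ l ≤ N, -L ≤ J l
    · rw [stoppedSum_eq h0 fun l hl => h l (Nat.lt_succ_iff.1 hl)]
      have h1 := (abs_le.1 (ho N N.lt_succ_self)).1
      have h2 := h N le_rfl
      linarith
    · have e : stoppedSum J L (N + 1) = stoppedSum J L N := by
        rw [stoppedSum, Finset.sum_range_succ, if_neg h, add_zero, stoppedSum]
      rw [e]
      exact ih fun i hi => ho i (hi.trans N.lt_succ_self)

end Stopping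

/-! ### Pathwise estimates for the drift of wealth -/

section Paths

variable {Ω : Type*} {mΩ : MeasurableSpace Ω} {n : ℕ} {P : Measure Ω} {𝓕 : Filtration ℝ≥0 mΩ}
  {W : ℝ≥0 → Ω → EuclideanSpace ℝ (Fin n)} {θ : ℝ≥0 → EuclideanSpace ℝ (Fin n)}

/-- The drift of a simple process is piecewise continuous. -/
lemma SimpleProcess.intervalIntegrable_inner_val (H : SimpleProcess 𝓕 n) (hθ : Continuous θ)
    (ω : Ω) (a b : ℝ) :
    IntervalIntegrable (fun r : ℝ => ⟪H.val r.toNNReal ω, θ r.toNNReal⟫) volume a b := by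
  have e : (fun r : ℝ => ⟪H.val r.toNNReal ω, θ r.toNNReal⟫) = fun r : ℝ =>
      ∑ i ∈ Finset.range H.N, (Real.toNNReal ⁻¹' Set.Ioc (H.τ i) (H.τ (i + 1))).indicator
        (fun r => ⟪H.ξ i ω, θ r.toNNReal⟫) r := by
    ext r
    rw [SimpleProcess.val, sum_inner]
    refine Finset.sum_congr rfl fun i _ => ?_
    by_cases h : r.toNNReal ∈ Set.Ioc (H.τ i) (H.τ (i + 1))
    · rw [Set.indicator_of_mem h, Set.indicator_of_mem (by exact h)]
    · rw [Set.indicator_of_notMem h, Set.indicator_of_notMem (by exact h), inner_zero_left]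
  rw [e]
  have hc : ∀ i, Continuous fun r : ℝ => ⟪H.ξ i ω, θ r.toNNReal⟫ := fun i =>
    continuous_const.inner (hθ.comp continuous_real_toNNReal)
  have hm : ∀ i, MeasurableSet (Real.toNNReal ⁻¹' Set.Ioc (H.τ i) (H.τ (i + 1))) := fun i =>
    measurable_real_toNNReal measurableSet_Ioc
  have hi : ∀ i, IntervalIntegrable ((Real.toNNReal ⁻¹' Set.Ioc (H.τ i) (H.τ (i + 1))).indicator
      fun r : ℝ => ⟪H.ξ i ω, θ r.toNNReal⟫) volume a b := fun i =>
    ⟨((hc i).intervalIntegrable a b).1.indicator (hm i),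
      ((hc i).intervalIntegrable a b).2.indicator (hm i)⟩
  have h := IntervalIntegrable.sum (Finset.range H.N) fun i _ => hi i
  rwa [Finset.sum_fn] at h

/-- Riemann sums for the drift of a simple process. -/
lemma SimpleProcess.integral_inner_val_le (H : SimpleProcess 𝓕 n) (hθ : Continuous θ)
    {s : ℕ → ℝ≥0} (hs : Monotone s) (h : ∀ i, H.JumpFree (s i) (s (i + 1))) (ω : Ω) {C ρ : ℝ}
    (hC : ‖C‖ = C) (hCH : ∀ r, ‖H.val r ω‖ ≤ C) (N : ℕ)
    (hρ : ∀ i < N, ∀ r ∈ Set.Icc (s i) (s (i + 1)), ‖θ (s i) - θ r‖ ≤ ρ) :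
    ∫ r in (s 0 : ℝ)..s N, ⟪H.val r.toNNReal ω, θ r.toNNReal⟫ ≤
      ∑ i ∈ Finset.range N, ⟪H.val (s (i + 1)) ω, θ (s i)⟫ * (s (i + 1) - s i) +
        C * ρ * (s N - s 0) := by
  have := abs_riemann_sum_sub_integral_le (s := fun i => (s i : ℝ)) (η := C * ρ)
    (fun i j hij => NNReal.coe_le_coe.2 (hs hij)) (H.intervalIntegrable_inner_val hθ ω)
    (fun i => ⟪H.val (s (i + 1)) ω, θ (s i)⟫) N fun i hi r hr => by
      have hr' : r.toNNReal ∈ Set.Ioc (s i) (s (i + 1)) :=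
        ⟨Real.lt_toNNReal_iff_coe_lt.2 hr.1, Real.toNNReal_le_iff_le_coe.2 hr.2⟩
      rw [H.val_eq hr' (h i), ← inner_sub_right]
      refine (abs_real_inner_le_norm _ _).trans (mul_le_mul (hCH _) (hρ i hi _ ⟨hr'.1.le, hr'.2⟩)
        (norm_nonneg _) (hC ▸ norm_nonneg _))
  have := (abs_le.1 this).1
  linarith

/-- The pathwise comparison of the drift of wealth with the drift of an approximating simple
process. No measurability of the integrand of the Itô integral is needed, since only upper bounds
for Lebesgue integrals are used. -/
lemma integral_le_of_approx {t s T : ℝ≥0} (hts : t ≤ s) (hsT : s ≤ T) {f g : ℝ → ℝ}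
    {D : ℝ → EuclideanSpace ℝ (Fin n)} {M e : ℝ} (hM : 0 ≤ M) (he : 0 < e)
    (hf : IntervalIntegrable f volume t s) (hg : IntervalIntegrable g volume t s)
    (hfg : ∀ᵐ r ∂volume.restrict (Set.Icc (t : ℝ) T), f r ≤ g r + M * ‖D r‖)
    (hD : ∫⁻ r in Set.Icc (t : ℝ) T, ‖D r‖ₑ ^ 2 ≤ ENNReal.ofReal (e ^ 2)) :
    ∫ r in (t : ℝ)..s, f r ≤ (∫ r in (t : ℝ)..s, g r) + M * e * (T + 1) / 2 := by
  have hts' : (t : ℝ) ≤ s := NNReal.coe_le_coe.2 hts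
  have hsT' : (s : ℝ) ≤ T := NNReal.coe_le_coe.2 hsT
  have hsub : Set.Ioc (t : ℝ) s ⊆ Set.Icc (t : ℝ) T := fun r hr => ⟨hr.1.le, hr.2.trans hsT'⟩
  rw [← sub_le_iff_le_add', ← intervalIntegral.integral_sub hf hg,
    intervalIntegral.integral_of_le hts']
  have hfgi : Integrable (fun r => f r - g r) (volume.restrict (Set.Ioc (t : ℝ) s)) := (hf.sub hg).1
  -- only the positive part of `f - g` has to be bounded
  rw [integral_eq_lintegral_pos_part_sub_lintegral_neg_part hfgi]
  have key : ∫⁻ r in Set.Ioc (t : ℝ) s, ENNReal.ofReal (f r - g r) ≤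
      ENNReal.ofReal (M * e * (T + 1) / 2) := by
    calc ∫⁻ r in Set.Ioc (t : ℝ) s, ENNReal.ofReal (f r - g r)
        ≤ ∫⁻ r in Set.Ioc (t : ℝ) s, (ENNReal.ofReal (M * e / 2) +
            ENNReal.ofReal (M / (2 * e)) * ‖D r‖ₑ ^ 2) := by
          refine lintegral_mono_ae ?_
          filter_upwards [ae_restrict_of_ae_restrict_of_subset hsub hfg] with r hr
          rw [← ofReal_norm, ← ENNReal.ofReal_pow (norm_nonneg _),
            ← ENNReal.ofReal_mul (by positivity), ← ENNReal.ofReal_add (by positivity)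
            (by positivity)]
          refine ENNReal.ofReal_le_ofReal (le_trans (sub_le_iff_le_add'.2 hr) ?_)
          -- Young's inequality `M ‖D‖ ≤ M e / 2 + M ‖D‖² / (2 e)` replaces Cauchy–Schwarz
          have h1 : M * e / 2 + M / (2 * e) * ‖D r‖ ^ 2 - M * ‖D r‖ =
              M / (2 * e) * (e - ‖D r‖) ^ 2 := by
            field_simp
            ring
          have h2 : 0 ≤ M / (2 * e) * (e - ‖D r‖) ^ 2 := by positivity
          linarith
      _ ≤ ENNReal.ofReal (M * e / 2) * ENNReal.ofReal (s - t) +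
            ENNReal.ofReal (M / (2 * e)) * ENNReal.ofReal (e ^ 2) := by
          rw [lintegral_add_left measurable_const, setLIntegral_const, Real.volume_Ioc,
            lintegral_const_mul' _ _ ENNReal.ofReal_ne_top]
          gcongr
          exact (lintegral_mono_set hsub).trans hD
      _ = ENNReal.ofReal (M * e / 2 * (s - t) + M / (2 * e) * e ^ 2) := by
          rw [← ENNReal.ofReal_mul (by positivity), ← ENNReal.ofReal_mul (by positivity),
            ← ENNReal.ofReal_add (mul_nonneg (by positivity) (by linarith)) (by positivity)]
      _ ≤ _ := by
          refine ENNReal.ofReal_le_ofReal ?_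
          have h1 : M / (2 * e) * e ^ 2 = M * e / 2 := by
            field_simp
          have h2 : M * e / 2 * (s - t) ≤ M * e / 2 * T := by
            have : (0 : ℝ) ≤ t := t.2
            gcongr
            linarith
          rw [h1]
          linarith
  have h1 := ENNReal.toReal_mono ENNReal.ofReal_ne_top key
  rw [ENNReal.toReal_ofReal (by positivity)] at h1
  have h2 : 0 ≤ (∫⁻ r in Set.Ioc (t : ℝ) s, ENNReal.ofReal (-(f r - g r))).toReal :=
    ENNReal.toReal_nonneg
  linarith

/-- A progressive portfolio which takes values in the cone almost surely at each time does so
almost surely at almost every time. -/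
lemma ae_ae_mem_cone [SFinite P] {K : ProperCone ℝ (EuclideanSpace ℝ (Fin n))} {t T : ℝ≥0}
    {π : ℝ≥0 → Ω → EuclideanSpace ℝ (Fin n)} (hπ : IsProgressive 𝓕 π)
    (hK : ∀ s ∈ Set.Icc t T, ∀ᵐ ω ∂P, π s ω ∈ K) :
    ∀ᵐ ω ∂P, ∀ᵐ r ∂volume.restrict (Set.Icc (t : ℝ) T), π r.toNNReal ω ∈ K := by
  have hm : Measurable fun p : Ω × ℝ => π (min p.2.toNNReal T) p.1 := by
    have h1 : Measurable fun p : Set.Iic T × Ω => π p.1 p.2 :=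
      (hπ T).mono (sup_le_sup_left (MeasurableSpace.comap_mono (𝓕.le T)) _) le_rfl
    exact h1.comp (Measurable.prodMk (Measurable.subtype_mk (h := fun p : Ω × ℝ =>
      (min_le_right p.2.toNNReal T : _ ∈ Set.Iic T)) (by fun_prop)) measurable_fst)
  have hset : MeasurableSet {p : Ω × ℝ | π (min p.2.toNNReal T) p.1 ∈ K} :=
    hm K.isClosed.measurableSet
  have hmem : ∀ r ∈ Set.Icc (t : ℝ) T, r.toNNReal ∈ Set.Icc t T := fun r hr =>
    ⟨NNReal.le_toNNReal_of_coe_le hr.1, Real.toNNReal_le_iff_le_coe.2 hr.2⟩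
  have h := (Measure.ae_ae_comm (μ := P) (ν := volume.restrict (Set.Icc (t : ℝ) T))
    (p := fun ω r => π (min r.toNNReal T) ω ∈ K) hset).2 (by
    filter_upwards [ae_restrict_mem measurableSet_Icc] with r hr
    rw [min_eq_left (hmem r hr).2]
    exact hK _ (hmem r hr))
  filter_upwards [h] with ω hω
  filter_upwards [hω, ae_restrict_mem measurableSet_Icc] with r hr hrI
  rwa [min_eq_left (hmem r hrI).2] at hr

end Paths


/-! ### The upper bound for the value function -/

section UpperBound

variable {Ω : Type*} {mΩ : MeasurableSpace Ω} {n : ℕ} {P : Measure Ω}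
  {W : ℝ≥0 → Ω → EuclideanSpace ℝ (Fin n)} {hW : IsStandardBrownian W P}
  {b : ℝ≥0 → EuclideanSpace ℝ (Fin n)} {σ : ℝ≥0 → Matrix (Fin n) (Fin n) ℝ}
  {K : ProperCone ℝ (EuclideanSpace ℝ (Fin n))} {T t : ℝ≥0} {U : ℝ → ℝ} {x : ℝ}
  {π : ℝ≥0 → Ω → EuclideanSpace ℝ (Fin n)} {X : ℝ≥0 → Ω → ℝ}

/-- Outside an event of small probability, wealth is dominated by the stochastic integral of a
simple process with respect to the Brownian motion with drift `θ̂`. -/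
lemma IsWealthProcess.exists_simple_approx [IsProbabilityMeasure P] {𝓕 : Filtration ℝ≥0 mΩ}
    (h : IsWealthProcess P 𝓕 W b σ K T t x π X)
    (hσ_det : ∀ s ∈ Set.Icc 0 T, IsUnit (σ s).det) (hθ : ParabolicityAssumption b σ K T)
    {ε : ℝ} (hε : 0 < ε) :
    ∃ (H : SimpleProcess 𝓕 n) (A : Set Ω), P A ≤ ENNReal.ofReal ε ∧
      ∀ ω ∉ A, ∀ s ∈ Set.Icc t T, 0 ≤ X s ω ∧
        X s ω ≤ x + (∫ r in (t : ℝ)..s, ⟪H.val r.toNNReal ω, stoppedThetaHat b σ K T r.toNNReal⟫) +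
          H.integral W t s ω + ε := by
  set θ := stoppedThetaHat b σ K T with hθdef
  have hθc : Continuous θ := hθ.continuous
  obtain ⟨M, hM⟩ := exists_norm_le_of_continuous hθc T
  have hM0 : 0 ≤ M := (norm_nonneg _).trans (hM 0 ⟨le_rfl, zero_le⟩)
  obtain ⟨Hs, h1, h2⟩ := h.sde
  -- so small that the errors of the integral and of the drift add up to `ε`
  set e : ℝ := ε / (1 + M * (T + 1) / 2) with he
  have hden : 0 < 1 + M * (T + 1) / 2 := by positivity
  have he0 : 0 < e := div_pos hε hden
  have heε : e + M * e * (T + 1) / 2 = ε := by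
    rw [he]
    field_simp
  have hε2 : (0 : ℝ≥0∞) < ENNReal.ofReal (ε / 2) := ENNReal.ofReal_pos.2 (by linarith)
  obtain ⟨k, hk1, hk2⟩ := (((h1 (ENNReal.ofReal (e ^ 2)) (ENNReal.ofReal_pos.2
    (by positivity))).eventually_le_const hε2).and
    ((h2 (ENNReal.ofReal e) (ENNReal.ofReal_pos.2 he0)).eventually_le_const hε2)).exists
  -- the exceptional events on which the approximation of the integrand or of the integral is bad
  set E₁ := {ω | ENNReal.ofReal (e ^ 2) ≤ ∫⁻ r in Set.Icc (t : ℝ) T,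
    ‖(Hs k).val r.toNNReal ω -
      X r.toNNReal ω • (σ r.toNNReal).transpose.toEuclideanLin (π r.toNNReal ω)‖ₑ ^ 2} with hE₁
  set E₂ := {ω | ENNReal.ofReal e ≤ ⨆ s ∈ Set.Icc t T, ‖(Hs k).integral W t s ω - (X s ω - x -
    ∫ r : ℝ in (t : ℝ)..s, X r.toNNReal ω * ⟪π r.toNNReal ω, b r.toNNReal⟫)‖ₑ} with hE₂
  have hae : ∀ᵐ ω ∂P, (∀ s ∈ Set.Icc t T, 0 ≤ X s ω) ∧
      IntervalIntegrable (fun r : ℝ => X r.toNNReal ω * ⟪π r.toNNReal ω, b r.toNNReal⟫)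
        volume t T ∧ ∀ᵐ r ∂volume.restrict (Set.Icc (t : ℝ) T), π r.toNNReal ω ∈ K := by
    filter_upwards [h.nonneg, h.integrable_drift, ae_ae_mem_cone h.progressive h.mem_cone]
      with ω ha hb hc using ⟨ha, hb, hc⟩
  obtain ⟨S, hSsub, -, hS0⟩ := exists_measurable_superset_of_null hae
  refine ⟨Hs k, (E₁ ∪ E₂) ∪ S, ?_, ?_⟩
  · calc P ((E₁ ∪ E₂) ∪ S) ≤ P E₁ + P E₂ + P S :=
          (measure_union_le _ _).trans (add_le_add_left (measure_union_le _ _) _)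
      _ ≤ ENNReal.ofReal (ε / 2) + ENNReal.ofReal (ε / 2) + 0 := by
          gcongr
          exact hS0.le
      _ = ENNReal.ofReal ε := by
          rw [add_zero, ← ENNReal.ofReal_add (by linarith) (by linarith), add_halves]
  · intro ω hω s hs
    simp only [Set.mem_union, not_or] at hω
    obtain ⟨⟨hω1, hω2⟩, hωS⟩ := hω
    obtain ⟨hX0, hint, hcone⟩ := not_not.1 fun hc => hωS (hSsub hc)
    refine ⟨hX0 s hs, ?_⟩
    have hts' : (t : ℝ) ≤ s := NNReal.coe_le_coe.2 hs.1
    have hsT' : (s : ℝ) ≤ T := NNReal.coe_le_coe.2 hs.2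
    have hI := (le_iSup₂ (f := fun s (_ : s ∈ Set.Icc t T) => ‖(Hs k).integral W t s ω -
      (X s ω - x - ∫ r : ℝ in (t : ℝ)..s,
        X r.toNNReal ω * ⟪π r.toNNReal ω, b r.toNNReal⟫)‖ₑ) s hs).trans (not_le.1 hω2).le
    rw [← ofReal_norm, ENNReal.ofReal_le_ofReal_iff he0.le, Real.norm_eq_abs] at hI
    have hI' := (abs_le.1 hI).1
    have hdrift := integral_le_of_approx hs.1 hs.2 hM0 he0
      (f := fun r : ℝ => X r.toNNReal ω * ⟪π r.toNNReal ω, b r.toNNReal⟫)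
      (g := fun r : ℝ => ⟪(Hs k).val r.toNNReal ω, θ r.toNNReal⟫)
      (D := fun r => (Hs k).val r.toNNReal ω -
        X r.toNNReal ω • (σ r.toNNReal).transpose.toEuclideanLin (π r.toNNReal ω))
      (hint.mono_set (by
        rw [Set.uIcc_of_le hts', Set.uIcc_of_le (hts'.trans hsT')]
        exact Set.Icc_subset_Icc_right hsT'))
      ((Hs k).intervalIntegrable_inner_val hθc ω _ _) (by
        filter_upwards [hcone, ae_restrict_mem measurableSet_Icc] with r hr hrI
        have hr' : r.toNNReal ∈ Set.Icc t T :=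
          ⟨NNReal.le_toNNReal_of_coe_le hrI.1, Real.toNNReal_le_iff_le_coe.2 hrI.2⟩
        have h3 := inner_le_of_mem_cone (b r.toNNReal) (hσ_det _ ⟨zero_le, hr'.2⟩) K hr
        rw [← stoppedThetaHat_of_le hr'.2] at h3
        -- the polar cone inequality, multiplied by the nonnegative wealth
        have h4 : X r.toNNReal ω * ⟪π r.toNNReal ω, b r.toNNReal⟫ ≤
            ⟪X r.toNNReal ω • (σ r.toNNReal).transpose.toEuclideanLin (π r.toNNReal ω),
              θ r.toNNReal⟫ := by
          rw [real_inner_smul_left]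
          exact mul_le_mul_of_nonneg_left h3 (hX0 _ hr')
        refine h4.trans ?_
        rw [← sub_le_iff_le_add', ← inner_sub_left]
        refine (le_abs_self _).trans ((abs_real_inner_le_norm _ _).trans ?_)
        rw [norm_sub_rev, mul_comm]
        exact mul_le_mul_of_nonneg_right (hM _ ⟨zero_le, hr'.2⟩) (norm_nonneg _))
      (not_le.1 hω1).le
    linarith

/-- The density is log-normal. -/
lemma map_log_partitionWeight [IsProbabilityMeasure P] [P.IsComplete]
    (hW : IsStandardBrownian W P) {s : ℕ → ℝ≥0} (hs : Monotone s)
    (d : ℕ → EuclideanSpace ℝ (Fin n)) (N : ℕ) :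
    P.map (fun ω => Real.log (partitionWeight W s d 0 N ω)) =
      gaussianReal (-((∑ i ∈ Finset.range N, ‖d i‖₊ ^ 2 * (s (i + 1) - s i) : ℝ≥0) / 2 : ℝ))
        (∑ i ∈ Finset.range N, ‖d i‖₊ ^ 2 * (s (i + 1) - s i)) := by
  set w : ℝ≥0 := ∑ i ∈ Finset.range N, ‖d i‖₊ ^ 2 * (s (i + 1) - s i) with hw
  have hwr : (w : ℝ) = ∑ i ∈ Finset.range N, ‖d i‖ ^ 2 * (s (i + 1) - s i) := by
    rw [hw]
    push_cast
    exact Finset.sum_congr rfl fun i _ => by rw [NNReal.coe_sub (hs i.le_succ)]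
  have e : (fun ω => Real.log (partitionWeight W s d 0 N ω)) =
      (fun y : ℝ => -y - w / 2) ∘
        fun ω => ∑ i ∈ Finset.range N, ⟪d i, W (s (i + 1)) ω - W (s i) ω⟫ := by
    ext ω
    simp only [Function.comp]
    rw [partitionWeight, Real.log_prod fun l _ => (stepWeight_pos _ _ _ _).ne', hwr,
      Finset.sum_div, ← Finset.sum_neg_distrib, ← Finset.sum_sub_distrib, Finset.range_eq_Ico]
    refine Finset.sum_congr rfl fun i _ => ?_
    rw [stepWeight, Real.log_exp]
  have hm : Measurable fun ω => ∑ i ∈ Finset.range N, ⟪d i, W (s (i + 1)) ω - W (s i) ω⟫ :=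
    Finset.measurable_fun_sum _ fun i _ =>
      (by fun_prop : Measurable fun v : EuclideanSpace ℝ (Fin n) => ⟪d i, v⟫).comp
        ((hW.measurable _).sub (hW.measurable _))
  have e2 : (fun y : ℝ => -y - w / 2) = (fun y : ℝ => y - w / 2) ∘ fun y : ℝ => -y := rfl
  rw [e, ← Measure.map_map (by fun_prop) hm, hW.map_sum_inner hs d N, e2,
    ← Measure.map_map (by fun_prop) (by fun_prop), gaussianReal_map_neg,
    gaussianReal_map_sub_const, ← hw]
  congr 1
  ring

open Classical in
/-- The weighted expectation of a discrete stochastic integral stopped near `-L`, corrected by the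
possible overshoot, is close to `L`. -/
lemma IsStandardBrownian.integral_partitionWeight_mul_stoppedSum_le [IsProbabilityMeasure P]
    [P.IsComplete] (hW : IsStandardBrownian W P) {s : ℕ → ℝ≥0} (hs : Monotone s)
    {d : ℕ → EuclideanSpace ℝ (Fin n)} (N : ℕ) {ζ : ℕ → Ω → EuclideanSpace ℝ (Fin n)}
    (hζ : ∀ i, Measurable[brownianFiltration P W hW.measurable (s i)] (ζ i)) {C : ℝ} (hC0 : 0 ≤ C)
    (hC : ∀ i ω, ‖ζ i ω‖ ≤ C) {L δ h : ℝ} (hL : 0 ≤ L) (hδ : 0 < δ)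
    (hmesh : ∀ i, (s (i + 1) : ℝ) ≤ s i + h) :
    ∃ Y : Ω → ℝ, Integrable Y P ∧ (∀ ω, 0 ≤ Y ω) ∧
      (∀ ω, (∀ j < N, -L ≤ ∑ i ∈ Finset.range j, ⟪ζ i ω, driftedIncrement W s d i ω⟫) →
        partitionWeight W s d 0 N ω * (L + ∑ i ∈ Finset.range N,
          ⟪ζ i ω, driftedIncrement W s d i ω⟫) ≤ Y ω) ∧
      ∫ ω, Y ω ∂P ≤ L + δ + C ^ 4 / δ ^ 3 * (n ^ 2 * (∫ u, u ^ 4 ∂gaussianReal 0 1)) *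
        (h * (s N - s 0)) := by
  set Z := partitionWeight W s d 0 N with hZ
  have hZ0 : ∀ ω, 0 < Z ω := fun ω => partitionWeight_pos _ _ _
  obtain ⟨hZi, hZ1⟩ := hW.integrable_partitionWeight (d := d) hs (Nat.zero_le N)
  set u := driftedIncrement W s d with hu
  set J : Ω → ℕ → ℝ := fun ω j => ∑ i ∈ Finset.range j, ⟪ζ i ω, u i ω⟫ with hJ
  have hJm : ∀ i, ∀ l ≤ i, Measurable[brownianFiltration P W hW.measurable (s i)]
      fun ω => J ω l := by
    intro i l hl
    refine @Finset.measurable_fun_sum _ _ _ _ _ _ (brownianFiltration P W hW.measurable (s i)) _ _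
      fun q hq => ?_
    have hq' := Finset.mem_range.1 hq
    exact ((hζ q).mono ((brownianFiltration P W hW.measurable).mono (hs (by omega)))
      le_rfl).inner ((measurable_driftedIncrement hW.measurable hs q).mono
        ((brownianFiltration P W hW.measurable).mono (hs (by omega))) le_rfl)
  -- the integrand switched off once the sum has fallen below `-L`; whether this has happened is
  -- known at the beginning of each step
  set ζ' : ℕ → Ω → EuclideanSpace ℝ (Fin n) := fun i ω =>
    if ∀ l ≤ i, -L ≤ J ω l then ζ i ω else 0 with hζ'
  have hζ'm : ∀ i, Measurable[brownianFiltration P W hW.measurable (s i)] (ζ' i) := by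
    intro i
    refine Measurable.ite ?_ (hζ i) measurable_const
    have e : {ω | ∀ l ≤ i, -L ≤ J ω l} = ⋂ l ∈ Finset.range (i + 1), {ω | -L ≤ J ω l} := by
      ext ω
      simp
    rw [e]
    refine Finset.measurableSet_biInter _ fun l hl => ?_
    exact measurableSet_le measurable_const (hJm i l (Nat.lt_succ_iff.1 (Finset.mem_range.1 hl)))
  have hζ'C : ∀ i ω, ‖ζ' i ω‖ ≤ C := fun i ω => by
    simp only [hζ']
    split_ifs
    · exact hC i ω
    · simpa using hC0
  have hstopped : ∀ ω, stoppedSum (J ω) L N = ∑ i ∈ Finset.range N, ⟪ζ' i ω, u i ω⟫ := fun ω => by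
    refine Finset.sum_congr rfl fun i _ => ?_
    simp only [hζ', hJ]
    split_ifs
    · rw [Finset.sum_range_succ, add_sub_cancel_left]
    · simp
  obtain ⟨hS1, hS2⟩ := hW.integral_partitionWeight_mul_sum (d := d) hs N hζ'm hζ'C
  have hF := fun i (hi : i ∈ Finset.range N) =>
    hW.integral_partitionWeight_mul_norm_pow_four_le (d := d) hs (Finset.mem_range.1 hi)
  -- a bound for the largest increment: an increment `a > δ` satisfies `a ≤ a ^ 4 / δ ^ 3`, and the
  -- sum of the fourth powers has small expectation for a fine partition
  set o : Ω → ℝ := fun ω => δ + ∑ i ∈ Finset.range N, C ^ 4 / δ ^ 3 * ‖u i ω‖ ^ 4 with ho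
  have hsum0 : ∀ ω, ∀ i ∈ Finset.range N, 0 ≤ C ^ 4 / δ ^ 3 * ‖u i ω‖ ^ 4 := fun ω i _ => by
    positivity
  have ho0 : ∀ ω, 0 ≤ o ω := fun ω => add_nonneg hδ.le (Finset.sum_nonneg (hsum0 ω))
  have hincr : ∀ ω, ∀ i < N, |J ω (i + 1) - J ω i| ≤ o ω := by
    intro ω i hi
    have e : J ω (i + 1) - J ω i = ⟪ζ i ω, u i ω⟫ := by
      simp only [hJ]
      rw [Finset.sum_range_succ, add_sub_cancel_left]
    set a : ℝ := C * ‖u i ω‖ with ha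
    have ha0 : 0 ≤ a := by positivity
    have h1 : |⟪ζ i ω, u i ω⟫| ≤ a :=
      (abs_real_inner_le_norm _ _).trans (mul_le_mul_of_nonneg_right (hC i ω) (norm_nonneg _))
    have h2 : a ≤ δ + C ^ 4 / δ ^ 3 * ‖u i ω‖ ^ 4 := by
      have e4 : C ^ 4 / δ ^ 3 * ‖u i ω‖ ^ 4 = a ^ 4 / δ ^ 3 := by
        rw [ha]
        ring
      rw [e4]
      rcases le_or_gt a δ with hle | hgt
      · have : 0 ≤ a ^ 4 / δ ^ 3 := by positivity
        linarith
      · have h3 : a ≤ a ^ 4 / δ ^ 3 := by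
          rw [le_div_iff₀ (by positivity)]
          calc a * δ ^ 3 ≤ a * a ^ 3 := by gcongr
            _ = a ^ 4 := by ring
        linarith
    rw [e]
    refine h1.trans (h2.trans ?_)
    simp only [ho]
    gcongr
    exact Finset.single_le_sum (f := fun i => C ^ 4 / δ ^ 3 * ‖u i ω‖ ^ 4) (hsum0 ω)
      (Finset.mem_range.2 hi)
  have hJ0 : ∀ ω, J ω 0 = 0 := fun ω => by simp [hJ]
  have hterm : ∀ i ∈ Finset.range N, Integrable (fun ω => C ^ 4 / δ ^ 3 *
      (Z ω * ‖u i ω‖ ^ 4)) P := fun i hi => (hF i hi).1.const_mul _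
  have eY : ∀ ω, Z ω * (L + o ω + stoppedSum (J ω) L N) =
      (L + δ) * Z ω + ∑ i ∈ Finset.range N, C ^ 4 / δ ^ 3 * (Z ω * ‖u i ω‖ ^ 4) +
        Z ω * ∑ i ∈ Finset.range N, ⟪ζ' i ω, u i ω⟫ := fun ω => by
    rw [hstopped]
    simp only [ho]
    have : ∑ i ∈ Finset.range N, C ^ 4 / δ ^ 3 * (Z ω * ‖u i ω‖ ^ 4) =
        Z ω * ∑ i ∈ Finset.range N, C ^ 4 / δ ^ 3 * ‖u i ω‖ ^ 4 := by
      rw [Finset.mul_sum]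
      exact Finset.sum_congr rfl fun i _ => by ring
    rw [this]
    ring
  have hA : Integrable (fun ω => (L + δ) * Z ω) P := hZi.const_mul _
  have hB : Integrable (fun ω => ∑ i ∈ Finset.range N, C ^ 4 / δ ^ 3 * (Z ω * ‖u i ω‖ ^ 4)) P :=
    integrable_finsetSum _ hterm
  have hAB : Integrable (fun ω => (L + δ) * Z ω +
      ∑ i ∈ Finset.range N, C ^ 4 / δ ^ 3 * (Z ω * ‖u i ω‖ ^ 4)) P := hA.add hB
  refine ⟨fun ω => Z ω * (L + o ω + stoppedSum (J ω) L N), ?_, fun ω => ?_, fun ω hω => ?_, ?_⟩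
  · simp_rw [eY]
    exact hAB.add hS1
  · refine mul_nonneg (hZ0 ω).le ?_
    linarith [neg_sub_le_stoppedSum (hJ0 ω) hL (ho0 ω) (hincr ω)]
  · refine mul_le_mul_of_nonneg_left ?_ (hZ0 ω).le
    rw [stoppedSum_eq (hJ0 ω) hω]
    linarith [ho0 ω]
  · simp_rw [eY]
    rw [integral_add hAB hS1, integral_add hA hB, hS2, integral_const_mul, hZ1,
      integral_finsetSum _ hterm]
    have hle : ∑ i ∈ Finset.range N, ∫ ω, C ^ 4 / δ ^ 3 * (Z ω * ‖u i ω‖ ^ 4) ∂P ≤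
        ∑ i ∈ Finset.range N, C ^ 4 / δ ^ 3 * (n ^ 2 * (∫ u, u ^ 4 ∂gaussianReal 0 1)) *
          (h * (s (i + 1) - s i)) := by
      refine Finset.sum_le_sum fun i hi => ?_
      rw [integral_const_mul, mul_assoc]
      refine mul_le_mul_of_nonneg_left ((hF i hi).2.trans ?_) (by positivity)
      have h0 : (0 : ℝ) ≤ s (i + 1) - s i := sub_nonneg.2 (NNReal.coe_le_coe.2 (hs i.le_succ))
      have h4 : 0 ≤ ∫ u : ℝ, u ^ 4 ∂gaussianReal 0 1 := integral_nonneg fun u => by positivity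
      refine mul_le_mul_of_nonneg_left ?_ (by positivity)
      rw [sq]
      exact mul_le_mul_of_nonneg_right (by linarith [hmesh i]) h0
    rw [← Finset.mul_sum, ← Finset.mul_sum,
      Finset.sum_range_sub (fun i => (s i : ℝ)) N] at hle
    linarith

end UpperBound


section UpperBound

variable {Ω : Type*} {mΩ : MeasurableSpace Ω} {n : ℕ} {P : Measure Ω}
  {W : ℝ≥0 → Ω → EuclideanSpace ℝ (Fin n)} {hW : IsStandardBrownian W P}
  {b : ℝ≥0 → EuclideanSpace ℝ (Fin n)} {σ : ℝ≥0 → Matrix (Fin n) (Fin n) ℝ}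
  {K : ProperCone ℝ (EuclideanSpace ℝ (Fin n))} {T t v : ℝ≥0} {U : ℝ → ℝ} {x : ℝ}
  {π : ℝ≥0 → Ω → EuclideanSpace ℝ (Fin n)} {X : ℝ≥0 → Ω → ℝ}

/-- A step function approximation of a continuous function on a fine partition, free of the jumps
of a given simple process, with the variance of its Wiener integral. -/
lemma exists_step_approx {𝓕 : Filtration ℝ≥0 mΩ} (H : SimpleProcess 𝓕 n)
    {θ : ℝ≥0 → EuclideanSpace ℝ (Fin n)} (hθ : Continuous θ) (htT : t ≤ T) {M ρ h : ℝ}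
    (hM : ∀ r ∈ Set.Icc 0 T, ‖θ r‖ ≤ M) (hρ : 0 < ρ) (hh : 0 < h) :
    ∃ (s : ℕ → ℝ≥0) (N : ℕ), Monotone s ∧ s 0 = t ∧ s N = T ∧ (∀ i, s i ∈ Set.Icc t T) ∧
      (∀ i, H.JumpFree (s i) (s (i + 1))) ∧ (∀ i, (s (i + 1) : ℝ) ≤ s i + h) ∧
      (∀ i, ∀ r ∈ Set.Icc (s i) (s (i + 1)), ‖θ (s i) - θ r‖ ≤ ρ) ∧
      |((∑ i ∈ Finset.range N, ‖θ (s i)‖₊ ^ 2 * (s (i + 1) - s i) : ℝ≥0) : ℝ) -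
        ((clock θ T - clock θ t : ℝ≥0) : ℝ)| ≤ 2 * M * ρ * T := by
  have hM0 : 0 ≤ M := (norm_nonneg _).trans (hM 0 ⟨le_rfl, zero_le⟩)
  have huc := (isCompact_Icc (a := (0 : ℝ≥0)) (b := T)).uniformContinuousOn_of_continuous
    hθ.continuousOn
  obtain ⟨η, hη, hu⟩ := Metric.uniformContinuousOn_iff.1 huc ρ hρ
  set m : ℝ≥0 := Real.toNNReal (min h (η / 2)) with hm
  have hm0 : 0 < min h (η / 2) := lt_min hh (by linarith)
  have hmr : (m : ℝ) = min h (η / 2) := Real.coe_toNNReal _ hm0.le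
  obtain ⟨s, N, hs, h0, hN, hjump, hmesh⟩ :=
    exists_fine_partition H.jumps htT (δ := m) (Real.toNNReal_pos.2 hm0)
  have hsI : ∀ i, s i ∈ Set.Icc t T := fun i => ⟨h0 ▸ hs (Nat.zero_le i), by
    rw [← hN (max i N) (le_max_right _ _)]
    exact hs (le_max_left _ _)⟩
  have hmesh' : ∀ i, (s (i + 1) : ℝ) ≤ s i + m := fun i => by exact_mod_cast hmesh i
  have hosc : ∀ i, ∀ r ∈ Set.Icc (s i) (s (i + 1)), ‖θ (s i) - θ r‖ ≤ ρ := by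
    intro i r hr
    rw [← dist_eq_norm]
    refine (hu _ ⟨zero_le, (hsI i).2⟩ _ ⟨zero_le, hr.2.trans (hsI _).2⟩ ?_).le
    have h1 : (s i : ℝ) ≤ r := hr.1
    have h2 : (r : ℝ) ≤ s (i + 1) := hr.2
    have h3 := hmesh' i
    have h4 := min_le_right h (η / 2)
    rw [NNReal.dist_eq, abs_sub_comm, abs_of_nonneg (by linarith)]
    linarith
  refine ⟨s, N, hs, h0, hN N le_rfl, hsI, fun i => H.jumpFree_of_jumps (hjump i),
    fun i => (hmesh' i).trans ?_, hosc, ?_⟩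
  · have := min_le_left h (η / 2)
    linarith
  · have hR := abs_riemann_sum_sub_integral_le (s := fun i => (s i : ℝ)) (η := 2 * M * ρ)
      (fun i j hij => NNReal.coe_le_coe.2 (hs hij))
      (fun a b => (continuous_sq_norm hθ).intervalIntegrable a b)
      (fun i => ‖θ (s i)‖ ^ 2) N fun i hi r hr => by
        have hr' : r.toNNReal ∈ Set.Icc (s i) (s (i + 1)) :=
          ⟨(Real.lt_toNNReal_iff_coe_lt.2 hr.1).le, Real.toNNReal_le_iff_le_coe.2 hr.2⟩
        have h1 := (abs_norm_sub_norm_le _ _).trans (hosc i _ hr')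
        have h2 := hM (s i) ⟨zero_le, (hsI i).2⟩
        have h3 := hM r.toNNReal ⟨zero_le, hr'.2.trans (hsI _).2⟩
        have e : ‖θ (s i)‖ ^ 2 - ‖θ r.toNNReal‖ ^ 2 =
            (‖θ (s i)‖ + ‖θ r.toNNReal‖) * (‖θ (s i)‖ - ‖θ r.toNNReal‖) := by ring
        rw [e, abs_mul, abs_of_nonneg (by positivity)]
        exact mul_le_mul (by linarith) h1 (abs_nonneg _) (by positivity)
    rw [coe_clock_sub hθ htT]
    push_cast
    simp only [h0, hN N le_rfl] at hR
    have e : ∀ i, ((s (i + 1) - s i : ℝ≥0) : ℝ) = s (i + 1) - s i := fun i =>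
      NNReal.coe_sub (hs i.le_succ)
    simp only [e]
    refine hR.trans (mul_le_mul_of_nonneg_left ?_ (by positivity))
    linarith [t.2]

/-- The dual bound for the truncated expected utility of a wealth process, up to `ε`. -/
lemma IsWealthProcess.lintegral_min_le [IsProbabilityMeasure P] [P.IsComplete]
    (h : IsWealthProcess P (brownianFiltration P W hW.measurable) W b σ K T t x π X)
    (hσ_det : ∀ s ∈ Set.Icc 0 T, IsUnit (σ s).det) (hθ : ParabolicityAssumption b σ K T)
    (htT : t ≤ T) (hx : 0 < x)
    (hv : v = clock (stoppedThetaHat b σ K T) T - clock (stoppedThetaHat b σ K T) t)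
    {Ψ : ℝ → ℝ} (hΨc : Continuous Ψ) (hΨ0 : ∀ ζ, 0 ≤ Ψ ζ)
    (hΨ : ∀ ζ a, 0 ≤ a → U a ≤ Ψ ζ + Real.exp ζ * a)
    (hΨi : ∀ m w, Integrable Ψ (gaussianReal m w)) (z : ℝ) (R : ℝ) {ε : ℝ}
    (hε : 0 < ε) :
    ∃ w : ℝ≥0, |(w : ℝ) - v| ≤ ε ∧
      ∫⁻ ω, min (ENNReal.ofReal (U (X T ω))) (ENNReal.ofReal R) ∂P ≤
        ENNReal.ofReal (∫ g, Ψ (z + g) ∂gaussianReal (-(w / 2 : ℝ)) w + Real.exp z * (x + ε)) +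
          ENNReal.ofReal R * ENNReal.ofReal ε := by
  set θ := stoppedThetaHat b σ K T with hθdef
  have hθc : Continuous θ := hθ.continuous
  obtain ⟨M, hM⟩ := exists_norm_le_of_continuous hθc T
  have hM0 : 0 ≤ M := (norm_nonneg _).trans (hM 0 ⟨le_rfl, zero_le⟩)
  obtain ⟨H, A, hPA, hA⟩ := h.exists_simple_approx hσ_det hθ (ε := ε / 8) (by linarith)
  obtain ⟨C, hC0, hC⟩ := H.exists_bound
  set M4 : ℝ := ∫ u, u ^ 4 ∂gaussianReal 0 1 with hM4
  have hM40 : 0 ≤ M4 := integral_nonneg fun u => by positivity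
  -- given the bound `C` on the simple process, the oscillation `ρ` of `θ̂`, the overshoot `δ` and
  -- the mesh `h'` are chosen such that all errors add up to at most `ε`
  set ρ : ℝ := ε / (8 * (C * T + M * T + 1)) with hρ
  have hρ0 : 0 < ρ := by positivity
  have hρ1 : 8 * (C * T * ρ + M * T * ρ + ρ) = ε := by
    rw [hρ]
    field_simp
  set δ : ℝ := ε / 4 with hδ
  have hδ0 : 0 < δ := by positivity
  set h' : ℝ := ε / (8 * (C ^ 4 / δ ^ 3 * (n ^ 2 * M4) * T + 1)) with hh'
  have hh0 : 0 < h' := by positivity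
  have hh1 : 8 * (C ^ 4 / δ ^ 3 * (n ^ 2 * M4) * (h' * T) + h') = ε := by
    have : 8 * (C ^ 4 / δ ^ 3 * (n ^ 2 * M4) * (h' * T) + h') =
      h' * (8 * (C ^ 4 / δ ^ 3 * (n ^ 2 * M4) * T + 1)) := by ring
    rw [this, hh']
    exact div_mul_cancel₀ _ (by positivity)
  obtain ⟨s, N, hs, h0, hN, hsI, hjump, hmesh, hosc, hvar⟩ :=
    exists_step_approx H hθc htT hM hρ0 hh0
  rw [← hv] at hvar
  set d : ℕ → EuclideanSpace ℝ (Fin n) := fun i => θ (s i) with hd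
  set w : ℝ≥0 := ∑ i ∈ Finset.range N, ‖θ (s i)‖₊ ^ 2 * (s (i + 1) - s i) with hw
  have hT0 : (0 : ℝ) ≤ T := T.2
  have hCTρ : 0 ≤ C * T * ρ := by positivity
  have hMTρ : 0 ≤ M * T * ρ := by positivity
  refine ⟨w, hvar.trans (by linarith), ?_⟩
  set ζ : ℕ → Ω → EuclideanSpace ℝ (Fin n) := fun i => H.val (s (i + 1)) with hζ
  set L : ℝ := x + ε / 4 with hL
  obtain ⟨Y, hYi, hY0, hY, hYint⟩ := hW.integral_partitionWeight_mul_stoppedSum_le hs (d := d) N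
    (ζ := ζ) (fun i => H.measurable_val (hjump i)) hC0 (fun i ω => hC _ ω) (L := L) (δ := δ)
    (h := h') (by positivity) hδ0 hmesh
  set Z := partitionWeight W s d 0 N with hZ
  have hZpos : ∀ ω, 0 < Z ω := fun ω => partitionWeight_pos _ _ _
  -- since wealth is nonnegative, off `A` the dominating sum never falls below `-L`, so that
  -- stopping it there has no effect
  have hpath : ∀ ω ∉ A, ∀ j, 0 ≤ X (s j) ω ∧ X (s j) ω ≤
      L + ∑ i ∈ Finset.range j, ⟪ζ i ω, driftedIncrement W s d i ω⟫ := by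
    intro ω hω j
    obtain ⟨h1, h2⟩ := hA ω hω (s j) (hsI j)
    refine ⟨h1, h2.trans ?_⟩
    have h3 := H.integral_inner_val_le hθc hs hjump ω (Real.norm_of_nonneg hC0)
      (fun r => hC r ω) j fun i _ => hosc i
    have h4 := H.integral_partition (W := W) hs hjump j ω
    rw [h0] at h3 h4
    have e : ∑ i ∈ Finset.range j, ⟪ζ i ω, driftedIncrement W s d i ω⟫ =
        ∑ i ∈ Finset.range j, ⟪H.val (s (i + 1)) ω, θ (s i)⟫ * (s (i + 1) - s i) +
          ∑ i ∈ Finset.range j, ⟪H.val (s (i + 1)) ω, W (s (i + 1)) ω - W (s i) ω⟫ := by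
      rw [← Finset.sum_add_distrib]
      refine Finset.sum_congr rfl fun i _ => ?_
      rw [driftedIncrement, inner_add_right, inner_smul_right]
      simp only [hζ, hd]
      ring
    have h5 : C * ρ * (s j - t) ≤ C * T * ρ := by
      have : (s j : ℝ) ≤ T := (hsI j).2
      have h6 : (s j : ℝ) - t ≤ T := by linarith [t.2]
      calc C * ρ * (s j - t) ≤ C * ρ * T := by gcongr
        _ = C * T * ρ := by ring
    rw [e, h4] at *
    linarith
  have hmlog : Measurable fun ω => Real.log (Z ω) :=
    ((measurable_partitionWeight_past (P := P) (d := d) hW.measurable hs 0 N).mono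
      ((brownianFiltration P W hW.measurable).le _) le_rfl).log
  have hlaw := map_log_partitionWeight hW hs d N
  have hΨzi : Integrable (fun g => Ψ (z + g)) (gaussianReal (-(w / 2 : ℝ)) w) := by
    have h1 := hΨi (-(w / 2 : ℝ) + z) w
    rw [← gaussianReal_map_const_add] at h1
    exact (integrable_map_measure hΨc.aestronglyMeasurable (by fun_prop)).1 h1
  have hΨm : AEStronglyMeasurable (fun g => Ψ (z + g)) (P.map fun ω => Real.log (Z ω)) :=
    (by fun_prop : Continuous fun g => Ψ (z + g)).aestronglyMeasurable
  have hΨint : Integrable (fun ω => Ψ (z + Real.log (Z ω))) P := by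
    rw [← hlaw] at hΨzi
    exact (integrable_map_measure hΨm hmlog.aemeasurable).1 hΨzi
  have hΨeq : ∫ ω, Ψ (z + Real.log (Z ω)) ∂P = ∫ g, Ψ (z + g) ∂gaussianReal (-(w / 2 : ℝ)) w := by
    rw [← hlaw, integral_map hmlog.aemeasurable hΨm]
  have hYi' : Integrable (fun ω => Real.exp z * Y ω) P := hYi.const_mul _
  have hsumi : Integrable (fun ω => Ψ (z + Real.log (Z ω)) + Real.exp z * Y ω) P :=
    hΨint.add hYi'
  have htot : ∫⁻ ω, ENNReal.ofReal (Ψ (z + Real.log (Z ω)) + Real.exp z * Y ω) ∂P ≤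
      ENNReal.ofReal (∫ g, Ψ (z + g) ∂gaussianReal (-(w / 2 : ℝ)) w + Real.exp z * (x + ε)) := by
    rw [← ofReal_integral_eq_lintegral_ofReal hsumi (ae_of_all _ fun ω =>
      add_nonneg (hΨ0 _) (mul_nonneg (Real.exp_nonneg _) (hY0 ω))), integral_add hΨint hYi',
      hΨeq, integral_const_mul]
    refine ENNReal.ofReal_le_ofReal (add_le_add le_rfl
      (mul_le_mul_of_nonneg_left (hYint.trans ?_) (Real.exp_nonneg _)))
    rw [h0, hN]
    have h1 : C ^ 4 / δ ^ 3 * (n ^ 2 * M4) * (h' * (T - t)) ≤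
        C ^ 4 / δ ^ 3 * (n ^ 2 * M4) * (h' * T) := by
      have : (T : ℝ) - t ≤ T := by linarith [t.2]
      gcongr
    linarith
  -- `A` need not be measurable, hence the measurable hull, on which the bound `R` is used
  calc ∫⁻ ω, min (ENNReal.ofReal (U (X T ω))) (ENNReal.ofReal R) ∂P
      ≤ ∫⁻ ω, (ENNReal.ofReal (Ψ (z + Real.log (Z ω)) + Real.exp z * Y ω) +
          (toMeasurable P A).indicator (fun _ => ENNReal.ofReal R) ω) ∂P := by
        refine lintegral_mono fun ω => ?_
        by_cases hω : ω ∈ toMeasurable P A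
        · rw [Set.indicator_of_mem hω]
          exact (min_le_right _ _).trans le_add_self
        · rw [Set.indicator_of_notMem hω, add_zero]
          have hωA : ω ∉ A := fun hc => hω (subset_toMeasurable P A hc)
          refine (min_le_left _ _).trans (ENNReal.ofReal_le_ofReal ?_)
          have hXT := hpath ω hωA N
          rw [hN] at hXT
          refine (hΨ (z + Real.log (Z ω)) _ hXT.1).trans (add_le_add le_rfl ?_)
          rw [Real.exp_add, Real.exp_log (hZpos ω), mul_assoc]
          refine mul_le_mul_of_nonneg_left (le_trans ?_ (hY ω fun j _ => ?_)) (Real.exp_nonneg _)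
          · exact mul_le_mul_of_nonneg_left hXT.2 (hZpos ω).le
          · have := hpath ω hωA j
            linarith [this.1, this.2]
    _ = ∫⁻ ω, ENNReal.ofReal (Ψ (z + Real.log (Z ω)) + Real.exp z * Y ω) ∂P +
          ENNReal.ofReal R * P A := by
        rw [lintegral_add_right _ (measurable_const.indicator (measurableSet_toMeasurable P A)),
          lintegral_indicator_const (measurableSet_toMeasurable P A), measure_toMeasurable]
    _ ≤ _ := by
        refine add_le_add htot (mul_le_mul_right ?_ _)
        exact hPA.trans (ENNReal.ofReal_le_ofReal (by linarith))

/-- The dual bound for the value function: `U ≤ Ψ(ζ) + e^ζ x` integrated along the state price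
density. -/
theorem valueFunction_le [IsProbabilityMeasure P] [P.IsComplete]
    (hσ_det : ∀ s ∈ Set.Icc 0 T, IsUnit (σ s).det) (hθ : ParabolicityAssumption b σ K T)
    (hU : UtilityAssumption U) (htT : t ≤ T) (hx : 0 < x)
    (hv : v = clock (stoppedThetaHat b σ K T) T - clock (stoppedThetaHat b σ K T) t)
    {Ψ : ℝ → ℝ} (hΨc : Continuous Ψ) (hΨ0 : ∀ ζ, 0 ≤ Ψ ζ)
    (hΨ : ∀ ζ a, 0 ≤ a → U a ≤ Ψ ζ + Real.exp ζ * a)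
    (hΨi : ∀ m w, Integrable Ψ (gaussianReal m w)) {z : ℝ}
    (hΨv : Continuous fun w : ℝ≥0 => ∫ g, Ψ (z + g) ∂gaussianReal (-(w / 2 : ℝ)) w) :
    valueFunction P (brownianFiltration P W hW.measurable) W b σ K U T t x ≤
      ENNReal.ofReal (∫ g, Ψ (z + g) ∂gaussianReal (-(v / 2 : ℝ)) v + Real.exp z * x) := by
  refine iSup₂_le fun π X => iSup_le fun h => ?_
  -- for truncated utility the error terms vanish as `ε → 0`; then the truncation is removed by
  -- monotone convergence
  have hstep : ∀ R : ℕ, ∫⁻ ω, min (ENNReal.ofReal (U (X T ω))) (ENNReal.ofReal R) ∂P ≤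
      ENNReal.ofReal (∫ g, Ψ (z + g) ∂gaussianReal (-(v / 2 : ℝ)) v + Real.exp z * x) := by
    intro R
    choose w hw1 hw2 using fun k : ℕ => h.lintegral_min_le (hW := hW) hσ_det hθ
      htT hx hv hΨc hΨ0 hΨ hΨi z R
      (ε := 1 / ((k : ℝ) + 1)) (by positivity)
    have hk : Tendsto (fun k : ℕ => 1 / ((k : ℝ) + 1)) atTop (𝓝 0) :=
      tendsto_one_div_add_atTop_nhds_zero_nat
    have hw : Tendsto w atTop (𝓝 v) := by
      refine tendsto_iff_dist_tendsto_zero.2 (squeeze_zero (fun _ => dist_nonneg) (fun k => ?_) hk)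
      rw [NNReal.dist_eq]
      exact hw1 k
    have hlim : Tendsto (fun k => ENNReal.ofReal (∫ g, Ψ (z + g) ∂gaussianReal
        (-(w k / 2 : ℝ)) (w k) + Real.exp z * (x + 1 / ((k : ℝ) + 1))) +
        ENNReal.ofReal R * ENNReal.ofReal (1 / ((k : ℝ) + 1))) atTop
        (𝓝 (ENNReal.ofReal (∫ g, Ψ (z + g) ∂gaussianReal (-(v / 2 : ℝ)) v +
          Real.exp z * (x + 0)) + ENNReal.ofReal R * ENNReal.ofReal 0)) := by
      refine Tendsto.add ?_ (ENNReal.Tendsto.const_mul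
        ((ENNReal.continuous_ofReal.tendsto _).comp hk) (Or.inr ENNReal.ofReal_ne_top))
      exact (ENNReal.continuous_ofReal.tendsto _).comp
        (((hΨv.tendsto v).comp hw).add ((hk.const_add x).const_mul _))
    have := ge_of_tendsto' hlim hw2
    simpa using this
  -- `U` is continuous on `[0, ∞)` only, whence the positive part for measurability
  have hae : (fun ω => ENNReal.ofReal (U (X T ω))) =ᵐ[P]
      fun ω => ENNReal.ofReal (U (max (X T ω) 0)) := by
    filter_upwards [h.nonneg] with ω hω
    rw [max_eq_left (hω T ⟨htT, le_rfl⟩)]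
  have hm : Measurable fun ω => ENNReal.ofReal (U (max (X T ω) 0)) :=
    ENNReal.measurable_ofReal.comp ((hU.continuous_comp (f := fun y : ℝ => max y 0) (by fun_prop)
      fun y => le_max_right _ _).measurable.comp ((h.adapted T ⟨htT, le_rfl⟩).mono
        ((brownianFiltration P W hW.measurable).le T) le_rfl))
  have hsup : ∀ y : ℝ, ENNReal.ofReal y =
      ⨆ R : ℕ, min (ENNReal.ofReal y) (ENNReal.ofReal R) := by
    intro y
    refine le_antisymm ?_ (iSup_le fun R => min_le_left _ _)
    obtain ⟨R, hR⟩ := exists_nat_ge y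
    exact le_iSup_of_le R (le_min le_rfl (ENNReal.ofReal_le_ofReal hR))
  rw [lintegral_congr_ae hae]
  have e : ∫⁻ ω, ENNReal.ofReal (U (max (X T ω) 0)) ∂P =
      ⨆ R : ℕ, ∫⁻ ω, min (ENNReal.ofReal (U (max (X T ω) 0))) (ENNReal.ofReal R) ∂P := by
    rw [← lintegral_iSup (fun R => hm.min measurable_const) fun R R' hR ω =>
      min_le_min_left _ (ENNReal.ofReal_le_ofReal (by exact_mod_cast hR))]
    exact lintegral_congr fun ω => hsup _
  rw [e]
  refine iSup_le fun R => le_trans (le_of_eq (lintegral_congr_ae ?_)) (hstep R)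
  filter_upwards [hae] with ω hω
  rw [hω]

end UpperBound


/-! ### Smooth utilities and the inverse of marginal utility -/

section InverseMarginal

/-- A utility function that is `C¹` on `(0,∞)`, strictly increasing and strictly concave. -/
structure SmoothUtility (U : ℝ → ℝ) : Prop extends UtilityAssumption U where
  contDiffOn : ContDiffOn ℝ 1 U (Set.Ioi 0)
  strictMonoOn : StrictMonoOn U (Set.Ici 0)
  strictConcaveOn : StrictConcaveOn ℝ (Set.Ici 0) U

variable {U : ℝ → ℝ}

namespace SmoothUtility

lemma hasDerivAt (hU : SmoothUtility U) {x : ℝ} (hx : 0 < x) : HasDerivAt U (deriv U x) x :=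
  ((hU.contDiffOn.differentiableOn one_ne_zero).differentiableAt
    (isOpen_Ioi.mem_nhds hx)).hasDerivAt

lemma continuousAt_deriv (hU : SmoothUtility U) {x : ℝ} (hx : 0 < x) :
    ContinuousAt (deriv U) x :=
  (hU.contDiffOn.continuousOn_deriv_of_isOpen isOpen_Ioi le_rfl).continuousAt
    (isOpen_Ioi.mem_nhds hx)

lemma strictAntiOn_deriv (hU : SmoothUtility U) : StrictAntiOn (deriv U) (Set.Ioi 0) :=
  (hU.strictConcaveOn.subset Set.Ioi_subset_Ici_self (convex_Ioi 0)).strictAntiOn_deriv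
    fun _ hx => (hU.hasDerivAt hx).differentiableAt

/-- Mean value theorem for `U`, up to the boundary point `0`. -/
lemma exists_deriv_eq (hU : SmoothUtility U) {x y : ℝ} (hx : 0 ≤ x) (hxy : x < y) :
    ∃ c, x < c ∧ c < y ∧ U y - U x = deriv U c * (y - x) := by
  obtain ⟨c, hc, h⟩ := exists_deriv_eq_slope U hxy
    (hU.continuousOn.mono fun a ha => hx.trans ha.1) fun a ha =>
      (hU.hasDerivAt (hx.trans_lt ha.1)).differentiableAt.differentiableWithinAt
  refine ⟨c, hc.1, hc.2, ?_⟩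
  rw [h, div_mul_cancel₀ _ (by linarith)]

lemma deriv_pos (hU : SmoothUtility U) {x : ℝ} (hx : 0 < x) : 0 < deriv U x := by
  obtain ⟨c, h1, h2, h⟩ := hU.exists_deriv_eq hx.le (lt_add_one x)
  have h3 := hU.strictMonoOn (Set.mem_Ici.2 hx.le) (Set.mem_Ici.2 (by linarith)) (lt_add_one x)
  have h4 := hU.strictAntiOn_deriv hx (Set.mem_Ioi.2 (hx.trans h1)) h1
  rw [add_sub_cancel_left, mul_one] at h
  linarith

/-- The tangent at `x` lies above the value at `0`. -/
lemma mul_deriv_le (hU : SmoothUtility U) {x : ℝ} (hx : 0 < x) : x * deriv U x ≤ U x := by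
  obtain ⟨c, h1, h2, h⟩ := hU.exists_deriv_eq le_rfl hx
  have h4 := hU.strictAntiOn_deriv (Set.mem_Ioi.2 h1) hx h2
  rw [hU.zero, sub_zero, sub_zero] at h
  rw [h, mul_comm]
  exact mul_le_mul_of_nonneg_right h4.le hx.le

/-- Marginal utility decays at least like the power `x ^ (p - 1)`. -/
lemma exists_le_of_le_deriv (hU : SmoothUtility U) : ∃ C r : ℝ, 0 ≤ C ∧ 0 < r ∧
    ∀ z y, 0 < y → Real.exp z ≤ deriv U y → y ≤ 1 + C * Real.exp (-r * z) := by
  obtain ⟨L, p, hL, hp0, hp1, hg⟩ := hU.growth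
  have hq : 0 < 1 - p := by linarith
  refine ⟨(2 * L) ^ (1 - p)⁻¹, (1 - p)⁻¹, by positivity, by positivity, fun z y hy hzy => ?_⟩
  rcases le_or_gt y 1 with h1 | h1
  · have : 0 ≤ (2 * L) ^ (1 - p)⁻¹ * Real.exp (-(1 - p)⁻¹ * z) := by positivity
    linarith
  -- `y U'(y) ≤ U(y) ≤ L (1 + y ^ p) ≤ 2 L y ^ p` for `y ≥ 1`
  · have h2 : y * Real.exp z ≤ 2 * L * y ^ p := by
      have := (hg y hy.le).2
      have h3 := hU.mul_deriv_le hy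
      have h4 := mul_le_mul_of_nonneg_left hzy hy.le
      have h5 : 1 ≤ y ^ p := Real.one_le_rpow h1.le hp0.le
      nlinarith
    have h3 : y ^ (1 - p) ≤ 2 * L * Real.exp (-z) := by
      rw [Real.rpow_sub hy, Real.rpow_one, div_le_iff₀ (by positivity), Real.exp_neg, mul_assoc,
        mul_comm _ (y ^ p), ← mul_assoc, ← div_eq_mul_inv, le_div_iff₀ (Real.exp_pos _)]
      exact h2
    have h4 := Real.rpow_le_rpow (by positivity) h3 (inv_nonneg.2 hq.le)
    rw [Real.rpow_rpow_inv hy.le hq.ne', Real.mul_rpow (by positivity) (by positivity),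
      ← Real.exp_mul] at h4
    rw [show -(1 - p)⁻¹ * z = -z * (1 - p)⁻¹ by ring]
    linarith

end SmoothUtility

/-- The generalized inverse of marginal utility in logarithmic dual variables: `Φ(z)` solves
`U'(Φ(z)) = e ^ z` where this is possible, and vanishes where `e ^ z` exceeds every value of `U'`.
The point `0` is inserted so that the set is never empty. -/
noncomputable def inverseMarginal (U : ℝ → ℝ) (z : ℝ) : ℝ :=
  sSup (insert 0 {x | 0 < x ∧ Real.exp z ≤ deriv U x})

/-- The convex conjugate `sup (U x - e ^ z x)` of the utility at `e ^ z`, written through the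
maximizer. -/
noncomputable def conjugate (U : ℝ → ℝ) (z : ℝ) : ℝ :=
  U (inverseMarginal U z) - Real.exp z * inverseMarginal U z

namespace SmoothUtility

lemma bddAbove_inverseMarginal (hU : SmoothUtility U) (z : ℝ) :
    BddAbove (insert 0 {x | 0 < x ∧ Real.exp z ≤ deriv U x}) := by
  obtain ⟨C, r, hC, -, h⟩ := hU.exists_le_of_le_deriv
  refine ⟨1 + C * Real.exp (-r * z), ?_⟩
  rintro x (rfl | hx)
  · positivity
  · exact h z x hx.1 hx.2

lemma inverseMarginal_nonneg (hU : SmoothUtility U) (z : ℝ) : 0 ≤ inverseMarginal U z :=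
  le_csSup (hU.bddAbove_inverseMarginal z) (Set.mem_insert _ _)

lemma exists_inverseMarginal_le (hU : SmoothUtility U) : ∃ C r : ℝ, 0 ≤ C ∧ 0 < r ∧
    ∀ z, inverseMarginal U z ≤ C * (1 + Real.exp (-r * z)) := by
  obtain ⟨C, r, hC, hr, h⟩ := hU.exists_le_of_le_deriv
  refine ⟨1 + C, r, by positivity, hr, fun z => csSup_le (Set.insert_nonempty _ _) ?_⟩
  have h0 := Real.exp_pos (-r * z)
  rintro x (rfl | hx)
  · positivity
  · nlinarith [h z x hx.1 hx.2]

lemma le_inverseMarginal (hU : SmoothUtility U) {z x : ℝ} (hx : 0 < x)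
    (h : Real.exp z ≤ deriv U x) : x ≤ inverseMarginal U z :=
  le_csSup (hU.bddAbove_inverseMarginal z) (Set.mem_insert_of_mem _ ⟨hx, h⟩)

lemma exp_lt_deriv (hU : SmoothUtility U) {z x : ℝ} (hx : 0 < x) (h : x < inverseMarginal U z) :
    Real.exp z < deriv U x := by
  obtain ⟨y, hy, hxy⟩ := exists_lt_of_lt_csSup (Set.insert_nonempty _ _) h
  rcases hy with rfl | hy
  · linarith
  · exact hy.2.trans_lt (hU.strictAntiOn_deriv hx hy.1 hxy)

lemma deriv_lt_exp (hU : SmoothUtility U) {z x : ℝ} (h : inverseMarginal U z < x) :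
    deriv U x < Real.exp z := by
  by_contra! hc
  exact absurd (hU.le_inverseMarginal ((hU.inverseMarginal_nonneg z).trans_lt h) hc) (not_le.2 h)

lemma inverseMarginal_le (hU : SmoothUtility U) {z x : ℝ} (hx : 0 < x)
    (h : deriv U x ≤ Real.exp z) : inverseMarginal U z ≤ x := by
  by_contra! hc
  exact absurd (hU.exp_lt_deriv hx hc) (not_lt.2 h)

lemma inverseMarginal_log_deriv (hU : SmoothUtility U) {x : ℝ} (hx : 0 < x) :
    inverseMarginal U (Real.log (deriv U x)) = x :=
  le_antisymm (hU.inverseMarginal_le hx (Real.exp_log (hU.deriv_pos hx)).ge)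
    (hU.le_inverseMarginal hx (Real.exp_log (hU.deriv_pos hx)).le)

lemma antitone_inverseMarginal (hU : SmoothUtility U) : Antitone (inverseMarginal U) :=
  fun _ _ h => csSup_le_csSup (hU.bddAbove_inverseMarginal _) (Set.insert_nonempty _ _)
    (Set.insert_subset_insert fun _ hx => ⟨hx.1, (Real.exp_le_exp.2 h).trans hx.2⟩)

lemma continuous_inverseMarginal (hU : SmoothUtility U) : Continuous (inverseMarginal U) := by
  refine continuous_iff_continuousAt.2 fun z => tendsto_order.2 ⟨fun a ha => ?_, fun a ha => ?_⟩
  · rcases lt_or_ge a 0 with h0 | h0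
    · exact Eventually.of_forall fun w => h0.trans_le (hU.inverseMarginal_nonneg w)
    · obtain ⟨c, hac, hc⟩ := exists_between ha
      have h1 := hU.exp_lt_deriv (h0.trans_lt hac) hc
      filter_upwards
        [Real.continuous_exp.continuousAt.eventually_lt continuousAt_const h1] with w hw
      exact hac.trans_le (hU.le_inverseMarginal (h0.trans_lt hac) hw.le)
  · obtain ⟨c, hc, hca⟩ := exists_between ha
    have h1 := hU.deriv_lt_exp hc
    filter_upwards [continuousAt_const.eventually_lt Real.continuous_exp.continuousAt h1] with w hw
    exact (hU.inverseMarginal_le ((hU.inverseMarginal_nonneg z).trans_lt hc) hw.le).trans_lt hca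

lemma deriv_inverseMarginal (hU : SmoothUtility U) {z : ℝ} (hz : 0 < inverseMarginal U z) :
    deriv U (inverseMarginal U z) = Real.exp z := by
  have hc := hU.continuousAt_deriv hz
  refine le_antisymm ?_ ?_
  · refine le_of_tendsto (hc.tendsto.mono_left
      (nhdsWithin_le_nhds (s := Set.Ioi (inverseMarginal U z)))) ?_
    filter_upwards [self_mem_nhdsWithin] with x hx using (hU.deriv_lt_exp hx).le
  · refine ge_of_tendsto (hc.tendsto.mono_left
      (nhdsWithin_le_nhds (s := Set.Iio (inverseMarginal U z)))) ?_
    filter_upwards [self_mem_nhdsWithin, nhdsWithin_le_nhds (isOpen_Ioi.mem_nhds hz)] with x hx hx0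
    exact (hU.exp_lt_deriv hx0 hx).le

lemma inverseMarginal_lt (hU : SmoothUtility U) {z z' : ℝ} (hz : 0 < inverseMarginal U z)
    (h : z < z') : inverseMarginal U z' < inverseMarginal U z := by
  refine lt_of_le_of_ne (hU.antitone_inverseMarginal h.le) fun he => h.ne ?_
  rw [← Real.exp_eq_exp, ← hU.deriv_inverseMarginal hz, ← hU.deriv_inverseMarginal (he ▸ hz), he]

lemma tendsto_inverseMarginal (hU : SmoothUtility U) :
    Tendsto (inverseMarginal U) atTop (𝓝 0) := by
  refine tendsto_order.2 ⟨fun a ha => Eventually.of_forall fun w =>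
    ha.trans_le (hU.inverseMarginal_nonneg w), fun a ha => ?_⟩
  filter_upwards [eventually_gt_atTop (Real.log (deriv U a))] with w hw
  have := hU.inverseMarginal_lt (by rwa [hU.inverseMarginal_log_deriv ha]) hw
  rwa [hU.inverseMarginal_log_deriv ha] at this

/-- Fenchel's inequality. -/
lemma le_conjugate_add (hU : SmoothUtility U) (z : ℝ) {x : ℝ} (hx : 0 ≤ x) :
    U x ≤ conjugate U z + Real.exp z * x := by
  rw [conjugate]
  rcases lt_trichotomy x (inverseMarginal U z) with h | h | h
  · obtain ⟨c, h1, h2, h3⟩ := hU.exists_deriv_eq hx h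
    have := hU.exp_lt_deriv (hx.trans_lt h1) h2
    nlinarith
  · rw [← h]
    linarith
  · obtain ⟨c, h1, h2, h3⟩ := hU.exists_deriv_eq (hU.inverseMarginal_nonneg z) h
    have := hU.deriv_lt_exp h1
    nlinarith

lemma conjugate_nonneg (hU : SmoothUtility U) (z : ℝ) : 0 ≤ conjugate U z := by
  simpa [hU.zero] using hU.le_conjugate_add z le_rfl

lemma continuous_conjugate (hU : SmoothUtility U) : Continuous (conjugate U) :=
  (hU.continuous_comp hU.continuous_inverseMarginal hU.inverseMarginal_nonneg).sub
    (Real.continuous_exp.mul hU.continuous_inverseMarginal)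

lemma exists_conjugate_le (hU : SmoothUtility U) : ∃ C r : ℝ, 0 ≤ C ∧ 0 < r ∧
    ∀ z, conjugate U z ≤ C * (1 + Real.exp (-r * z)) := by
  obtain ⟨C, r, hC, hr, h⟩ := hU.exists_inverseMarginal_le
  obtain ⟨L, p, hL, hp0, hp1, hg⟩ := hU.growth
  refine ⟨L * (2 + C), r, by positivity, hr, fun z => ?_⟩
  have h0 := hU.inverseMarginal_nonneg z
  have h1 := (hg _ h0).2
  have h2 : inverseMarginal U z ^ p ≤ 1 + inverseMarginal U z := by
    rcases le_or_gt (inverseMarginal U z) 1 with h3 | h3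
    · linarith [Real.rpow_le_one h0 h3 hp0.le]
    · have := Real.rpow_le_rpow_of_exponent_le h3.le hp1.le
      rw [Real.rpow_one] at this
      linarith
  have h3 : conjugate U z ≤ U (inverseMarginal U z) := by
    have : 0 ≤ Real.exp z * inverseMarginal U z := by positivity
    rw [conjugate]
    linarith
  refine h3.trans (h1.trans ?_)
  rw [mul_assoc]
  refine mul_le_mul_of_nonneg_left ?_ hL.le
  have h4 := h z
  have h5 := Real.exp_pos (-r * z)
  nlinarith

/-- If `ln U'` is convex, then so is its (generalized) inverse. -/
lemma convexOn_inverseMarginal (hU : SmoothUtility U)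
    (hconv : ConvexOn ℝ (Set.Ioi 0) fun x => Real.log (deriv U x)) :
    ConvexOn ℝ Set.univ (inverseMarginal U) := by
  refine ⟨convex_univ, fun z₁ _ z₂ _ a b ha hb hab => le_of_forall_pos_le_add fun δ hδ => ?_⟩
  -- shifting by `δ` moves the points into `(0, ∞)`, where `ln U'` is defined and convex, even if
  -- `Φ` vanishes
  have hx : ∀ z, 0 < inverseMarginal U z + δ := fun z => by
    linarith [hU.inverseMarginal_nonneg z]
  have hlog : ∀ z, Real.log (deriv U (inverseMarginal U z + δ)) ≤ z := fun z => by
    rw [Real.log_le_iff_le_exp (hU.deriv_pos (hx z))]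
    exact (hU.deriv_lt_exp (by linarith)).le
  have h1 := hconv.2 (hx z₁) (hx z₂) ha hb hab
  have hX : a • (inverseMarginal U z₁ + δ) + b • (inverseMarginal U z₂ + δ) =
      a • inverseMarginal U z₁ + b • inverseMarginal U z₂ + δ := by
    simp only [smul_eq_mul]
    linear_combination δ * hab
  have hX0 := (convex_Ioi (0 : ℝ)) (hx z₁) (hx z₂) ha hb hab
  rw [hX] at h1 hX0
  refine hU.inverseMarginal_le hX0 ((Real.log_le_iff_le_exp (hU.deriv_pos hX0)).1 (h1.trans ?_))
  exact add_le_add (mul_le_mul_of_nonneg_left (hlog z₁) ha)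
    (mul_le_mul_of_nonneg_left (hlog z₂) hb)

/-- A strictly decreasing marginal utility with concave logarithm decays exponentially, which
would make the utility bounded. -/
lemma not_concaveOn_log_deriv (hU : SmoothUtility U) :
    ¬ ConcaveOn ℝ (Set.Ioi 0) fun x => Real.log (deriv U x) := by
  intro hc
  set f : ℝ → ℝ := fun x => Real.log (deriv U x) with hf
  have hlt : f 2 < f 1 := Real.log_lt_log (hU.deriv_pos two_pos)
    (hU.strictAntiOn_deriv (Set.mem_Ioi.2 one_pos) (Set.mem_Ioi.2 two_pos) one_lt_two)
  set c := f 1 - f 2 with hcdef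
  have hc0 : 0 < c := sub_pos.2 hlt
  -- concavity extends the negative slope of `ln U'` between `1` and `2` to the right
  have hbound : ∀ x, 2 < x → deriv U x ≤ Real.exp (f 2 - c * (x - 2)) := by
    intro x hx
    have h1 := hc.slope_anti_adjacent (x := 1) (y := 2) (z := x) (Set.mem_Ioi.2 one_pos)
      (Set.mem_Ioi.2 (by linarith)) one_lt_two hx
    rw [div_le_iff₀ (by linarith)] at h1
    rw [← Real.log_le_iff_le_exp (hU.deriv_pos (by linarith))]
    change f x ≤ _
    norm_num at h1
    linarith
  -- `g` is decreasing and dominates `U`, which would therefore be bounded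
  set g : ℝ → ℝ := fun x => U x + c⁻¹ * Real.exp (f 2 - c * (x - 2)) with hg
  have hg' : ∀ x, 0 < x → HasDerivAt g (deriv U x - Real.exp (f 2 - c * (x - 2))) x := by
    intro x hx
    have h1 : HasDerivAt (fun x => f 2 - c * (x - 2)) (-c) x := by
      simpa using (((hasDerivAt_id x).sub_const 2).const_mul c).const_sub (f 2)
    refine ((hU.hasDerivAt hx).add (h1.exp.const_mul c⁻¹)).congr_deriv ?_
    field_simp
    ring
  have hanti : AntitoneOn g (Set.Ici 2) := by
    refine antitoneOn_of_deriv_nonpos (convex_Ici 2) (fun x hx => ?_) (fun x hx => ?_)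
      fun x hx => ?_
    · exact (hg' x (two_pos.trans_le hx)).continuousAt.continuousWithinAt
    · rw [interior_Ici] at hx
      exact (hg' x (two_pos.trans hx)).differentiableAt.differentiableWithinAt
    · rw [interior_Ici] at hx
      rw [(hg' x (two_pos.trans hx)).deriv]
      linarith [hbound x hx]
  obtain ⟨x, hx1, hx2⟩ := ((hU.tendsto_atTop.eventually_gt_atTop (g 2)).and
    (eventually_ge_atTop 2)).exists
  have h1 := hanti (Set.mem_Ici.2 le_rfl) hx2 hx2
  have h2 : 0 ≤ c⁻¹ * Real.exp (f 2 - c * (x - 2)) := by positivity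
  have h3 : g x = U x + c⁻¹ * Real.exp (f 2 - c * (x - 2)) := rfl
  linarith

end SmoothUtility

end InverseMarginal


/-! ### Gaussian averages of functions of exponential growth -/

section GaussianAverage

/-- Nonnegative continuous functions on `ℝ` that are bounded at `+∞` and grow at most exponentially
at `-∞`. -/
structure ExpGrowth (f : ℝ → ℝ) : Prop where
  continuous : Continuous f
  nonneg : ∀ z, 0 ≤ f z
  bound : ∃ C r : ℝ, 0 ≤ C ∧ 0 < r ∧ ∀ z, f z ≤ C * (1 + Real.exp (-r * z))

variable {f g : ℝ → ℝ}

lemma ExpGrowth.continuous_add (hf : ExpGrowth f) (z : ℝ) : Continuous fun u => f (z + u) :=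
  hf.continuous.comp (by fun_prop)

lemma ExpGrowth.integrable (hf : ExpGrowth f) (z m : ℝ) (w : ℝ≥0) :
    Integrable (fun u => f (z + u)) (gaussianReal m w) := by
  obtain ⟨C, r, hC, hr, h⟩ := hf.bound
  have hi : Integrable (fun u => C * (1 + Real.exp (-r * z) * Real.exp (-r * u)))
      (gaussianReal m w) :=
    ((integrable_const _).add ((integrable_exp_mul_gaussianReal _).const_mul _)).const_mul _
  refine hi.mono' (hf.continuous_add z).aestronglyMeasurable (ae_of_all _ fun u => ?_)
  rw [Real.norm_of_nonneg (hf.nonneg _), ← Real.exp_add, ← mul_add]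
  exact h _

lemma ExpGrowth.continuous_integral_add (hf : ExpGrowth f) (m : ℝ) (w : ℝ≥0) :
    Continuous fun z => ∫ u, f (z + u) ∂gaussianReal m w := by
  obtain ⟨C, r, hC, hr, h⟩ := hf.bound
  refine continuous_iff_continuousAt.2 fun z₀ => ?_
  have hi : Integrable (fun u => C * (1 + Real.exp (-r * (z₀ - 1)) * Real.exp (-r * u)))
      (gaussianReal m w) :=
    ((integrable_const _).add ((integrable_exp_mul_gaussianReal _).const_mul _)).const_mul _
  refine continuousAt_of_dominated (Eventually.of_forall fun z =>
    (hf.integrable z m w).aestronglyMeasurable) ?_ hi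
    (ae_of_all _ fun u =>
      (hf.continuous.comp (by fun_prop : Continuous fun z => z + u)).continuousAt)
  filter_upwards [lt_mem_nhds (sub_one_lt z₀)] with z hz
  refine ae_of_all _ fun u => ?_
  rw [Real.norm_of_nonneg (hf.nonneg _), ← Real.exp_add, ← mul_add]
  refine (h _).trans (mul_le_mul_of_nonneg_left (add_le_add le_rfl (Real.exp_le_exp.2 ?_)) hC)
  nlinarith

lemma gaussianReal_eq_map_standard (m : ℝ) (w : ℝ≥0) :
    gaussianReal m w = (gaussianReal 0 1).map fun u => m + Real.sqrt w * u := by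
  have : (fun u => m + Real.sqrt w * u) = (fun x => m + x) ∘ fun u => Real.sqrt w * u := rfl
  rw [this, ← Measure.map_map (by fun_prop) (by fun_prop), gaussianReal_map_const_mul,
    gaussianReal_map_const_add]
  congr 1
  · simp
  · ext
    simp

/-- Averages over the log-normal family with drift `-w/2` depend continuously on `w`. -/
lemma ExpGrowth.continuous_integral_gaussianReal (hf : ExpGrowth f) (z : ℝ) :
    Continuous fun w : ℝ≥0 => ∫ u, f (z + u) ∂gaussianReal (-(w / 2 : ℝ)) w := by
  obtain ⟨C, r, hC, hr, h⟩ := hf.bound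
  have e : ∀ w : ℝ≥0, ∫ u, f (z + u) ∂gaussianReal (-(w / 2 : ℝ)) w =
      ∫ u, f (z + (-(w / 2 : ℝ) + Real.sqrt w * u)) ∂gaussianReal 0 1 := fun w => by
    rw [gaussianReal_eq_map_standard, integral_map (by fun_prop)
      (hf.continuous_add z).aestronglyMeasurable]
  simp only [e]
  refine continuous_iff_continuousAt.2 fun w₀ => ?_
  set R : ℝ := w₀ + 1 with hR
  have hR0 : 0 ≤ R := by positivity
  have hi : Integrable (fun u => C * (1 + Real.exp (-r * z + r * (R / 2)) *
      (Real.exp (r * Real.sqrt R * u) + Real.exp (-(r * Real.sqrt R) * u)))) (gaussianReal 0 1) :=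
    ((integrable_const _).add (((integrable_exp_mul_gaussianReal _).add
      (integrable_exp_mul_gaussianReal _)).const_mul _)).const_mul _
  refine continuousAt_of_dominated (Eventually.of_forall fun w =>
    (hf.continuous.comp (by fun_prop)).aestronglyMeasurable) ?_ hi
    (ae_of_all _ fun u => (hf.continuous.comp (by fun_prop :
      Continuous fun w : ℝ≥0 => z + (-(w / 2 : ℝ) + Real.sqrt w * u))).continuousAt)
  filter_upwards [gt_mem_nhds (lt_add_one w₀)] with w hw
  refine ae_of_all _ fun u => ?_
  have hwR : (w : ℝ) ≤ R := by
    rw [hR]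
    exact_mod_cast hw.le
  have hs := Real.sqrt_le_sqrt hwR
  rw [Real.norm_of_nonneg (hf.nonneg _)]
  refine (h _).trans (mul_le_mul_of_nonneg_left (add_le_add le_rfl ?_) hC)
  have h1 : -r * (z + (-(w / 2 : ℝ) + Real.sqrt w * u)) ≤
      (-r * z + r * (R / 2)) + r * Real.sqrt R * |u| := by
    have h2 : -u * Real.sqrt w ≤ |u| * Real.sqrt R :=
      mul_le_mul (neg_le_abs u) hs (Real.sqrt_nonneg _) (abs_nonneg _)
    nlinarith
  refine (Real.exp_le_exp.2 h1).trans ?_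
  rw [Real.exp_add]
  refine mul_le_mul_of_nonneg_left ?_ (Real.exp_nonneg _)
  rcases abs_cases u with ⟨hu, -⟩ | ⟨hu, -⟩ <;> rw [hu]
  · linarith [Real.exp_pos (-(r * Real.sqrt R) * u)]
  · rw [mul_neg, ← neg_mul]
    linarith [Real.exp_pos (r * Real.sqrt R * u)]

/-- Nondegenerate Gaussian laws have full support, so averaging is strictly monotone. -/
lemma integral_lt_integral_gaussianReal {m : ℝ} {w : ℝ≥0} (hw : w ≠ 0) (hf : Continuous f)
    (hg : Continuous g) (hfi : Integrable f (gaussianReal m w))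
    (hgi : Integrable g (gaussianReal m w)) (hle : ∀ u, f u ≤ g u) {u : ℝ} (hlt : f u < g u) :
    ∫ u, f u ∂gaussianReal m w < ∫ u, g u ∂gaussianReal m w := by
  rw [← sub_pos, ← integral_sub hgi hfi,
    integral_pos_iff_support_of_nonneg (fun u => sub_nonneg.2 (hle u)) (hgi.sub hfi)]
  have := (gaussianReal_absolutelyContinuous' m hw).isOpenPosMeasure
  exact ((hg.sub hf).isOpen_support).measure_pos _ ⟨u, (sub_pos.2 hlt).ne'⟩

end GaussianAverage

/-! ### The optimal wealth as a function of the dual variable -/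

section DualWealth

variable {U : ℝ → ℝ} {v : ℝ≥0}

/-- The initial capital `∫ Φ(z + g) N(v/2, v)(dg)` for which `e ^ z` is the optimal multiplier,
where `v` is the remaining variance of the log state price density and `Φ` the inverse of
`ln U'`. -/
noncomputable def dualWealth (U : ℝ → ℝ) (v : ℝ≥0) (z : ℝ) : ℝ :=
  ∫ g, inverseMarginal U (z + g) ∂gaussianReal (v / 2) v

/-- The dual value `∫ Ψ(z + g) N(-v/2, v)(dg)`, where `Ψ` is the convex conjugate of the utility. -/
noncomputable def dualValue (U : ℝ → ℝ) (v : ℝ≥0) (z : ℝ) : ℝ :=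
  ∫ g, conjugate U (z + g) ∂gaussianReal (-(v / 2 : ℝ)) v

namespace SmoothUtility

lemma expGrowth_inverseMarginal (hU : SmoothUtility U) : ExpGrowth (inverseMarginal U) :=
  ⟨hU.continuous_inverseMarginal, hU.inverseMarginal_nonneg, hU.exists_inverseMarginal_le⟩

lemma expGrowth_conjugate (hU : SmoothUtility U) : ExpGrowth (conjugate U) :=
  ⟨hU.continuous_conjugate, hU.conjugate_nonneg, hU.exists_conjugate_le⟩

/-- Although `Φ` may vanish, its Gaussian average does not. -/
lemma dualWealth_pos (hU : SmoothUtility U) (hv : v ≠ 0) (z : ℝ) : 0 < dualWealth U v z := by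
  have h := integral_lt_integral_gaussianReal (m := v / 2) hv continuous_const
    (hU.continuous_inverseMarginal.comp (by fun_prop : Continuous fun g => z + g))
    (integrable_const 0) (hU.expGrowth_inverseMarginal.integrable z _ _)
    (fun g => hU.inverseMarginal_nonneg _) (u := Real.log (deriv U 1) - z) (by
      simp [hU.inverseMarginal_log_deriv one_pos])
  rwa [integral_zero] at h

lemma strictAnti_dualWealth (hU : SmoothUtility U) (hv : v ≠ 0) : StrictAnti (dualWealth U v) := by
  intro z z' h
  refine integral_lt_integral_gaussianReal hv
    (hU.continuous_inverseMarginal.comp (by fun_prop))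
    (hU.continuous_inverseMarginal.comp (by fun_prop))
    (hU.expGrowth_inverseMarginal.integrable z' _ _) (hU.expGrowth_inverseMarginal.integrable z _ _)
    (fun g => hU.antitone_inverseMarginal (by linarith)) (u := Real.log (deriv U 1) - z)
    (hU.inverseMarginal_lt ?_ (by linarith))
  rw [add_sub_cancel, hU.inverseMarginal_log_deriv one_pos]
  exact one_pos

lemma tendsto_dualWealth (hU : SmoothUtility U) (v : ℝ≥0) :
    Tendsto (dualWealth U v) atTop (𝓝 0) := by
  have h := tendsto_integral_filter_of_dominated_convergence (l := atTop)
    (μ := gaussianReal (v / 2) v) (F := fun z g => inverseMarginal U (z + g)) (f := fun _ => 0)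
    (fun g => inverseMarginal U (0 + g))
    (Eventually.of_forall fun z =>
      (hU.expGrowth_inverseMarginal.integrable z _ _).aestronglyMeasurable)
    (by
      filter_upwards [eventually_ge_atTop 0] with z hz
      refine ae_of_all _ fun g => ?_
      rw [Real.norm_of_nonneg (hU.inverseMarginal_nonneg _)]
      exact hU.antitone_inverseMarginal (by linarith))
    (hU.expGrowth_inverseMarginal.integrable 0 _ _)
    (ae_of_all _ fun g => hU.tendsto_inverseMarginal.comp
      (tendsto_atTop_add_const_right _ g tendsto_id))
  rw [integral_zero] at h
  exact h

/-- The dual wealth is unbounded: it is at least `Φ(z)` times the probability of `(-∞, 0]`, and `Φ`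
takes every positive value. -/
lemma exists_le_dualWealth (hU : SmoothUtility U) (hv : v ≠ 0) {x : ℝ} (hx : 0 < x) :
    ∃ z, x ≤ dualWealth U v z := by
  set c := (gaussianReal (v / 2) v).real (Set.Iic 0) with hc
  have hc0 : 0 < c := by
    refine ENNReal.toReal_pos (fun h => ?_) (measure_ne_top _ _)
    have h1 := (gaussianReal_absolutelyContinuous' (v / 2) hv) h
    simp at h1
  have hy : 0 < x / c := by positivity
  refine ⟨Real.log (deriv U (x / c)), ?_⟩
  have h1 : ∫ g, (Set.Iic (0 : ℝ)).indicator (fun _ => x / c) g ∂gaussianReal (v / 2) v = x := by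
    rw [integral_indicator_const _ measurableSet_Iic, ← hc, smul_eq_mul]
    field_simp
  refine h1.symm.le.trans ?_
  refine integral_mono ((integrable_const _).indicator measurableSet_Iic)
    (hU.expGrowth_inverseMarginal.integrable _ _ _) fun g => ?_
  by_cases hg : g ∈ Set.Iic (0 : ℝ)
  · rw [Set.indicator_of_mem hg]
    nth_rewrite 1 [← hU.inverseMarginal_log_deriv hy]
    exact hU.antitone_inverseMarginal (by linarith [Set.mem_Iic.1 hg])
  · rw [Set.indicator_of_notMem hg]
    exact hU.inverseMarginal_nonneg _

lemma exists_dualWealth_eq (hU : SmoothUtility U) (hv : v ≠ 0) {x : ℝ} (hx : 0 < x) :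
    ∃ z, dualWealth U v z = x := by
  obtain ⟨z₁, h1⟩ := hU.exists_le_dualWealth hv hx
  obtain ⟨z₂, h2⟩ := ((hU.tendsto_dualWealth v).eventually_lt_const hx).exists
  exact mem_range_of_exists_le_of_exists_ge
    (hU.expGrowth_inverseMarginal.continuous_integral_add _ _) ⟨z₂, h2.le⟩ ⟨z₁, h1⟩

/-- A convex function that is affine across an interior point of every interval of a fixed shape is
affine along all arithmetic progressions of some step, which is impossible for the
inverse of marginal utility: it is bounded below and strictly decreasing where it is positive. -/
lemma exists_inverseMarginal_lt (hU : SmoothUtility U)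
    (hΦ : ConvexOn ℝ Set.univ (inverseMarginal U)) {a b D : ℝ} (ha : 0 < a) (hb : 0 < b)
    (hab : a + b = 1) (hD : 0 < D) : ∃ y, inverseMarginal U (y + b * D) <
      a * inverseMarginal U y + b * inverseMarginal U (y + D) := by
  by_contra! hcon
  set Φ := inverseMarginal U with hΦdef
  have haD : 0 < a * D := by positivity
  have hbD : 0 < b * D := by positivity
  -- the slopes on both sides of the interior point agree
  have heq : ∀ y, (Φ (y + D) - Φ (y + b * D)) / (a * D) = (Φ y - Φ (y + b * D)) / (-(b * D)) := by
    intro y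
    have h1 := hΦ.2 (Set.mem_univ y) (Set.mem_univ (y + D)) ha.le hb.le hab
    have e : a • y + b • (y + D) = y + b * D := by
      simp only [smul_eq_mul]
      linear_combination y * hab
    rw [e] at h1
    simp only [smul_eq_mul] at h1
    have h2 := le_antisymm h1 (hcon y)
    rw [h2]
    field_simp
    have hae : a = 1 - b := by linarith
    rw [hae]
    ring
  -- with the shorter of the two sides as step, a secant over the longer side is comparable with one
  -- over the shorter side, so the increments over steps of length `d` do not increase
  obtain ⟨d, hd, hstep⟩ : ∃ d : ℝ, 0 < d ∧ ∀ y, Φ (y + d + d) - Φ (y + d) ≤ Φ (y + d) - Φ y := by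
    rcases le_total b a with hle | hle
    · refine ⟨b * D, hbD, fun y => ?_⟩
      have h1 := hΦ.secant_mono (a := y + b * D) (x := y + b * D + b * D) (y := y + D) trivial
        trivial trivial (by linarith) (by nlinarith) (by nlinarith)
      rw [show y + D - (y + b * D) = a * D by linear_combination -D * hab, heq y,
        add_sub_cancel_left, div_neg, ← neg_div, div_le_div_iff_of_pos_right hbD] at h1
      linarith
    · refine ⟨a * D, haD, fun y => ?_⟩
      have h1 := hΦ.secant_mono (a := y + a * D) (x := y + a * D - b * D) (y := y) trivial
        trivial trivial (by linarith) (by linarith) (by nlinarith)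
      have h2 := heq (y + a * D - b * D)
      rw [show y + a * D - b * D + D = y + a * D + a * D by linear_combination -D * hab,
        sub_add_cancel] at h2
      rw [show y + a * D - b * D - (y + a * D) = -(b * D) by ring, ← h2,
        show y - (y + a * D) = -(a * D) by ring, div_neg, ← neg_div,
        div_le_div_iff_of_pos_right haD] at h1
      linarith
  -- starting from a point where `Φ` decreases strictly, `Φ` then becomes negative
  set y := Real.log (deriv U 1) with hy
  have hy1 : Φ y = 1 := hU.inverseMarginal_log_deriv one_pos
  have hlt : Φ (y + d) < Φ y := hU.inverseMarginal_lt (by rw [← hΦdef, hy1]; exact one_pos)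
    (by linarith)
  have hinc : ∀ k : ℕ, Φ (y + k * d + d) - Φ (y + k * d) ≤ Φ (y + d) - Φ y := by
    intro k
    induction k with
    | zero => simp
    | succ k ih =>
      have := hstep (y + k * d)
      rw [show y + ((k + 1 : ℕ) : ℝ) * d = y + k * d + d by push_cast; ring]
      linarith
  have hsum : ∀ k : ℕ, Φ (y + k * d) ≤ 1 - k * (Φ y - Φ (y + d)) := by
    intro k
    induction k with
    | zero => simp [hy1]
    | succ k ih =>
      have := hinc k
      rw [show y + ((k + 1 : ℕ) : ℝ) * d = y + k * d + d by push_cast; ring]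
      push_cast
      linarith
  obtain ⟨k, hk⟩ := exists_nat_gt (1 / (Φ y - Φ (y + d)))
  rw [div_lt_iff₀ (sub_pos.2 hlt)] at hk
  have h1 := hsum k
  have h2 : 0 ≤ Φ (y + k * d) := hU.inverseMarginal_nonneg _
  linarith

/-- Averaging against a law of full support turns convexity of `Φ` into strict convexity, since for
each triple of collinear arguments the inequality is strict after some translation. -/
lemma strictConvexOn_dualWealth (hU : SmoothUtility U) (hv : v ≠ 0)
    (hΦ : ConvexOn ℝ Set.univ (inverseMarginal U)) :
    StrictConvexOn ℝ Set.univ (dualWealth U v) := by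
  refine LinearOrder.strictConvexOn_of_lt convex_univ fun z₁ _ z₂ _ hz a b ha hb hab => ?_
  obtain ⟨y, hy⟩ := hU.exists_inverseMarginal_lt hΦ ha hb hab (sub_pos.2 hz)
  have hI := fun z => hU.expGrowth_inverseMarginal.integrable z (v / 2) v
  have hC := fun z => hU.continuous_inverseMarginal.comp (by fun_prop : Continuous fun g => z + g)
  simp only [smul_eq_mul, dualWealth]
  rw [← integral_const_mul, ← integral_const_mul,
    ← integral_add ((hI z₁).const_mul a) ((hI z₂).const_mul b)]
  refine integral_lt_integral_gaussianReal hv (hC _)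
    (((hC z₁).const_mul a).add ((hC z₂).const_mul b)) (hI _)
    (((hI z₁).const_mul a).add ((hI z₂).const_mul b)) (fun g => ?_) (u := y - z₁) ?_
  · have h1 := hΦ.2 (Set.mem_univ (z₁ + g)) (Set.mem_univ (z₂ + g)) ha.le hb.le hab
    rw [show a • (z₁ + g) + b • (z₂ + g) = a * z₁ + b * z₂ + g by
      simp only [smul_eq_mul]; linear_combination g * hab] at h1
    exact h1
  · rw [show a * z₁ + b * z₂ + (y - z₁) = y + b * (z₂ - z₁) by linear_combination z₁ * hab,
      show z₁ + (y - z₁) = y by ring, show z₂ + (y - z₁) = y + (z₂ - z₁) by ring]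
    exact hy

/-- Expected utility of the optimal terminal wealth. The measure change `e ^ g` turns `N(-v/2, v)`
into `N(v/2, v)`. -/
lemma integral_utility_inverseMarginal (hU : SmoothUtility U) (v : ℝ≥0) (z : ℝ) :
    Integrable (fun g => U (inverseMarginal U (z + g))) (gaussianReal (-(v / 2 : ℝ)) v) ∧
    ∫ g, U (inverseMarginal U (z + g)) ∂gaussianReal (-(v / 2 : ℝ)) v =
      dualValue U v z + Real.exp z * dualWealth U v z := by
  have e : (fun g => U (inverseMarginal U (z + g))) = fun g => conjugate U (z + g) +
      Real.exp z * (Real.exp (1 * g - (1 * -(v / 2 : ℝ) + 1 ^ 2 * v / 2)) *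
        inverseMarginal U (z + g)) := by
    ext g
    rw [conjugate, show (1 : ℝ) * g - (1 * -(v / 2 : ℝ) + 1 ^ 2 * v / 2) = g by ring, Real.exp_add]
    ring
  have e2 : -(v / 2 : ℝ) + 1 * v = v / 2 := by ring
  have hi := hU.expGrowth_conjugate.integrable z (-(v / 2 : ℝ)) v
  have hj := (integrable_exp_mul_gaussianReal_iff (-(v / 2 : ℝ)) 1 v _).2
    (hU.expGrowth_inverseMarginal.integrable z (-(v / 2 : ℝ) + 1 * v) v)
  rw [e]
  refine ⟨hi.add (hj.const_mul _), ?_⟩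
  rw [integral_add hi (hj.const_mul _), integral_const_mul, integral_exp_mul_gaussianReal, e2]
  rfl

end SmoothUtility

end DualWealth

/-! ### Duality for the value function -/

section Duality

variable {Ω : Type*} {mΩ : MeasurableSpace Ω} {n : ℕ} {P : Measure Ω}
  {W : ℝ≥0 → Ω → EuclideanSpace ℝ (Fin n)} {hW : IsStandardBrownian W P}
  {b : ℝ≥0 → EuclideanSpace ℝ (Fin n)} {σ : ℝ≥0 → Matrix (Fin n) (Fin n) ℝ}
  {K : ProperCone ℝ (EuclideanSpace ℝ (Fin n))} {T t v : ℝ≥0} {U : ℝ → ℝ}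

/-- Weak duality. -/
theorem SmoothUtility.valueFunction_le_dualValue [IsProbabilityMeasure P] [P.IsComplete]
    (hU : SmoothUtility U) (hσ_det : ∀ s ∈ Set.Icc 0 T, IsUnit (σ s).det)
    (hθ : ParabolicityAssumption b σ K T) (htT : t ≤ T)
    (hv : v = clock (stoppedThetaHat b σ K T) T - clock (stoppedThetaHat b σ K T) t)
    {x : ℝ} (hx : 0 < x) (z : ℝ) :
    valueFunction P (brownianFiltration P W hW.measurable) W b σ K U T t x ≤
      ENNReal.ofReal (dualValue U v z + Real.exp z * x) :=
  valueFunction_le (hW := hW) hσ_det hθ hU.toUtilityAssumption htT hx hv hU.continuous_conjugate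
    hU.conjugate_nonneg (fun ζ _ ha => hU.le_conjugate_add ζ ha)
    (fun m w => by simpa using hU.expGrowth_conjugate.integrable 0 m w)
    (hU.expGrowth_conjugate.continuous_integral_gaussianReal z)

/-- No duality gap: `Φ` of the dual variable plus the log state price density is a nondecreasing
payoff of the drifted Wiener integral, which is replicated from the initial capital
`dualWealth U v z`. -/
theorem SmoothUtility.le_valueFunction_dualWealth [IsProbabilityMeasure P] [P.IsComplete]
    (hU : SmoothUtility U) (hσ : ContinuousOn σ (Set.Icc 0 T))
    (hσ_det : ∀ s ∈ Set.Icc 0 T, IsUnit (σ s).det)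
    (hθ : ParabolicityAssumption b σ K T) (htT : t < T)
    (hv : v = clock (stoppedThetaHat b σ K T) T - clock (stoppedThetaHat b σ K T) t)
    (hv0 : v ≠ 0) (z : ℝ) :
    ENNReal.ofReal (dualValue U v z + Real.exp z * dualWealth U v z) ≤
      valueFunction P (brownianFiltration P W hW.measurable) W b σ K U T t (dualWealth U v z) := by
  -- in terms of the drifted Wiener integral `y`, the log state price density is `v / 2 - y`
  set ξ : ℝ → ℝ := fun y => inverseMarginal U (z + (v / 2 - y)) with hξ
  have hΦ := hU.expGrowth_inverseMarginal
  have hξc : Continuous ξ := hΦ.continuous.comp (by fun_prop)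
  have hlaw : ∀ c : ℝ, (gaussianReal 0 v).map (fun u => c - u) = gaussianReal c v := fun c => by
    rw [gaussianReal_map_const_sub, sub_zero]
  have hξint : ∫ u, ξ u ∂gaussianReal 0 v = dualWealth U v z := by
    rw [dualWealth, ← hlaw (v / 2), integral_map (by fun_prop)
      (hΦ.continuous_add z).aestronglyMeasurable]
  have hξi : Integrable ξ (gaussianReal 0 v) := by
    have h := hΦ.integrable z (v / 2) v
    rw [← hlaw, integrable_map_measure (hΦ.continuous_add z).aestronglyMeasurable
      (by fun_prop)] at h
    exact h
  have h := lintegral_le_valueFunction_of_monotone (hW := hW) hσ hσ_det hθ hU.toUtilityAssumption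
    htT hv (fun y y' hy => hU.antitone_inverseMarginal (by linarith)) hξc
    (fun y => hU.inverseMarginal_nonneg _) hξi (by rw [hξint]; exact hU.dualWealth_pos hv0 z)
  rw [hξint] at h
  refine le_trans (le_of_eq ?_) h
  obtain ⟨hi, he⟩ := hU.integral_utility_inverseMarginal v z
  have hUc : Continuous fun g => U (inverseMarginal U (z + g)) :=
    hU.continuous_comp (hΦ.continuous_add z) fun y => hU.inverseMarginal_nonneg _
  rw [← he, ofReal_integral_eq_lintegral_ofReal hi (ae_of_all _ fun g => by
      obtain ⟨L, p, -, -, -, hg⟩ := hU.growth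
      exact (hg _ (hU.inverseMarginal_nonneg _)).1),
    ← hlaw (-(v / 2 : ℝ)), lintegral_map hUc.measurable.ennreal_ofReal (by fun_prop)]
  refine lintegral_congr fun u => ?_
  ring_nf

end Duality


/-! ### Supergradients and inverse functions -/

section Supergradient

/-- A function with a continuous selection `s` of supergradients is differentiable with derivative
`s`. -/
lemma hasDerivAt_of_supergradient {f s : ℝ → ℝ} {x : ℝ} (hs : ContinuousAt s x)
    (h₁ : ∀ᶠ y in 𝓝 x, f y ≤ f x + s x * (y - x)) (h₂ : ∀ᶠ y in 𝓝 x, f x ≤ f y + s y * (x - y)) :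
    HasDerivAt f (s x) x := by
  rw [hasDerivAt_iff_isLittleO, Asymptotics.isLittleO_iff]
  intro c hc
  filter_upwards [h₁, h₂, Metric.continuousAt_iff'.1 hs c hc] with y hy1 hy2 hy3
  rw [Real.dist_eq] at hy3
  rw [Real.norm_eq_abs, Real.norm_eq_abs, smul_eq_mul]
  have h3 : |s y - s x| * |y - x| ≤ c * |y - x| :=
    mul_le_mul_of_nonneg_right hy3.le (abs_nonneg _)
  refine le_trans ?_ h3
  rw [← abs_mul]
  have h4 := neg_abs_le ((s y - s x) * (y - x))
  have h5 := abs_nonneg ((s y - s x) * (y - x))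
  rw [abs_le]
  constructor <;> nlinarith

variable {h Z : ℝ → ℝ}

lemma continuousAt_of_strictAnti_rightInverse (hh : StrictAnti h) (hZ : ∀ x, 0 < x → h (Z x) = x)
    {x : ℝ} (hx : 0 < x) : ContinuousAt Z x := by
  refine tendsto_order.2 ⟨fun a ha => ?_, fun a ha => ?_⟩
  · have h1 := hh ha
    rw [hZ x hx] at h1
    filter_upwards [gt_mem_nhds h1, lt_mem_nhds hx] with y hy hy0
    rw [← hZ y hy0] at hy
    exact hh.lt_iff_gt.1 hy
  · have h1 := hh ha
    rw [hZ x hx] at h1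
    filter_upwards [lt_mem_nhds h1, lt_mem_nhds hx] with y hy hy0
    rw [← hZ y hy0] at hy
    exact hh.lt_iff_gt.1 hy

/-- The inverse of a strictly decreasing strictly convex function is strictly convex: reflection in
the diagonal preserves the epigraph of a decreasing function. -/
lemma strictConvexOn_of_strictAnti_rightInverse (hh : StrictAnti h)
    (hconv : StrictConvexOn ℝ Set.univ h) (hZ : ∀ x, 0 < x → h (Z x) = x) :
    StrictConvexOn ℝ (Set.Ioi 0) Z := by
  refine ⟨convex_Ioi 0, fun x hx y hy hxy a b ha hb hab => ?_⟩
  have hne : Z x ≠ Z y := fun he => hxy (by rw [← hZ x hx, ← hZ y hy, he])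
  have h1 := hconv.2 (Set.mem_univ (Z x)) (Set.mem_univ (Z y)) hne ha hb hab
  rw [hZ x hx, hZ y hy, ← hZ _ ((convex_Ioi (0 : ℝ)) hx hy ha.le hb.le hab)] at h1
  exact hh.lt_iff_gt.1 h1

end Supergradient

/-! ### Regularity of the value function -/

section Regularity

variable {Ω : Type*} {mΩ : MeasurableSpace Ω} {n : ℕ} {P : Measure Ω}
  {W : ℝ≥0 → Ω → EuclideanSpace ℝ (Fin n)} {hW : IsStandardBrownian W P}
  {b : ℝ≥0 → EuclideanSpace ℝ (Fin n)} {σ : ℝ≥0 → Matrix (Fin n) (Fin n) ℝ}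
  {K : ProperCone ℝ (EuclideanSpace ℝ (Fin n))} {T t v : ℝ≥0} {U : ℝ → ℝ}

/-- The value function is finite, and its derivative at `x` is `e ^ z`, where `z` is the dual
variable with initial capital `x`. -/
theorem SmoothUtility.hasDerivAt_valueFunction [IsProbabilityMeasure P] [P.IsComplete]
    (hU : SmoothUtility U) (hσ : ContinuousOn σ (Set.Icc 0 T))
    (hσ_det : ∀ s ∈ Set.Icc 0 T, IsUnit (σ s).det)
    (hθ : ParabolicityAssumption b σ K T) (htT : t < T)
    (hv : v = clock (stoppedThetaHat b σ K T) T - clock (stoppedThetaHat b σ K T) t)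
    (hv0 : v ≠ 0) {Z : ℝ → ℝ} (hZ : ∀ x, 0 < x → dualWealth U v (Z x) = x) {x : ℝ} (hx : 0 < x) :
    valueFunction P (brownianFiltration P W hW.measurable) W b σ K U T t x ≠ ⊤ ∧
    HasDerivAt (fun y =>
      (valueFunction P (brownianFiltration P W hW.measurable) W b σ K U T t y).toReal)
      (Real.exp (Z x)) x := by
  set V : ℝ → ℝ≥0∞ := valueFunction P (brownianFiltration P W hW.measurable) W b σ K U T t with hV
  have hup : ∀ y, 0 < y → ∀ z, V y ≤ ENNReal.ofReal (dualValue U v z + Real.exp z * y) :=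
    fun y hy z => hU.valueFunction_le_dualValue (hW := hW) hσ_det hθ htT.le hv hy z
  have hnn : ∀ y, 0 < y → ∀ z, 0 ≤ dualValue U v z + Real.exp z * y := fun y hy z =>
    add_nonneg (integral_nonneg fun g => hU.conjugate_nonneg _) (by positivity)
  have htop : ∀ y, 0 < y → V y ≠ ⊤ := fun y hy =>
    ne_top_of_le_ne_top ENNReal.ofReal_ne_top (hup y hy 0)
  have hle : ∀ y, 0 < y → ∀ z, (V y).toReal ≤ dualValue U v z + Real.exp z * y := fun y hy z =>
    ENNReal.toReal_le_of_le_ofReal (hnn y hy z) (hup y hy z)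
  have hge : ∀ y, 0 < y → dualValue U v (Z y) + Real.exp (Z y) * y ≤ (V y).toReal := by
    intro y hy
    have h := hU.le_valueFunction_dualWealth (hW := hW) hσ hσ_det hθ htT hv hv0 (Z y)
    rw [hZ y hy] at h
    exact (ENNReal.ofReal_le_iff_le_toReal (htop y hy)).1 h
  -- weak duality at `y'` with the multiplier that is optimal at `y`: `e ^ Z(y)` is a supergradient
  have hsuper : ∀ y, 0 < y → ∀ y', 0 < y' →
      (V y').toReal ≤ (V y).toReal + Real.exp (Z y) * (y' - y) := fun y hy y' hy' => by
    linarith [hge y hy, hle y' hy' (Z y)]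
  refine ⟨htop x hx, hasDerivAt_of_supergradient (f := fun y => (V y).toReal)
    (s := fun y => Real.exp (Z y)) ?_ ?_ ?_⟩
  · exact Real.continuous_exp.continuousAt.comp
      (continuousAt_of_strictAnti_rightInverse (hU.strictAnti_dualWealth hv0) hZ hx)
  · filter_upwards [lt_mem_nhds hx] with y hy using hsuper x hx y hy
  · filter_upwards [lt_mem_nhds hx] with y hy using hsuper y hy x hx

end Regularity

end UtilityMax

theorem theorem6p2 {n : ℕ} {Ω : Type*} {mΩ : MeasurableSpace Ω} (P : Measure Ω)
    [IsProbabilityMeasure P] [P.IsComplete]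
    (W : ℝ≥0 → Ω → EuclideanSpace ℝ (Fin n)) (hW : UtilityMax.IsStandardBrownian W P)
    (T : ℝ≥0) (hT : 0 < T)
    (b : ℝ≥0 → EuclideanSpace ℝ (Fin n)) (hb : ContinuousOn b (Set.Icc 0 T))
    (σ : ℝ≥0 → Matrix (Fin n) (Fin n) ℝ) (hσ : ContinuousOn σ (Set.Icc 0 T))
    (hσ_det : ∀ s ∈ Set.Icc 0 T, IsUnit (σ s).det)
    (K : ProperCone ℝ (EuclideanSpace ℝ (Fin n)))
    (U : ℝ → ℝ) (hU : UtilityMax.UtilityAssumption U)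
    (hθ : UtilityMax.ParabolicityAssumption b σ K T)
    (hU_C1 : ContDiffOn ℝ 1 U (Set.Ioi 0))
    (hU_mono : StrictMonoOn U (Set.Ici 0))
    (hU_conc : StrictConcaveOn ℝ (Set.Ici 0) U) :
    let V : ℝ≥0 → ℝ → ℝ≥0∞ := fun t x => UtilityMax.valueFunction P
      (UtilityMax.brownianFiltration P W hW.measurable) W b σ K U T t x
    let Vx : ℝ≥0 → ℝ → ℝ := fun t x => deriv (fun z => (V t z).toReal) x
    (∀ t < T, ∀ x : ℝ, 0 < x →
      V t x ≠ ⊤ ∧ DifferentiableAt ℝ (fun z => (V t z).toReal) x ∧ 0 < Vx t x) ∧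
    (ConvexOn ℝ (Set.Ioi 0) (fun x => Real.log (deriv U x)) →
      ∀ t < T, StrictConvexOn ℝ (Set.Ioi 0) (fun x => Real.log (Vx t x))) ∧
    (ConcaveOn ℝ (Set.Ioi 0) (fun x => Real.log (deriv U x)) →
      ∀ t < T, StrictConcaveOn ℝ (Set.Ioi 0) (fun x => Real.log (Vx t x))) := by
  intro V Vx
  have hSU : UtilityMax.SmoothUtility U := ⟨hU, hU_C1, hU_mono, hU_conc⟩
  have key : ∀ t < T, ∃ Z : ℝ → ℝ,
      (∀ x : ℝ, 0 < x → V t x ≠ ⊤ ∧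
        HasDerivAt (fun z => (V t z).toReal) (Real.exp (Z x)) x) ∧
      (ConvexOn ℝ (Set.Ioi 0) (fun x => Real.log (deriv U x)) →
        StrictConvexOn ℝ (Set.Ioi 0) Z) := by
    intro t ht
    have hv0 : UtilityMax.clock (UtilityMax.stoppedThetaHat b σ K T) T -
        UtilityMax.clock (UtilityMax.stoppedThetaHat b σ K T) t ≠ 0 :=
      (tsub_pos_of_lt (hθ.clock_lt ht)).ne'
    -- `Z x` is the dual variable with initial capital `x`; `V_x(t, x) = e ^ Z(x)`
    choose! Z hZ using fun (x : ℝ) (hx : 0 < x) => hSU.exists_dualWealth_eq hv0 hx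
    exact ⟨Z, fun x hx => hSU.hasDerivAt_valueFunction (hW := hW) hσ hσ_det hθ ht rfl hv0 hZ hx,
      fun hc => UtilityMax.strictConvexOn_of_strictAnti_rightInverse (hSU.strictAnti_dualWealth hv0)
        (hSU.strictConvexOn_dualWealth hv0 (hSU.convexOn_inverseMarginal hc)) hZ⟩
  -- a utility with `ln U'` concave would be bounded, so the last case does not occur
  refine ⟨fun t ht x hx => ?_, fun hc t ht => ?_,
    fun hc => absurd hc hSU.not_concaveOn_log_deriv⟩
  · obtain ⟨Z, hZ, -⟩ := key t ht
    obtain ⟨h1, h2⟩ := hZ x hx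
    refine ⟨h1, h2.differentiableAt, ?_⟩
    change 0 < deriv (fun z => (V t z).toReal) x
    rw [h2.deriv]
    exact Real.exp_pos _
  · obtain ⟨Z, hZ, hconv⟩ := key t ht
    refine (hconv hc).congr fun x hx => ?_
    change Z x = Real.log (deriv (fun z => (V t z).toReal) x)
    rw [(hZ x hx).2.deriv, Real.log_exp]
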